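/- **Setting.** Let $a,c>0$ and let $p(z_1,z_2)=a-z_1+cz_2$ have no zeros on $\mathbb{D}^2$ and at least one zero on $\mathbb{T}^2$. Put $\tilde p(z_1,z_2)=z_1z_2\,\overline{p(1/\bar z_1,1/\bar z_2)}=a z_1z_2-z_2+cz_1$, $\theta_1=\tilde p/p$ and $\Theta=\theta_1^2$ (a rational inner function on $\mathbb{D}^2$ of degree $(2,2)$). Let $\mathcal{K}_\Theta=H^2(\mathbb{D}^2)\ominus\Theta H^2(\mathbb{D}^2)$, where $H^2(\mathbb{D}^2)$ is regarded, through boundary values, as the subspace of $L^2(\mathbb{T}^2)$ of the functions whose Fourier coefficients vanish outside $\mathbb{N}\times\mathbb{N}$ ($0\in\mathbb{N}$), and let $M_{z_j}$ be multiplication by $z_j$. Consider orthogonal decompositions $\mathcal{K}_\Theta=\mathcal{S}_1\oplus\mathcal{S}_2$ with $\mathcal{S}_1,\mathcal{S}_2$ closed, $M_{z_1}\mathcal{S}_1\subseteq\mathcal{S}_1$ and $M_{z_2}\mathcal{S}_2\subseteq\mathcal{S}_2$. For such a decomposition let $S^1_\Theta=P_{\mathcal{S}_2}M_{z_1}|_{\mathcal{S}_2}$,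 with numerical range $\mathcal{W}(S^1_\Theta)=\{\langle S^1_\Theta f,f\rangle: f\in\mathcal{S}_2,\ \|f\|=1\}$. For $\theta\in\mathbb{R}$ put $$c(\theta)=\frac{a+ce^{i\theta}}{a+c},\qquad r(\theta)=\frac{ac(1-\cos\theta)}{(a+c)^2},\qquad s_1(\theta)=\theta-\arcsin\Big(\frac{a}{a+c}\sin\theta\Big),$$ $$E(\theta)=x(\theta)+iy(\theta)=c(\theta)+r(\theta)e^{is_1(\theta)}.$$ **Theorem.** Decompositions $\mathcal{K}_\Theta=\mathcal{S}_1\oplus\mathcal{S}_2$ as above exist, and for every one of them the boundary of $\mathcal{W}(S^1_\Theta)$ is the curve $$\partial\,\mathcal{W}(S^1_\Theta)=\{E(\theta):\theta\in[0,2\pi)\}.$$ Moreover this curve is the outer envelope of the family of circles $\mathcal{C}_\theta$ with centre $c(\theta)$ and radius $r(\theta)$, in the following sense. Write $f(x,y,\theta)=(x-\operatorname{Re}c(\theta))^2+(y-\operatorname{Im}c(\theta))^2-r(\theta)^2$. 1. (Envelope.) For $0<\theta<2\pi$ one has $f_x^2+f_y^2\neq0$ at every point of $\mathcal{C}_\theta$;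 the functions $x,y$ are continuously differentiable on $(0,2\pi)$ with $x'(\theta)^2+y'(\theta)^2\neq0$; and $f=0$ and $f_\theta=0$ at $(x(\theta),y(\theta),\theta)$. 2. (Outer.) For $0<\theta<2\pi$ the point $E(\theta)$ lies outside the closed disk with centre $\frac{a}{a+c}$ and radius $\frac{c}{a+c}$, whose boundary is the circle of the centres $c(\theta)$; and for every $\theta$ the closed disk with centre $c(\theta)$ and radius $r(\theta)$ is contained in the convex hull of the curve $\{E(\theta):\theta\in[0,2\pi)\}$. -/

import Mathlib

open MeasureTheory Set
open scoped ComplexConjugate ENNReal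

noncomputable section

namespace Bidisk

/-! ### The Hardy space of the bidisk

`H²(𝔻²)` is realised, in the usual way through boundary values, as the closed subspace of `L²(𝕋²)`
of the functions whose Fourier coefficients vanish off `ℕ × ℕ`. The torus `𝕋²` is `(ℝ/ℤ)²`, its
points `t` being identified with `(exp (2πi t₀), exp (2πi t₁))`. -/

/-- The torus `𝕋²`, parametrised by angles; index `0` is the variable `z₁`, index `1` is `z₂`. -/
abbrev Torus : Type := UnitAddTorus (Fin 2)

/-- The normalised Lebesgue measure on `𝕋²`. -/
abbrev torusMeasure : Measure Torus := Measure.pi fun _ => AddCircle.haarAddCircle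

/-- `L²(𝕋²)`. -/
abbrev L2 : Type := Lp ℂ 2 torusMeasure

/-- The `j`-th coordinate function, as a continuous function on `𝕋²` with unimodular values. -/
def coord (j : Fin 2) : C(Torus, ℂ) where
  toFun t := (AddCircle.toCircle (t j) : ℂ)
  continuous_toFun := by fun_prop

/-- `M_{z_j}`: multiplication by the `j`-th coordinate. -/
def mulCoord (j : Fin 2) : L2 →L[ℂ] L2 :=
  (ContinuousLinearMap.mul ℂ ℂ).holderL torusMeasure ∞ 2 2
    (ContinuousMap.toLp ∞ torusMeasure ℂ (coord j))

theorem coeFn_mulCoord (j : Fin 2) (f : L2) :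
    mulCoord j f =ᵐ[torusMeasure] fun t => coord j t * f t := by
  have h1 := (ContinuousLinearMap.mul ℂ ℂ).coeFn_holder (r := 2)
    (ContinuousMap.toLp (p := ∞) (μ := torusMeasure) (𝕜 := ℂ) (coord j)) f
  have h2 := ContinuousMap.coeFn_toLp (p := ∞) (𝕜 := ℂ) torusMeasure (coord j)
  filter_upwards [h1, h2] with t ht1 ht2
  rw [← ht2]
  exact ht1

theorem integrable_mFourier_mul (n : Fin 2 → ℤ) (f : L2) :
    Integrable (fun t => UnitAddTorus.mFourier n t * f t) torusMeasure := by
  have hf : Integrable f torusMeasure := (Lp.memLp f).integrable (by norm_num)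
  refine hf.bdd_mul (c := 1) (UnitAddTorus.mFourier n).continuous.aestronglyMeasurable ?_
  refine Filter.Eventually.of_forall fun t => ?_
  exact ((UnitAddTorus.mFourier n).norm_coe_le_norm t).trans_eq UnitAddTorus.mFourier_norm

/-- The Hardy space `H²`: the functions in `L²(𝕋²)` all of whose Fourier coefficients with a
negative frequency (in at least one of the two variables) vanish. -/
def hardy : Submodule ℂ L2 where
  carrier := {f | ∀ n : Fin 2 → ℤ, (∃ j, n j < 0) →
    ∫ t, UnitAddTorus.mFourier (-n) t * f t ∂torusMeasure = 0}
  zero_mem' := by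
    intro n _
    rw [integral_eq_zero_of_ae]
    filter_upwards [Lp.coeFn_zero ℂ 2 torusMeasure] with t ht
    rw [ht]
    simp
  add_mem' := by
    intro f g hf hg n hn
    have h : (fun t => UnitAddTorus.mFourier (-n) t * (f + g : L2) t) =ᵐ[torusMeasure]
        fun t => UnitAddTorus.mFourier (-n) t * f t + UnitAddTorus.mFourier (-n) t * g t := by
      filter_upwards [Lp.coeFn_add f g] with t ht
      rw [ht, Pi.add_apply, mul_add]
    rw [integral_congr_ae h,
      integral_add (integrable_mFourier_mul _ f) (integrable_mFourier_mul _ g), hf n hn, hg n hn,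
      add_zero]
  smul_mem' := by
    intro k f hf n hn
    have h : (fun t => UnitAddTorus.mFourier (-n) t * (k • f : L2) t) =ᵐ[torusMeasure]
        fun t => k * (UnitAddTorus.mFourier (-n) t * f t) := by
      filter_upwards [Lp.coeFn_smul k f] with t ht
      rw [ht, Pi.smul_apply, smul_eq_mul, mul_left_comm]
    rw [integral_congr_ae h, integral_const_mul, hf n hn, mul_zero]

/-- `Θ H²`, for an inner function `Θ` given by its boundary values on `𝕋²`. -/
def innerMulHardy (Θ : Torus → ℂ) : Submodule ℂ L2 where
  carrier := {h | ∃ g ∈ hardy, h =ᵐ[torusMeasure] fun t => Θ t * g t}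
  zero_mem' := by
    refine ⟨0, hardy.zero_mem, ?_⟩
    filter_upwards [Lp.coeFn_zero ℂ 2 torusMeasure] with t ht
    rw [ht]
    simp
  add_mem' := by
    rintro h₁ h₂ ⟨g₁, hg₁, e₁⟩ ⟨g₂, hg₂, e₂⟩
    refine ⟨g₁ + g₂, hardy.add_mem hg₁ hg₂, ?_⟩
    filter_upwards [Lp.coeFn_add h₁ h₂, Lp.coeFn_add g₁ g₂, e₁, e₂] with t k₁ k₂ k₃ k₄
    rw [k₁, k₂, Pi.add_apply, Pi.add_apply, k₃, k₄, mul_add]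
  smul_mem' := by
    rintro k h ⟨g, hg, e⟩
    refine ⟨k • g, hardy.smul_mem k hg, ?_⟩
    filter_upwards [Lp.coeFn_smul k h, Lp.coeFn_smul k g, e] with t k₁ k₂ k₃
    rw [k₁, k₂, Pi.smul_apply, Pi.smul_apply, k₃, smul_eq_mul, smul_eq_mul, mul_left_comm]

/-- The model space `K_Θ = H² ⊖ Θ H²`. -/
def modelSpace (Θ : Torus → ℂ) : Submodule ℂ L2 := hardy ⊓ (innerMulHardy Θ)ᗮ

/-- `K_Θ = S₁ ⊕ S₂` orthogonally, with `S₁` and `S₂` closed and invariant under multiplication by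
`z₁` and by `z₂`, respectively. -/
structure IsInvariantDecomposition (Θ : Torus → ℂ) (S₁ S₂ : Submodule ℂ L2) : Prop where
  isClosed_left : IsClosed (S₁ : Set L2)
  isClosed_right : IsClosed (S₂ : Set L2)
  isOrtho : S₁ ⟂ S₂
  sup_eq : S₁ ⊔ S₂ = modelSpace Θ
  invariant_left : ∀ f ∈ S₁, mulCoord 0 f ∈ S₁
  invariant_right : ∀ f ∈ S₂, mulCoord 1 f ∈ S₂

/-- The compression `P_S T |_S` of an operator `T` to a closed subspace `S`. -/
def compression {H : Type*} [NormedAddCommGroup H] [InnerProductSpace ℂ H] (T : H →L[ℂ] H)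
    (S : Submodule ℂ H) [S.HasOrthogonalProjection] : S →L[ℂ] S :=
  S.orthogonalProjectionOnto ∘L T ∘L S.subtypeL

/-- The numerical range `{⟨T x, x⟩ : ‖x‖ = 1}`; the inner product of Mathlib is linear in its
second argument. -/
def numericalRange {H : Type*} [NormedAddCommGroup H] [InnerProductSpace ℂ H]
    (T : H →L[ℂ] H) : Set ℂ :=
  {w | ∃ x : H, ‖x‖ = 1 ∧ inner ℂ x (T x) = w}

/-! ### The rational inner function -/

/-- `p(z₁, z₂) = a - z₁ + c z₂`. -/
def poly (a c : ℝ) (z₁ z₂ : ℂ) : ℂ := a - z₁ + c * z₂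

/-- The reflection `p̃(z₁, z₂) = z₁ z₂ conj (p (1 / conj z₁, 1 / conj z₂))` of a polynomial of degree
`(1, 1)`, at points with nonzero coordinates (it is only used on `𝕋²`). -/
def reflection (p : ℂ → ℂ → ℂ) (z₁ z₂ : ℂ) : ℂ := z₁ * z₂ * conj (p (1 / conj z₁) (1 / conj z₂))

/-- The boundary values of `θ₁ = p̃ / p`, defined off the zeros of `p` on `𝕋²`. -/
def theta (a c : ℝ) (t : Torus) : ℂ :=
  reflection (poly a c) (coord 0 t) (coord 1 t) / poly a c (coord 0 t) (coord 1 t)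

/-- The boundary values of `Θ = θ₁²`. -/
def bigTheta (a c : ℝ) (t : Torus) : ℂ := theta a c t ^ 2

/-! ### The circles and the curve -/

/-- `c(θ) = (a + c e^{iθ}) / (a + c)`. -/
def center (a c θ : ℝ) : ℂ := (a + c * Complex.exp (θ * Complex.I)) / (a + c)

/-- `r(θ) = a c (1 - cos θ) / (a + c)²`. -/
def radius (a c θ : ℝ) : ℝ := a * c * (1 - Real.cos θ) / (a + c) ^ 2

/-- `s₁(θ) = θ - arcsin ((a / (a + c)) sin θ)`. -/
def angle (a c θ : ℝ) : ℝ := θ - Real.arcsin (a / (a + c) * Real.sin θ)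

/-- `x(θ) + i y(θ) = c(θ) + r(θ) e^{i s₁(θ)}`. -/
def curve (a c θ : ℝ) : ℂ := center a c θ + radius a c θ * Complex.exp (angle a c θ * Complex.I)

/-- The function whose zero set, for fixed `θ`, is the circle with centre `c(θ)` and radius
`r(θ)`. -/
def circleFamily (a c x y θ : ℝ) : ℝ :=
  (x - (center a c θ).re) ^ 2 + (y - (center a c θ).im) ^ 2 - radius a c θ ^ 2

/-- On the parameter set `I` (an open interval), the curve `(x(θ), y(θ))` satisfies the envelope
algorithm for the family of regular curves `f(x, y, θ) = 0`: it is a regular `C¹` curve, and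
`f = 0` and `∂f/∂θ = 0` hold at `(x(θ), y(θ), θ)`. -/
structure IsEnvelopeOn (f : ℝ → ℝ → ℝ → ℝ) (x y : ℝ → ℝ) (I : Set ℝ) : Prop where
  family_regular : ∀ θ ∈ I, ∀ u v, f u v θ = 0 →
    deriv (fun u' => f u' v θ) u ^ 2 + deriv (fun v' => f u v' θ) v ^ 2 ≠ 0
  contDiffOn_x : ContDiffOn ℝ 1 x I
  contDiffOn_y : ContDiffOn ℝ 1 y I
  curve_regular : ∀ θ ∈ I, deriv x θ ^ 2 + deriv y θ ^ 2 ≠ 0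
  mem_curve : ∀ θ ∈ I, f (x θ) (y θ) θ = 0
  hasDerivAt_zero : ∀ θ ∈ I, HasDerivAt (fun θ' => f (x θ) (y θ) θ') 0 θ

end Bidisk

end

noncomputable section

namespace Bidisk

/-! The hypotheses on `p` force `a = 1 + c` (`eq_one_add_of_zeros`), so that `p` vanishes on the
torus only at `(1, -1)`. Call spectrum the support of the Fourier coefficients.

Identifying `S₂`. Every `z₂`-invariant subspace of `K_Θ` lies in `maxInvariant a c 0`, every
`z₁`-invariant one in `maxInvariant a c 1` (`le_maxInvariant`). Almost everywhere on the torus `conj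
p² conj Θ = conj (z₁ z₂)² p²`, and division by `p` or `conj p` does not enlarge the spectrum, by a
maximum principle resting on `a = 1 + c` (`eq_zero_of_norm_le_average`). Hence `f ∈ maxInvariant a c
0` means that `p² f` has spectrum in `{0, 1} × ℕ` (`mem_maxInvariant_iff_denSq`). It follows that
the complement of `maxInvariant a c 0` in `K_Θ` is `z₁`-invariant, so decompositions exist. It also
follows that the two maximal spaces meet in `0`: there `p² f` is a polynomial of bidegree at most
`(1, 1)`, and square integrability of `f` near `(1, -1)` kills it. So `S₂ = maxInvariant a c 0` for
every decomposition.

Slicing. For fixed `z₂ = w ≠ -1`, `Θ(·, w)` is the square of a Blaschke factor `b` with zero `λ(w)`.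
The slices of `f` lie in its two-dimensional model space, with orthonormal basis `k`, `b k`. In
coordinates `(A, B)` the quadratic form of the compressed shift is the integral over `w` of the form
of a triangular `2 × 2` matrix with diagonal `λ` and off-diagonal entry of modulus `1 - |λ|²`; its
numerical range is the disk of centre `λ` and radius `(1 - |λ|²) / 2`. These are the disks `(c(θ),
r(θ))`. Integrating bounds the support function of the numerical range
(`re_inner_mulCoord_le_supportFun`); functions peaking at one `w` show that the bound is sharp
(`slice_form_mem_closure`). Convexity is the Toeplitz–Hausdorff theorem.

Convex geometry. Put `α = a / (a + c)`, `γ = c / (a + c)`, so `α + γ = 1`. In the direction `u` the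
disk of parameter `θ` reaches `α Re u + αγ + γ Re (e^{iθ} conj (u - α))`, which is largest when
`e^{iθ}` is the direction of `u - α`. By the law of sines in the triangle `0, α, u` this says `u =
e^{i s₁(θ)}`, and the contact point is `E(θ)`. Since `α < 1`, the support function is differentiable
on the unit circle, so each supporting line has only one contact point and the boundary is the curve
(`frontier_eq_curve`). -/

/-! ### Fourier coefficients on the torus -/

/-- The Fourier coefficients of a function on `𝕋²`. -/
def coef (f : Torus → ℂ) (n : Fin 2 → ℤ) : ℂ :=
  ∫ t, UnitAddTorus.mFourier (-n) t * f t ∂torusMeasure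

/-- The monomials, as a Hilbert basis of `L²(𝕋²)`. -/
def torusBasis : HilbertBasis (Fin 2 → ℤ) ℂ L2 :=
  UnitAddTorus.mFourierBasis (d := Fin 2)

theorem torusBasis_repr (f : L2) (n : Fin 2 → ℤ) : torusBasis.repr f n = coef f n :=
  UnitAddTorus.mFourierBasis_repr f n

theorem integrable_mFourier_smul (n : Fin 2 → ℤ) {f : Torus → ℂ} (hf : Integrable f torusMeasure) :
    Integrable (fun t => UnitAddTorus.mFourier n t * f t) torusMeasure := by
  refine hf.bdd_mul (c := 1) (UnitAddTorus.mFourier n).continuous.aestronglyMeasurable ?_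
  refine Filter.Eventually.of_forall fun t => ?_
  exact ((UnitAddTorus.mFourier n).norm_coe_le_norm t).trans_eq UnitAddTorus.mFourier_norm

theorem coef_congr {f g : Torus → ℂ} (h : f =ᵐ[torusMeasure] g) (n : Fin 2 → ℤ) :
    coef f n = coef g n := by
  refine integral_congr_ae ?_
  filter_upwards [h] with t ht
  rw [ht]

theorem coef_add {f g : Torus → ℂ} (hf : Integrable f torusMeasure)
    (hg : Integrable g torusMeasure) (n : Fin 2 → ℤ) :
    coef (fun t => f t + g t) n = coef f n + coef g n := by
  simp only [coef, mul_add]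
  exact integral_add (integrable_mFourier_smul _ hf) (integrable_mFourier_smul _ hg)

theorem coef_const_mul (k : ℂ) (f : Torus → ℂ) (n : Fin 2 → ℤ) :
    coef (fun t => k * f t) n = k * coef f n := by
  simp only [coef, mul_left_comm _ k]
  exact integral_const_mul _ _

theorem coef_sub {f g : Torus → ℂ} (hf : Integrable f torusMeasure)
    (hg : Integrable g torusMeasure) (n : Fin 2 → ℤ) :
    coef (fun t => f t - g t) n = coef f n - coef g n := by
  simp only [coef, mul_sub]
  exact integral_sub (integrable_mFourier_smul _ hf) (integrable_mFourier_smul _ hg)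

theorem mFourier_single_eq_coord (j : Fin 2) (t : Torus) :
    UnitAddTorus.mFourier (Pi.single j 1) t = coord j t := by
  rw [UnitAddTorus.mFourier_single, fourier_one]
  rfl

theorem coef_coord_mul (j : Fin 2) (f : Torus → ℂ) (n : Fin 2 → ℤ) :
    coef (fun t => coord j t * f t) n = coef f (n - Pi.single j 1) := by
  simp only [coef]
  congr 1
  ext t
  rw [neg_sub, sub_eq_add_neg, UnitAddTorus.mFourier_add, mFourier_single_eq_coord]
  ring

theorem coef_conj_coord_mul (j : Fin 2) (f : Torus → ℂ) (n : Fin 2 → ℤ) :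
    coef (fun t => conj (coord j t) * f t) n = coef f (n + Pi.single j 1) := by
  simp only [coef]
  congr 1
  ext t
  rw [neg_add, UnitAddTorus.mFourier_add, UnitAddTorus.mFourier_neg (n := Pi.single j 1),
    mFourier_single_eq_coord]
  ring

theorem coef_one (n : Fin 2 → ℤ) : coef (fun _ => 1) n = if n = 0 then 1 else 0 := by
  have h := (orthonormal_iff_ite.mp (UnitAddTorus.orthonormal_mFourier (d := Fin 2))) n 0
  rw [← h]
  simp only [ContinuousMap.inner_toLp, ← UnitAddTorus.mFourier_neg, UnitAddTorus.mFourier_zero]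
  simp only [coef, mul_one, ContinuousMap.one_apply, one_mul]
  rfl

theorem hasSum_coef_inner (f g : L2) :
    HasSum (fun n => conj (coef f n) * coef g n) (inner ℂ f g) := by
  have h := UnitAddTorus.hasSum_prod_mFourierCoeff (d := Fin 2) f g
  rw [MeasureTheory.L2.inner_def]
  simp only [RCLike.inner_apply, mul_comm _ (conj _)]
  exact h

theorem inner_eq_zero_of_coef {f g : L2} (h : ∀ n, coef f n = 0 ∨ coef g n = 0) :
    inner ℂ f g = 0 := by
  refine (hasSum_coef_inner f g).unique ?_
  convert hasSum_zero using 2 with n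
  rcases h n with h | h <;> simp [h]

theorem L2_ext {f g : L2} (h : ∀ n, coef f n = coef g n) : f = g := by
  apply torusBasis.repr.injective
  ext n
  rw [torusBasis_repr, torusBasis_repr, h]

theorem coef_toLp {f : Torus → ℂ} (hf : MemLp f 2 torusMeasure) (n : Fin 2 → ℤ) :
    coef (hf.toLp f) n = coef f n :=
  coef_congr hf.coeFn_toLp n

theorem ae_eq_of_coef {f g : Torus → ℂ} (hf : MemLp f 2 torusMeasure)
    (hg : MemLp g 2 torusMeasure) (h : ∀ n, coef f n = coef g n) : f =ᵐ[torusMeasure] g := by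
  rw [← hf.toLp_eq_toLp_iff hg]
  refine L2_ext fun n => ?_
  rw [coef_toLp, coef_toLp, h]

/-- Parseval. The decay makes suprema of coefficients attained, which the maximum principle below
needs. -/
theorem tendsto_coef {f : Torus → ℂ} (hf : MemLp f 2 torusMeasure) :
    Filter.Tendsto (coef f) Filter.cofinite (nhds 0) := by
  have h := (UnitAddTorus.hasSum_sq_mFourierCoeff (d := Fin 2) (hf.toLp f)).summable
  have h2 := h.tendsto_cofinite_zero
  rw [tendsto_zero_iff_norm_tendsto_zero]
  have h3 := h2.sqrt
  simp only [Real.sqrt_zero, Real.sqrt_sq (norm_nonneg _)] at h3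
  refine h3.congr fun n => ?_
  exact congrArg norm (coef_toLp hf n)

open Classical in
/-- The restriction of the spectrum to a set of frequencies. -/
theorem exists_coef_restrict (R : Set (Fin 2 → ℤ)) (f : L2) :
    ∃ g : L2, ∀ n, coef g n = if n ∈ R then coef f n else 0 := by
  have hm : Memℓp (fun n => if n ∈ R then coef f n else 0) 2 := by
    refine memℓp_gen ?_
    have h := (torusBasis.repr f).2.summable (p := 2) (by norm_num)
    refine h.of_nonneg_of_le (fun n => by positivity) fun n => ?_
    rw [← torusBasis_repr]
    split_ifs
    · exact le_rfl
    · simp only [norm_zero]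
      rw [Real.zero_rpow (by norm_num)]
      positivity
  refine ⟨torusBasis.repr.symm ⟨_, hm⟩, fun n => ?_⟩
  rw [← torusBasis_repr, LinearIsometryEquiv.apply_symm_apply]

/-- A maximum principle: a family tending to zero, whose values on a set stable under `s₁`, `s₂`
are dominated by averages over the images under `s₁`, `s₂`, vanishes on that set. -/
theorem eq_zero_of_norm_le_average {ι : Type*} {u : ι → ℂ}
    (hu : Filter.Tendsto u Filter.cofinite (nhds 0)) {R : Set ι} {s₁ s₂ : ι → ι}
    (h₁ : ∀ n ∈ R, s₁ n ∈ R) (h₂ : ∀ n ∈ R, s₂ n ∈ R)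
    (hs : ∀ n, Function.Injective fun k : ℕ => s₁^[k] n) {a c : ℝ} (hc : 0 ≤ c) (hac : a = 1 + c)
    (h : ∀ n ∈ R, a * ‖u n‖ ≤ ‖u (s₁ n)‖ + c * ‖u (s₂ n)‖) : ∀ n ∈ R, u n = 0 := by
  by_contra! ⟨n₀, hn₀, hne⟩
  have hpos : 0 < ‖u n₀‖ := norm_pos_iff.mpr hne
  have hfin : ∀ ε > 0, {n | ε ≤ ‖u n‖}.Finite := by
    intro ε hε
    have := hu (Metric.ball_mem_nhds 0 hε)
    rw [Filter.mem_map, Filter.mem_cofinite] at this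
    refine this.subset fun n hn => ?_
    simpa using hn
  have hfin' : (R ∩ {n | ‖u n₀‖ ≤ ‖u n‖}).Finite := (hfin _ hpos).inter_of_right _
  -- Only finitely many values are as large as the one at `n₀`, so the supremum over `R` is
  -- attained.
  obtain ⟨m, ⟨hmR, hm⟩, hmax⟩ := hfin'.exists_maximalFor (fun n => ‖u n‖) _ ⟨n₀, hn₀, le_refl ‖u n₀‖⟩
  have hle : ∀ n ∈ R, ‖u n‖ ≤ ‖u m‖ := by
    intro n hn
    by_cases hn' : ‖u n₀‖ ≤ ‖u n‖
    · by_contra! hlt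
      exact absurd (hmax ⟨hn, hn'⟩ hlt.le) (not_le.mpr hlt)
    · exact (not_le.mp hn').le.trans hm
  -- As `a = 1 + c`, a maximum at a point forces the same value at its image under `s₁`. The whole
  -- infinite orbit then carries the maximum, against convergence to zero.
  have horb : ∀ k : ℕ, s₁^[k] m ∈ R ∧ ‖u (s₁^[k] m)‖ = ‖u m‖ := by
    intro k
    induction k with
    | zero => exact ⟨hmR, rfl⟩
    | succ k ih =>
      rw [Function.iterate_succ_apply']
      refine ⟨h₁ _ ih.1, le_antisymm (hle _ (h₁ _ ih.1)) ?_⟩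
      have h3 := h _ ih.1
      have h4 := hle _ (h₂ _ ih.1)
      rw [ih.2, hac] at h3
      nlinarith
  have hinf := Set.infinite_range_of_injective (hs m)
  refine hinf ((hfin ‖u m‖ (hpos.trans_le hm)).subset ?_)
  rintro _ ⟨k, rfl⟩
  exact (horb k).2.ge

/-! ### The circle -/

theorem toCircle_half : (AddCircle.toCircle ((1 / 2 : ℝ) : UnitAddCircle) : ℂ) = -1 := by
  rw [AddCircle.toCircle_apply_mk, Circle.coe_exp]
  rw [show ((2 * Real.pi / 1 * (1 / 2) : ℝ) : ℂ) = Real.pi by push_cast; ring]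
  exact Complex.exp_pi_mul_I

instance : Nontrivial UnitAddCircle := by
  refine ⟨((1 / 2 : ℝ) : UnitAddCircle), 0, fun h => ?_⟩
  have h1 := toCircle_half
  rw [h, AddCircle.toCircle_zero, Circle.coe_one] at h1
  norm_num at h1

/-- Needed to discard the slice `z₂ = -1`, the only one on which `p` has a zero in the closed disk.
-/
instance : NullSingletonClass (AddCircle.haarAddCircle (T := (1 : ℝ))) := by
  have : (nhdsWithin (0 : UnitAddCircle) {0}ᶜ).NeBot :=
    ConnectedSpace.neBot_nhdsWithin_compl_of_nontrivial_of_t1space 0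
  infer_instance

theorem ae_toCircle_ne (w : ℂ) :
    ∀ᵐ x ∂(AddCircle.haarAddCircle (T := (1 : ℝ))), (AddCircle.toCircle x : ℂ) ≠ w := by
  rw [ae_iff]
  refine Set.Subsingleton.measure_zero ?_ _
  intro x hx y hy
  simp only [ne_eq, not_not, mem_ofPred_eq] at hx hy
  exact AddCircle.injective_toCircle one_ne_zero (Subtype.ext (hx.trans hy.symm))

theorem ae_coord_ne (j : Fin 2) (w : ℂ) : ∀ᵐ t ∂torusMeasure, coord j t ≠ w :=
  (Measure.quasiMeasurePreserving_eval (fun _ : Fin 2 => AddCircle.haarAddCircle) j).ae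
    (ae_toCircle_ne w)

theorem norm_coord (j : Fin 2) (t : Torus) : ‖coord j t‖ = 1 :=
  Circle.norm_coe _

theorem coord_mul_conj (j : Fin 2) (t : Torus) : coord j t * conj (coord j t) = 1 := by
  rw [Complex.mul_conj', norm_coord]; norm_num

/-! ### The denominator and the inner function on the torus -/

/-- The boundary values of `p`. -/
def den (a c : ℝ) (t : Torus) : ℂ := poly a c (coord 0 t) (coord 1 t)

theorem continuous_den (a c : ℝ) : Continuous (den a c) := by
  unfold den poly
  fun_prop

/-- A zero has `z = a + c w`, and `|a + c w| ≥ a - c = 1`, with equality only at `w = -1`. -/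
theorem poly_ne_zero {a c : ℝ} (hc : 0 < c) (hac : a = 1 + c) {z w : ℂ} (hz : ‖z‖ ≤ 1)
    (hw : ‖w‖ = 1) (hw' : w ≠ -1) : poly a c z w ≠ 0 := by
  intro h
  have h1 : z = a + c * w := by unfold poly at h; linear_combination -h
  have hn : w.re ^ 2 + w.im ^ 2 = 1 := by
    have := Complex.sq_norm w
    rw [hw, Complex.normSq_apply] at this
    nlinarith
  have hz2 : z.re ^ 2 + z.im ^ 2 ≤ 1 := by
    have := Complex.sq_norm z
    rw [Complex.normSq_apply] at this
    nlinarith [norm_nonneg z]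
  have hre : z.re = a + c * w.re := by rw [h1]; simp
  have him : z.im = c * w.im := by rw [h1]; simp
  rw [hre, him] at hz2
  have h3 : w.re ≤ -1 := by
    subst hac
    by_contra! h
    nlinarith [mul_pos hc (by linarith : 0 < c + 1), mul_pos (mul_pos hc (by linarith : 0 < c + 1)) (by linarith : 0 < w.re + 1)]
  have h4 : w.re = -1 := by nlinarith [sq_nonneg w.im]
  have h5 : w.im = 0 := by nlinarith [sq_nonneg w.im]
  exact hw' (Complex.ext (by simp [h4]) (by simp [h5]))

theorem den_ne_zero {a c : ℝ} (hc : 0 < c) (hac : a = 1 + c) {t : Torus} (h : coord 1 t ≠ -1) :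
    den a c t ≠ 0 :=
  poly_ne_zero hc hac (norm_coord 0 t).le (norm_coord 1 t) h

theorem ae_den_ne_zero {a c : ℝ} (hc : 0 < c) (hac : a = 1 + c) :
    ∀ᵐ t ∂torusMeasure, den a c t ≠ 0 := by
  filter_upwards [ae_coord_ne 1 (-1)] with t ht
  exact den_ne_zero hc hac ht

theorem theta_eq (a c : ℝ) (t : Torus) :
    theta a c t = coord 0 t * coord 1 t * conj (den a c t) / den a c t := by
  have h : ∀ j, 1 / conj (coord j t) = coord j t := fun j => by
    have h1 := coord_mul_conj j t
    rw [one_div]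
    exact inv_eq_of_mul_eq_one_left h1
  rw [theta, reflection, h, h, den]

theorem norm_theta {a c : ℝ} {t : Torus} (h : den a c t ≠ 0) : ‖theta a c t‖ = 1 := by
  rw [theta_eq, norm_div, norm_mul, norm_mul, norm_coord, norm_coord, RCLike.norm_conj]
  rw [one_mul, one_mul, div_self (norm_ne_zero_iff.mpr h)]

theorem measurable_theta (a c : ℝ) : Measurable (theta a c) := by
  have h : theta a c = fun t => coord 0 t * coord 1 t * conj (den a c t) / den a c t :=
    funext (theta_eq a c)
  rw [h]
  have h1 := (continuous_den a c)
  refine Measurable.div (Continuous.measurable ?_) h1.measurable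
  fun_prop

theorem measurable_bigTheta (a c : ℝ) : Measurable (bigTheta a c) :=
  (measurable_theta a c).pow_const 2

theorem norm_bigTheta {a c : ℝ} {t : Torus} (h : den a c t ≠ 0) : ‖bigTheta a c t‖ = 1 := by
  rw [bigTheta, norm_pow, norm_theta h, one_pow]

theorem ae_norm_bigTheta {a c : ℝ} (hc : 0 < c) (hac : a = 1 + c) :
    ∀ᵐ t ∂torusMeasure, ‖bigTheta a c t‖ = 1 := by
  filter_upwards [ae_den_ne_zero hc hac] with t ht using norm_bigTheta ht

theorem MemLp.of_bdd_mul {u f : Torus → ℂ} (hf : MemLp f 2 torusMeasure)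
    (hu : AEStronglyMeasurable u torusMeasure) {C : ℝ} (h : ∀ᵐ t ∂torusMeasure, ‖u t‖ ≤ C) :
    MemLp (fun t => u t * f t) 2 torusMeasure := by
  refine hf.of_le_mul (c := C) (hu.mul hf.1) ?_
  filter_upwards [h] with t ht
  rw [norm_mul]
  gcongr

theorem MemLp.continuous_mul {u f : Torus → ℂ} (hf : MemLp f 2 torusMeasure)
    (hu : Continuous u) : MemLp (fun t => u t * f t) 2 torusMeasure := by
  obtain ⟨C, hC⟩ := isCompact_univ.exists_bound_of_continuousOn hu.continuousOn
  exact MemLp.of_bdd_mul hf hu.aestronglyMeasurable (Filter.Eventually.of_forall fun t => hC t trivial)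

theorem MemLp.den_mul {f : Torus → ℂ} (hf : MemLp f 2 torusMeasure) (a c : ℝ) :
    MemLp (fun t => den a c t * f t) 2 torusMeasure :=
  MemLp.continuous_mul hf (continuous_den a c)

theorem MemLp.conj_den_mul {f : Torus → ℂ} (hf : MemLp f 2 torusMeasure) (a c : ℝ) :
    MemLp (fun t => conj (den a c t) * f t) 2 torusMeasure :=
  MemLp.continuous_mul hf (by have := continuous_den a c; fun_prop)

theorem MemLp.bigTheta_mul {a c : ℝ} (hc : 0 < c) (hac : a = 1 + c) {f : Torus → ℂ}
    (hf : MemLp f 2 torusMeasure) :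
    MemLp (fun t => bigTheta a c t * f t) 2 torusMeasure :=
  MemLp.of_bdd_mul hf (measurable_bigTheta a c).aestronglyMeasurable
    ((ae_norm_bigTheta hc hac).mono fun _ h => h.le)

theorem MemLp.conj_bigTheta_mul {a c : ℝ} (hc : 0 < c) (hac : a = 1 + c) {f : Torus → ℂ}
    (hf : MemLp f 2 torusMeasure) :
    MemLp (fun t => conj (bigTheta a c t) * f t) 2 torusMeasure :=
  MemLp.of_bdd_mul hf (RCLike.continuous_conj.measurable.comp
    (measurable_bigTheta a c)).aestronglyMeasurable
    ((ae_norm_bigTheta hc hac).mono fun _ h => by rw [RCLike.norm_conj]; exact h.le)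

/-- The two unit frequencies. -/
abbrev unitFreq (j : Fin 2) : Fin 2 → ℤ := Pi.single j 1

/-- Multiplication by `p` is a three-term recurrence on coefficients; where it vanishes, it
expresses `a` times a coefficient through two neighbours with weights `1` and `c`. -/
theorem coef_den_mul (a c : ℝ) {f : Torus → ℂ} (hf : MemLp f 2 torusMeasure) (n : Fin 2 → ℤ) :
    coef (fun t => den a c t * f t) n =
      a * coef f n - coef f (n - unitFreq 0) + c * coef f (n - unitFreq 1) := by
  have hi : ∀ {g : Torus → ℂ}, MemLp g 2 torusMeasure → Integrable g torusMeasure :=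
    fun h => h.integrable (by norm_num)
  have h0 := MemLp.continuous_mul hf (coord 0).continuous
  have h1 := MemLp.continuous_mul hf (coord 1).continuous
  have h2 : MemLp (fun t => a * f t - coord 0 t * f t) 2 torusMeasure := (hf.const_mul _).sub h0
  rw [show (fun t => den a c t * f t) =
    fun t => (a * f t - coord 0 t * f t) + c * (coord 1 t * f t) by
      ext t; simp only [den, poly]; ring]
  rw [coef_add (hi h2) (hi (h1.const_mul _)),
    coef_sub (hi (hf.const_mul _)) (hi h0), coef_const_mul, coef_const_mul, coef_coord_mul,
    coef_coord_mul]

theorem coef_conj_den_mul (a c : ℝ) {f : Torus → ℂ} (hf : MemLp f 2 torusMeasure)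
    (n : Fin 2 → ℤ) :
    coef (fun t => conj (den a c t) * f t) n =
      a * coef f n - coef f (n + unitFreq 0) + c * coef f (n + unitFreq 1) := by
  have hi : ∀ {g : Torus → ℂ}, MemLp g 2 torusMeasure → Integrable g torusMeasure :=
    fun h => h.integrable (by norm_num)
  have h0 : MemLp (fun t => conj (coord 0 t) * f t) 2 torusMeasure :=
    MemLp.continuous_mul hf (by fun_prop)
  have h1 : MemLp (fun t => conj (coord 1 t) * f t) 2 torusMeasure :=
    MemLp.continuous_mul hf (by fun_prop)
  have h2 : MemLp (fun t => a * f t - conj (coord 0 t) * f t) 2 torusMeasure :=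
    (hf.const_mul _).sub h0
  rw [show (fun t => conj (den a c t) * f t) =
    fun t => (a * f t - conj (coord 0 t) * f t) + c * (conj (coord 1 t) * f t) by
      ext t; simp only [den, poly, map_add, map_sub, map_mul, Complex.conj_ofReal]; ring]
  rw [coef_add (hi h2) (hi (h1.const_mul _)),
    coef_sub (hi (hf.const_mul _)) (hi h0), coef_const_mul, coef_const_mul, coef_conj_coord_mul,
    coef_conj_coord_mul]

theorem norm_mul_le_of_combination {a c : ℝ} (ha : 0 ≤ a) (hc : 0 ≤ c) {x y z : ℂ}
    (h : a * x - y + c * z = 0) : a * ‖x‖ ≤ ‖y‖ + c * ‖z‖ := by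
  have h1 : (a : ℂ) * x = y - c * z := by linear_combination h
  calc a * ‖x‖ = ‖(a : ℂ) * x‖ := by simp [abs_of_nonneg ha]
    _ ≤ ‖y‖ + ‖(c : ℂ) * z‖ := by rw [h1]; exact norm_sub_le _ _
    _ = ‖y‖ + c * ‖z‖ := by simp [abs_of_nonneg hc]

theorem iterate_add_right_injective {e : Fin 2 → ℤ} (he : e ≠ 0) (n : Fin 2 → ℤ) :
    Function.Injective fun k : ℕ => (fun m => m + e)^[k] n := by
  have h : ∀ k : ℕ, (fun m => m + e)^[k] n = n + k • e := by
    intro k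
    induction k with
    | zero => simp
    | succ k ih => rw [Function.iterate_succ_apply', ih, succ_nsmul, add_assoc]
  intro k l hkl
  simp only [h, add_right_inj] at hkl
  obtain ⟨i, hi⟩ := Function.ne_iff.mp he
  have := congrFun hkl i
  simp only [Pi.smul_apply, nsmul_eq_mul] at this
  exact_mod_cast mul_right_cancel₀ hi this

/-- Division by `p` does not enlarge the spectrum beyond a set stable under raising frequencies. -/
theorem coef_eq_zero_of_den_mul {a c : ℝ} (hc : 0 < c) (hac : a = 1 + c) {f : Torus → ℂ}
    (hf : MemLp f 2 torusMeasure) {R : Set (Fin 2 → ℤ)} (hR : ∀ n ∈ R, ∀ j, n - unitFreq j ∈ R)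
    (h : ∀ n ∈ R, coef (fun t => den a c t * f t) n = 0) : ∀ n ∈ R, coef f n = 0 := by
  refine eq_zero_of_norm_le_average (tendsto_coef hf) (s₁ := fun n => n + -unitFreq 0)
    (s₂ := fun n => n + -unitFreq 1) ?_ ?_ ?_ hc.le hac ?_
  · intro n hn; simpa only [← sub_eq_add_neg] using hR n hn 0
  · intro n hn; simpa only [← sub_eq_add_neg] using hR n hn 1
  · exact iterate_add_right_injective (by simp)
  · intro n hn
    have h1 := h n hn
    rw [coef_den_mul a c hf] at h1
    simp only [← sub_eq_add_neg]
    exact norm_mul_le_of_combination (by linarith) hc.le h1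

/-- The mirror image: `conj p` involves the neighbours of higher frequency, so the set must be
stable under raising frequencies. -/
theorem coef_eq_zero_of_conj_den_mul {a c : ℝ} (hc : 0 < c) (hac : a = 1 + c) {f : Torus → ℂ}
    (hf : MemLp f 2 torusMeasure) {R : Set (Fin 2 → ℤ)} (hR : ∀ n ∈ R, ∀ j, n + unitFreq j ∈ R)
    (h : ∀ n ∈ R, coef (fun t => conj (den a c t) * f t) n = 0) : ∀ n ∈ R, coef f n = 0 := by
  refine eq_zero_of_norm_le_average (tendsto_coef hf) (s₁ := fun n => n + unitFreq 0)
    (s₂ := fun n => n + unitFreq 1) (fun n hn => hR n hn 0) (fun n hn => hR n hn 1) ?_ hc.le hac ?_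
  · exact iterate_add_right_injective (by simp)
  · intro n hn
    have h1 := h n hn
    rw [coef_conj_den_mul a c hf] at h1
    exact norm_mul_le_of_combination (by linarith) hc.le h1

/-! ### The model space and its maximal invariant subspaces -/

theorem inner_eq_integral_of_ae {h f : L2} {u : Torus → ℂ} (hu : h =ᵐ[torusMeasure] u) :
    inner ℂ h f = ∫ t, conj (u t) * f t ∂torusMeasure := by
  rw [MeasureTheory.L2.inner_def]
  refine integral_congr_ae ?_
  filter_upwards [hu] with t ht
  rw [RCLike.inner_apply, ht, mul_comm]

theorem inner_eq_coef_of_ae {Θ : Torus → ℂ} {h f : L2} {n : Fin 2 → ℤ}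
    (hh : h =ᵐ[torusMeasure] fun t => Θ t * UnitAddTorus.mFourier n t) :
    inner ℂ h f = coef (fun t => conj (Θ t) * f t) n := by
  rw [inner_eq_integral_of_ae hh, coef]
  congr 1
  ext t
  rw [UnitAddTorus.mFourier_neg, map_mul]
  ring

theorem memLp_mFourier (n : Fin 2 → ℤ) :
    MemLp (fun t => UnitAddTorus.mFourier n t) 2 torusMeasure := by
  refine MemLp.of_bound (UnitAddTorus.mFourier n).continuous.aestronglyMeasurable 1 ?_
  refine Filter.Eventually.of_forall fun t => ?_
  exact ((UnitAddTorus.mFourier n).norm_coe_le_norm t).trans_eq UnitAddTorus.mFourier_norm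

theorem coef_mFourier (m n : Fin 2 → ℤ) :
    coef (fun t => UnitAddTorus.mFourier m t) n = if n = m then 1 else 0 := by
  have h : coef (fun t => UnitAddTorus.mFourier m t) n = coef (fun _ => 1) (n - m) := by
    simp only [coef]
    congr 1
    ext t
    rw [mul_one, neg_sub, sub_eq_add_neg, UnitAddTorus.mFourier_add, mul_comm]
  rw [h, coef_one]
  simp only [sub_eq_zero]

theorem exists_inner_mul_mFourier {a c : ℝ} (hc : 0 < c) (hac : a = 1 + c) (n : Fin 2 → ℤ) :
    ∃ h : L2, h =ᵐ[torusMeasure] fun t => bigTheta a c t * UnitAddTorus.mFourier n t :=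
  ⟨(MemLp.bigTheta_mul hc hac (memLp_mFourier n)).toLp _, MemLp.coeFn_toLp _⟩

theorem mem_hardy {f : L2} : f ∈ hardy ↔ ∀ n : Fin 2 → ℤ, (∃ j, n j < 0) → coef f n = 0 :=
  Iff.rfl

theorem isClosed_hardy : IsClosed (hardy : Set L2) := by
  have h : (hardy : Set L2) = ⋂ n : {n : Fin 2 → ℤ // ∃ j, n j < 0},
      {f | inner ℂ (torusBasis n.1) f = 0} := by
    ext f
    simp only [SetLike.mem_coe, mem_hardy, mem_iInter, Subtype.forall, ← torusBasis_repr,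
      HilbertBasis.repr_apply_apply]
    rfl
  rw [h]
  exact isClosed_iInter fun n => isClosed_eq (by fun_prop) continuous_const

/-- For the largest subspaces of the model space which are invariant under multiplication by one of
the variables: the functions `f` in the Hardy space for which the spectrum of `conj Θ * f` is
contained in the half plane where the `j`-th frequency is negative. -/
def maxInvariant (a c : ℝ) (j : Fin 2) : Submodule ℂ L2 :=
  hardy ⊓ (Submodule.span ℂ {h : L2 | ∃ n : Fin 2 → ℤ, 0 ≤ n j ∧
    h =ᵐ[torusMeasure] fun t => bigTheta a c t * UnitAddTorus.mFourier n t})ᗮ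

theorem isClosed_maxInvariant (a c : ℝ) (j : Fin 2) :
    IsClosed (maxInvariant a c j : Set L2) := by
  rw [maxInvariant, Submodule.coe_inf]
  exact isClosed_hardy.inter (Submodule.isClosed_orthogonal _)

theorem mem_maxInvariant {a c : ℝ} (hc : 0 < c) (hac : a = 1 + c) {j : Fin 2} {f : L2} :
    f ∈ maxInvariant a c j ↔ f ∈ hardy ∧ ∀ n : Fin 2 → ℤ, 0 ≤ n j →
      coef (fun t => conj (bigTheta a c t) * f t) n = 0 := by
  rw [maxInvariant, Submodule.mem_inf]
  refine and_congr_right fun _ => ⟨fun h n hn => ?_, fun h => ?_⟩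
  · obtain ⟨g, hg⟩ := exists_inner_mul_mFourier hc hac n
    rw [← inner_eq_coef_of_ae hg]
    exact h g (Submodule.subset_span ⟨n, hn, hg⟩)
  · rw [Submodule.mem_orthogonal]
    intro u hu
    induction hu using Submodule.span_induction with
    | mem x hx =>
      obtain ⟨n, hn, hx⟩ := hx
      rw [inner_eq_coef_of_ae hx, h n hn]
    | zero => exact inner_zero_left _
    | add x y _ _ hx hy => rw [inner_add_left, hx, hy, add_zero]
    | smul k x _ hx => rw [inner_smul_left, hx, mul_zero]

/-- Testing against `Θ zⁿ` with `n ≥ 0` suffices: `⟨Θ g, f⟩ = ⟨g, conj Θ f⟩`, and Parseval reduces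
this to the nonnegative frequencies of `conj Θ f`. -/
theorem mem_modelSpace {a c : ℝ} (hc : 0 < c) (hac : a = 1 + c) {f : L2} :
    f ∈ modelSpace (bigTheta a c) ↔ f ∈ hardy ∧ ∀ n : Fin 2 → ℤ, (∀ j, 0 ≤ n j) →
      coef (fun t => conj (bigTheta a c t) * f t) n = 0 := by
  rw [modelSpace, Submodule.mem_inf]
  refine and_congr_right fun _ => ⟨fun h n hn => ?_, fun h => ?_⟩
  · obtain ⟨g, hg⟩ := exists_inner_mul_mFourier hc hac n
    rw [← inner_eq_coef_of_ae hg]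
    refine h g ⟨(memLp_mFourier n).toLp _, ?_, ?_⟩
    · intro m ⟨j, hj⟩
      change coef _ m = 0
      rw [coef_toLp, coef_mFourier, if_neg]
      rintro rfl
      exact absurd (hn j) (not_le.mpr hj)
    · filter_upwards [hg, (memLp_mFourier n).coeFn_toLp] with t h1 h2
      rw [h1, h2]
  · rw [Submodule.mem_orthogonal]
    rintro u ⟨g, hg, hu⟩
    have hf := MemLp.conj_bigTheta_mul hc hac (Lp.memLp f)
    have h1 : inner ℂ u f = inner ℂ g (hf.toLp _) := by
      rw [inner_eq_integral_of_ae hu, inner_eq_integral_of_ae (Filter.EventuallyEq.refl _ _)]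
      refine integral_congr_ae ?_
      filter_upwards [hf.coeFn_toLp] with t ht
      rw [ht, map_mul]
      ring
    rw [h1]
    refine inner_eq_zero_of_coef fun n => ?_
    by_cases hn : ∀ j, 0 ≤ n j
    · right; rw [coef_toLp, h n hn]
    · left; push Not at hn; exact hg n hn

theorem maxInvariant_le {a c : ℝ} (hc : 0 < c) (hac : a = 1 + c) (j : Fin 2) :
    maxInvariant a c j ≤ modelSpace (bigTheta a c) := by
  intro f hf
  rw [mem_maxInvariant hc hac] at hf
  rw [mem_modelSpace hc hac]
  exact ⟨hf.1, fun n hn => hf.2 n (hn j)⟩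

theorem coef_mulCoord (j : Fin 2) (f : L2) (n : Fin 2 → ℤ) :
    coef (mulCoord j f) n = coef f (n - unitFreq j) := by
  rw [coef_congr (coeFn_mulCoord j f), coef_coord_mul]

theorem coef_conj_mul_mulCoord (Θ : Torus → ℂ) (j : Fin 2) (f : L2) (n : Fin 2 → ℤ) :
    coef (fun t => conj (Θ t) * mulCoord j f t) n =
      coef (fun t => conj (Θ t) * f t) (n - unitFreq j) := by
  rw [← coef_coord_mul]
  refine coef_congr ?_ n
  filter_upwards [coeFn_mulCoord j f] with t ht
  rw [ht]
  ring

theorem mulCoord_mem_hardy (j : Fin 2) {f : L2} (hf : f ∈ hardy) : mulCoord j f ∈ hardy := by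
  rintro n ⟨i, hi⟩
  change coef _ n = 0
  rw [coef_mulCoord]
  refine hf _ ⟨i, ?_⟩
  have : 0 ≤ unitFreq j i := by
    by_cases h : i = j
    · subst h; simp
    · simp [h]
  simp only [Pi.sub_apply]
  lia

theorem mulCoord_mem_maxInvariant {a c : ℝ} (hc : 0 < c) (hac : a = 1 + c) {i j : Fin 2}
    (hij : j ≠ i) {f : L2} (hf : f ∈ maxInvariant a c j) : mulCoord i f ∈ maxInvariant a c j := by
  rw [mem_maxInvariant hc hac] at hf ⊢
  refine ⟨mulCoord_mem_hardy i hf.1, fun n hn => ?_⟩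
  rw [coef_conj_mul_mulCoord]
  refine hf.2 _ ?_
  simpa [hij] using hn

/-- An invariant subspace of the model space lies in the maximal one. -/
theorem le_maxInvariant {a c : ℝ} (hc : 0 < c) (hac : a = 1 + c) {i j : Fin 2} (hij : j ≠ i)
    {S : Submodule ℂ L2} (hS : S ≤ modelSpace (bigTheta a c))
    (hinv : ∀ f ∈ S, mulCoord i f ∈ S) : S ≤ maxInvariant a c j := by
  intro f hf
  have h0 := (mem_modelSpace hc hac).1 (hS hf)
  rw [mem_maxInvariant hc hac]
  refine ⟨h0.1, fun n hn => ?_⟩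
  have hiter : ∀ k : ℕ, ∃ g ∈ S, ∀ m, coef (fun t => conj (bigTheta a c t) * g t) m =
      coef (fun t => conj (bigTheta a c t) * f t) (m - k • unitFreq i) := by
    intro k
    induction k with
    | zero => exact ⟨f, hf, fun m => by simp⟩
    | succ k ih =>
      obtain ⟨g, hg, h⟩ := ih
      refine ⟨_, hinv g hg, fun m => ?_⟩
      rw [coef_conj_mul_mulCoord, h, succ_nsmul']
      congr 1
      abel
  -- Multiplying by `z_i` often enough moves the frequency `n` into the nonnegative quadrant, where
  -- membership in the model space gives zero.
  obtain ⟨g, hg, h⟩ := hiter (-n i).toNat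
  have h1 := h (n + (-n i).toNat • unitFreq i)
  rw [add_sub_cancel_right] at h1
  rw [← h1]
  refine ((mem_modelSpace hc hac).1 (hS hg)).2 _ fun k => ?_
  by_cases hk : k = i
  · subst hk
    simp
    lia
  · have hkj : k = j := by lia
    subst hkj
    simpa [hk] using hn

/-! ### The maximal invariant subspaces in terms of `p² f` -/

theorem coef_den_mul_congr (a c : ℝ) {f g : Torus → ℂ} (hf : MemLp f 2 torusMeasure)
    (hg : MemLp g 2 torusMeasure) {n : Fin 2 → ℤ} (h : coef f n = coef g n)
    (hs : ∀ j, coef f (n - unitFreq j) = coef g (n - unitFreq j)) :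
    coef (fun t => den a c t * f t) n = coef (fun t => den a c t * g t) n := by
  rw [coef_den_mul a c hf, coef_den_mul a c hg, h, hs, hs]

theorem coef_den_mul_eq_zero (a c : ℝ) {f : Torus → ℂ} (hf : MemLp f 2 torusMeasure)
    {n : Fin 2 → ℤ} (h : coef f n = 0) (hs : ∀ j, coef f (n - unitFreq j) = 0) :
    coef (fun t => den a c t * f t) n = 0 := by
  rw [coef_den_mul a c hf, h, hs, hs]
  simp

theorem coef_conj_den_mul_eq_zero (a c : ℝ) {f : Torus → ℂ} (hf : MemLp f 2 torusMeasure)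
    {n : Fin 2 → ℤ} (h : coef f n = 0) (hs : ∀ j, coef f (n + unitFreq j) = 0) :
    coef (fun t => conj (den a c t) * f t) n = 0 := by
  rw [coef_conj_den_mul a c hf, h, hs, hs]
  simp

/-- `p² f`. -/
def denSq (a c : ℝ) (f : Torus → ℂ) (t : Torus) : ℂ := den a c t * (den a c t * f t)

theorem MemLp.denSq {f : Torus → ℂ} (hf : MemLp f 2 torusMeasure) (a c : ℝ) :
    MemLp (denSq a c f) 2 torusMeasure :=
  MemLp.den_mul (MemLp.den_mul hf a c) a c

theorem unitFreq_nonneg (i j : Fin 2) : 0 ≤ unitFreq i j := by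
  by_cases h : j = i
  · subst h; simp
  · simp [h]

theorem unitFreq_le_one (i j : Fin 2) : unitFreq i j ≤ 1 := by
  by_cases h : j = i
  · subst h; simp
  · simp [h]

theorem mem_hardy_iff_denSq {a c : ℝ} (hc : 0 < c) (hac : a = 1 + c) {f : L2} :
    f ∈ hardy ↔ ∀ n : Fin 2 → ℤ, (∃ j, n j < 0) → coef (denSq a c f) n = 0 := by
  have hf := Lp.memLp f
  have hR : ∀ n ∈ {n : Fin 2 → ℤ | ∃ j, n j < 0}, ∀ j,
      n - unitFreq j ∈ {n : Fin 2 → ℤ | ∃ j, n j < 0} := by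
    rintro n ⟨i, hi⟩ j
    refine ⟨i, ?_⟩
    have := unitFreq_nonneg j i
    simp only [Pi.sub_apply]
    lia
  constructor
  · intro h n hn
    have h1 : ∀ n ∈ {n : Fin 2 → ℤ | ∃ j, n j < 0}, coef (fun t => den a c t * f t) n = 0 :=
      fun n hn => coef_den_mul_eq_zero a c hf (h n hn) fun j => h _ (hR n hn j)
    exact coef_den_mul_eq_zero a c (MemLp.den_mul hf a c) (h1 n hn) fun j => h1 _ (hR n hn j)
  · intro h
    exact coef_eq_zero_of_den_mul hc hac hf hR
      (coef_eq_zero_of_den_mul hc hac (MemLp.den_mul hf a c) hR h)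

/-- On the torus `Θ = (z₁ z₂ conj p / p)²`. This turns a condition on `conj Θ f` into one on `p² f`,
at the cost of a shift by `2` in each frequency. -/
theorem conj_den_sq_mul_conj_bigTheta {a c : ℝ} {t : Torus} (h : den a c t ≠ 0) (x : ℂ) :
    conj (den a c t) * (conj (den a c t) * (conj (bigTheta a c t) * x)) =
      conj (coord 0 t) * (conj (coord 0 t) * (conj (coord 1 t) * (conj (coord 1 t) *
        (den a c t * (den a c t * x))))) := by
  have h' : conj (den a c t) ≠ 0 := by simpa using h
  rw [bigTheta, theta_eq]
  simp only [map_pow, map_div₀, map_mul, Complex.conj_conj]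
  field_simp

theorem coef_conj_den_sq_mul {a c : ℝ} (hc : 0 < c) (hac : a = 1 + c) (f : Torus → ℂ)
    (n : Fin 2 → ℤ) :
    coef (fun t => conj (den a c t) * (conj (den a c t) * (conj (bigTheta a c t) * f t))) n =
      coef (denSq a c f) (n + unitFreq 0 + unitFreq 0 + unitFreq 1 + unitFreq 1) := by
  rw [← coef_conj_coord_mul, ← coef_conj_coord_mul, ← coef_conj_coord_mul, ← coef_conj_coord_mul]
  refine coef_congr ?_ n
  filter_upwards [ae_den_ne_zero hc hac] with t ht
  exact conj_den_sq_mul_conj_bigTheta ht _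

theorem coef_conj_bigTheta_mul_eq_zero_iff {a c : ℝ} (hc : 0 < c) (hac : a = 1 + c) {j : Fin 2}
    {f : Torus → ℂ} (hf : MemLp f 2 torusMeasure) :
    (∀ n : Fin 2 → ℤ, 0 ≤ n j → coef (fun t => conj (bigTheta a c t) * f t) n = 0) ↔
      ∀ n : Fin 2 → ℤ, 2 ≤ n j → coef (denSq a c f) n = 0 := by
  have hT := MemLp.conj_bigTheta_mul hc hac hf
  have hR : ∀ n ∈ {n : Fin 2 → ℤ | 0 ≤ n j}, ∀ i, n + unitFreq i ∈ {n : Fin 2 → ℤ | 0 ≤ n j} := by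
    intro n hn i
    have := unitFreq_nonneg i j
    simp only [mem_ofPred_eq, Pi.add_apply] at hn ⊢
    lia
  constructor
  · intro h n hn
    have h1 : ∀ n ∈ {n : Fin 2 → ℤ | 0 ≤ n j},
        coef (fun t => conj (den a c t) * (conj (bigTheta a c t) * f t)) n = 0 :=
      fun n hn => coef_conj_den_mul_eq_zero a c hT (h n hn) fun i => h _ (hR n hn i)
    have h2 : ∀ n ∈ {n : Fin 2 → ℤ | 0 ≤ n j}, coef (fun t => conj (den a c t) *
        (conj (den a c t) * (conj (bigTheta a c t) * f t))) n = 0 := fun n hn =>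
      coef_conj_den_mul_eq_zero a c (MemLp.conj_den_mul hT a c) (h1 n hn) fun i => h1 _ (hR n hn i)
    have h3 := h2 (n - unitFreq 0 - unitFreq 0 - unitFreq 1 - unitFreq 1) (by
      fin_cases j <;> simp at hn ⊢ <;> lia)
    rw [coef_conj_den_sq_mul hc hac] at h3
    rw [← h3]
    congr 1
    abel
  · intro h
    refine coef_eq_zero_of_conj_den_mul hc hac hT hR
      (coef_eq_zero_of_conj_den_mul hc hac (MemLp.conj_den_mul hT a c) hR fun n hn => ?_)
    rw [coef_conj_den_sq_mul hc hac]
    have hn' : 0 ≤ n j := hn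
    refine h _ ?_
    clear hn hR h
    fin_cases j <;> simp at hn' ⊢ <;> lia

/-- The working description of the maximal subspace: `p² f` has degree at most `1` in `z_j` and is
analytic in both variables. -/
theorem mem_maxInvariant_iff_denSq {a c : ℝ} (hc : 0 < c) (hac : a = 1 + c) {j : Fin 2}
    {f : L2} : f ∈ maxInvariant a c j ↔
      ∀ n : Fin 2 → ℤ, ((∃ i, n i < 0) ∨ 2 ≤ n j) → coef (denSq a c f) n = 0 := by
  rw [mem_maxInvariant hc hac, mem_hardy_iff_denSq hc hac,
    coef_conj_bigTheta_mul_eq_zero_iff hc hac (Lp.memLp f)]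
  constructor
  · rintro ⟨h1, h2⟩ n (h | h)
    exacts [h1 n h, h2 n h]
  · exact fun h => ⟨fun n hn => h n (Or.inl hn), fun n hn => h n (Or.inr hn)⟩

/-! ### Existence of a decomposition -/

/-- The compressed backward shift in the first variable maps `x` into the maximal subspace
`maxInvariant a c 0`. -/
theorem exists_mem_maxInvariant_inner_eq {a c : ℝ} (hc : 0 < c) (hac : a = 1 + c) {x : L2}
    (hx : x ∈ hardy) (hx' : ∀ n : Fin 2 → ℤ, 3 ≤ n 0 → coef (denSq a c x) n = 0) :
    ∃ w ∈ maxInvariant a c 0, ∀ f ∈ hardy, inner ℂ x (mulCoord 0 f) = inner ℂ w f := by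
  have hy : MemLp (fun t => conj (coord 0 t) * x t) 2 torusMeasure :=
    MemLp.continuous_mul (Lp.memLp x) (by fun_prop)
  set y : L2 := hy.toLp _ with hy_def
  have hyc : ∀ n, coef y n = coef x (n + unitFreq 0) := fun n => by
    rw [hy_def, coef_toLp, coef_conj_coord_mul]
  -- `w` is the projection of `conj z₁ x` to the Hardy space. It drops only frequencies with first
  -- entry `-1`, since `x` is already analytic.
  obtain ⟨w, hw⟩ := exists_coef_restrict {n : Fin 2 → ℤ | ∀ j, 0 ≤ n j} y
  have hwhardy : w ∈ hardy := by
    intro n ⟨j, hj⟩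
    change coef w n = 0
    rw [hw, if_neg]
    intro h
    exact absurd (h j) (not_le.mpr hj)
  have hwy : ∀ n : Fin 2 → ℤ, 0 ≤ n 0 → coef w n = coef y n := by
    intro n hn
    rw [hw]
    split_ifs with h
    · rfl
    · rw [hyc]
      symm
      refine mem_hardy.1 hx _ ⟨1, ?_⟩
      simp only [mem_ofPred_eq, Fin.forall_fin_two] at h
      simp
      lia
  refine ⟨w, ?_, fun f hf => ?_⟩
  · rw [mem_maxInvariant_iff_denSq hc hac]
    rintro n (h | h)
    · exact (mem_hardy_iff_denSq hc hac).1 hwhardy n h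
    -- Each factor `p` looks back by at most one, so the coefficients of `p² w` with first frequency
    -- at least `2` only see `w` where it agrees with `y`.
    · have h1 : ∀ m : Fin 2 → ℤ, 1 ≤ m 0 → coef (fun t => den a c t * w t) m =
          coef (fun t => den a c t * y t) m := by
        intro m hm
        refine coef_den_mul_congr a c (Lp.memLp w) (Lp.memLp y) (hwy _ (by lia)) fun j => hwy _ ?_
        have := unitFreq_le_one j 0
        simp only [Pi.sub_apply]
        lia
      have h2 : coef (denSq a c w) n = coef (denSq a c y) n := by
        refine coef_den_mul_congr a c (MemLp.den_mul (Lp.memLp w) a c)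
          (MemLp.den_mul (Lp.memLp y) a c) (h1 _ (by lia)) fun j => h1 _ ?_
        have := unitFreq_le_one j 0
        simp only [Pi.sub_apply]
        lia
      have h3 : coef (denSq a c y) n = coef (denSq a c x) (n + unitFreq 0) := by
        rw [← coef_conj_coord_mul]
        refine coef_congr ?_ n
        filter_upwards [hy.coeFn_toLp] with t ht
        rw [denSq, denSq, hy_def, ht]
        ring
      rw [h2, h3]
      exact hx' _ (by simp; lia)
  · have h1 : inner ℂ x (mulCoord 0 f) = inner ℂ y f := by
      rw [inner_eq_integral_of_ae (Filter.EventuallyEq.refl _ _),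
        inner_eq_integral_of_ae hy.coeFn_toLp]
      refine integral_congr_ae ?_
      filter_upwards [coeFn_mulCoord 0 f] with t ht
      rw [ht, map_mul, Complex.conj_conj]
      ring
    rw [h1, ← sub_eq_zero, ← inner_sub_left]
    refine inner_eq_zero_of_coef fun n => ?_
    by_cases hn : ∀ j, 0 ≤ n j
    · left
      rw [← torusBasis_repr, map_sub]
      change torusBasis.repr y n - torusBasis.repr w n = 0
      rw [torusBasis_repr, torusBasis_repr, hwy n (hn 0), sub_self]
    · right
      push Not at hn
      exact hf n hn

/-- The spectrum of `p² Θ e`, for a monomial `e`. -/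
theorem coef_denSq_bigTheta_mul {a c : ℝ} (hc : 0 < c) (hac : a = 1 + c) {x : L2}
    {n : Fin 2 → ℤ} (hx : x =ᵐ[torusMeasure] fun t => bigTheta a c t * UnitAddTorus.mFourier n t)
    {m : Fin 2 → ℤ} {j : Fin 2} (hm : m j < n j ∨ n j + 2 < m j) : coef (denSq a c x) m = 0 := by
  set e : Torus → ℂ := fun t =>
    UnitAddTorus.mFourier (n + unitFreq 0 + unitFreq 0 + unitFreq 1 + unitFreq 1) t with he
  have hmem : MemLp e 2 torusMeasure := memLp_mFourier _
  have h1 : coef (denSq a c x) m =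
      coef (fun t => conj (den a c t) * (conj (den a c t) * e t)) m := by
    refine coef_congr ?_ m
    filter_upwards [hx, ae_den_ne_zero hc hac] with t h1 h2
    rw [denSq, h1, bigTheta, theta_eq, he]
    simp only [UnitAddTorus.mFourier_add, mFourier_single_eq_coord]
    field_simp
  rw [h1]
  have h0 : ∀ l : Fin 2 → ℤ, (l j < n j + 2 ∨ n j + 2 < l j) → coef e l = 0 := by
    intro l hl
    rw [coef_mFourier, if_neg]
    rintro rfl
    fin_cases j <;> simp at hl <;> lia
  have h2 : ∀ l : Fin 2 → ℤ, (l j < n j + 1 ∨ n j + 2 < l j) →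
      coef (fun t => conj (den a c t) * e t) l = 0 := by
    intro l hl
    refine coef_conj_den_mul_eq_zero a c hmem (h0 _ (by lia)) fun i => h0 _ ?_
    have := unitFreq_le_one i j
    have := unitFreq_nonneg i j
    simp only [Pi.add_apply]
    lia
  refine coef_conj_den_mul_eq_zero a c (MemLp.conj_den_mul hmem a c) (h2 _ (by lia))
    fun i => h2 _ ?_
  have := unitFreq_le_one i j
  have := unitFreq_nonneg i j
  simp only [Pi.add_apply]
  lia

/-- For `f` in the complement of `maxInvariant a c 0`, both `z₁ f ⟂ maxInvariant a c 0` and `z₁ f ∈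
K_Θ` reduce to one fact: the backward shift sends `x` into `maxInvariant a c 0` as soon as `p² x`
has degree at most `2` in `z₁`. This covers the elements of that space and also the functions `Θ zⁿ`
with `n 0 = 0`. -/
theorem isInvariantDecomposition_maxInvariant {a c : ℝ} (hc : 0 < c) (hac : a = 1 + c) :
    IsInvariantDecomposition (bigTheta a c)
      ((maxInvariant a c 0)ᗮ ⊓ modelSpace (bigTheta a c)) (maxInvariant a c 0) := by
  have hcl := isClosed_maxInvariant a c 0
  have hmcl : IsClosed (modelSpace (bigTheta a c) : Set L2) := by
    rw [modelSpace, Submodule.coe_inf]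
    exact isClosed_hardy.inter (Submodule.isClosed_orthogonal _)
  have : CompleteSpace (maxInvariant a c 0) := hcl.completeSpace_coe
  refine ⟨?_, hcl, ?_, ?_, ?_, fun f hf => mulCoord_mem_maxInvariant hc hac (by decide) hf⟩
  · rw [Submodule.coe_inf]
    exact (Submodule.isClosed_orthogonal _).inter hmcl
  · rw [Submodule.isOrtho_iff_le]
    exact inf_le_left
  · rw [sup_comm]
    exact Submodule.sup_orthogonal_inf_of_hasOrthogonalProjection (maxInvariant_le hc hac 0)
  · rintro f ⟨hf, hfm⟩
    have hfm' := (mem_modelSpace hc hac).1 hfm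
    have key : ∀ x ∈ hardy, (∀ n : Fin 2 → ℤ, 3 ≤ n 0 → coef (denSq a c x) n = 0) →
        inner ℂ x (mulCoord 0 f) = 0 := by
      intro x hx hx'
      obtain ⟨w, hw, h⟩ := exists_mem_maxInvariant_inner_eq hc hac hx hx'
      rw [h f hfm'.1]
      exact hf w hw
    refine ⟨?_, ?_⟩
    · intro x hx
      refine key x ((mem_maxInvariant hc hac).1 hx).1 fun n hn => ?_
      exact (mem_maxInvariant_iff_denSq hc hac).1 hx n (Or.inr (by lia))
    · refine (mem_modelSpace hc hac).2 ⟨mulCoord_mem_hardy 0 hfm'.1, fun n hn => ?_⟩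
      by_cases h0 : 1 ≤ n 0
      · rw [coef_conj_mul_mulCoord]
        refine hfm'.2 _ (Fin.forall_fin_two.2 ⟨?_, ?_⟩)
        · simp; lia
        · simpa using hn 1
      · have h00 : n 0 = 0 := le_antisymm (by lia) (hn 0)
        obtain ⟨x, hx⟩ := exists_inner_mul_mFourier hc hac n
        rw [← inner_eq_coef_of_ae hx]
        refine key x ((mem_hardy_iff_denSq hc hac).2 ?_) ?_
        · rintro m ⟨j, hj⟩
          exact coef_denSq_bigTheta_mul hc hac hx (j := j) (Or.inl (hj.trans_le (hn j)))
        · intro m hm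
          exact coef_denSq_bigTheta_mul hc hac hx (j := 0) (Or.inr (by lia))

/-! ### Integrals over slices -/

/-- The normalised Lebesgue measure on the circle. -/
abbrev circleMeasure : Measure UnitAddCircle := AddCircle.haarAddCircle

/-- The parametrisation of the unit circle by angles. -/
def circ (x : UnitAddCircle) : ℂ := (AddCircle.toCircle x : ℂ)

theorem coord_eq_circ (j : Fin 2) (t : Torus) : coord j t = circ (t j) := rfl

theorem norm_circ (x : UnitAddCircle) : ‖circ x‖ = 1 := Circle.norm_coe _

theorem conj_circ (x : UnitAddCircle) : conj (circ x) = (circ x)⁻¹ :=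
  (Circle.coe_inv_eq_conj _).symm

theorem continuous_circ : Continuous circ := by
  unfold circ
  fun_prop

theorem integral_circ {F : ℂ → ℂ} (hF : DiffContOnCl ℂ F (Metric.ball 0 1)) :
    ∫ x, F (circ x) ∂circleMeasure = F 0 := by
  have h0 := DiffContOnCl.circleAverage (R := 1) (c := 0) (f := F) (by simpa using hF)
  rw [← h0, Real.circleAverage,
    AddCircle.integral_haarAddCircle, ← AddCircle.intervalIntegral_preimage 1 0]
  have h : ∀ s : ℝ, F (circ ((s : ℝ) : UnitAddCircle)) =
      (fun θ => F (circleMap 0 1 θ)) (2 * Real.pi * s) := by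
    intro s
    rw [circ, AddCircle.toCircle_apply_mk, Circle.coe_exp]
    simp [circleMap]
  simp only [h]
  rw [intervalIntegral.integral_comp_mul_left (fun θ => F (circleMap 0 1 θ)) (by positivity)]
  simp

/-- Replaces residue calculus: both slice integrals below are computed by splitting the integrand on
the circle as `F + conj G` with `F`, `G` holomorphic, and evaluating at `0`. -/
theorem integral_circ_add_conj {F G : ℂ → ℂ} (hF : DiffContOnCl ℂ F (Metric.ball 0 1))
    (hG : DiffContOnCl ℂ G (Metric.ball 0 1)) :
    ∫ x, (F (circ x) + conj (G (circ x)))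
      ∂circleMeasure = F 0 + conj (G 0) := by
  have hi : ∀ {H : ℂ → ℂ}, DiffContOnCl ℂ H (Metric.ball 0 1) →
      Integrable (fun x => H (circ x)) circleMeasure := by
    intro H hH
    have hc : Continuous fun x => H (circ x) := by
      refine hH.continuousOn.comp_continuous continuous_circ fun x => ?_
      rw [closure_ball _ one_ne_zero, mem_closedBall_zero_iff, norm_circ]
    exact hc.integrable_of_hasCompactSupport (HasCompactSupport.of_compactSpace _)
  have hG' : Integrable (fun x => conj (G (circ x)))
      circleMeasure := by
    have := (hi hG)
    exact (RCLike.conjCLE (K := ℂ)).toContinuousLinearMap.integrable_comp this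
  rw [integral_add (hi hF) hG', integral_conj, integral_circ hF, integral_circ hG]

/-- The functions in the model space of a squared Blaschke factor with zero `l`. -/
def blaschkeSlice (l β κ A B z : ℂ) : ℂ :=
  κ / (1 - conj l * z) * (A + B * (β * (z - l) / (1 - conj l * z)))

theorem one_sub_conj_mul_ne_zero {l z : ℂ} (hl : ‖l‖ < 1) (hz : ‖z‖ ≤ 1) :
    1 - conj l * z ≠ 0 := by
  intro h
  have h1 : ‖conj l * z‖ = 1 := by rw [← sub_eq_zero.mp h, norm_one]
  rw [norm_mul, RCLike.norm_conj] at h1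
  nlinarith [norm_nonneg l, norm_nonneg z]

theorem diffContOnCl_of_forall {F : ℂ → ℂ} (h : ∀ z : ℂ, ‖z‖ ≤ 1 → DifferentiableAt ℂ F z) :
    DiffContOnCl ℂ F (Metric.ball 0 1) := by
  refine DifferentiableOn.diffContOnCl fun z hz => (h z ?_).differentiableWithinAt
  rw [closure_ball _ one_ne_zero] at hz
  simpa using hz

section

variable {l β κ : ℂ} (A B : ℂ)

/-- Orthonormality of `k = κ / (1 - conj l z)` and `b k`, where `b` is the Blaschke factor with zero
`l`. -/
theorem integral_blaschkeSlice (hl : ‖l‖ < 1) (hβ : β * conj β = 1)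
    (hκ : κ * conj κ = 1 - l * conj l) :
    ∫ x, blaschkeSlice l β κ A B (circ x) *
      conj (blaschkeSlice l β κ A B (circ x))
        ∂circleMeasure = A * conj A + B * conj B := by
  set N := A * conj A + B * conj B with hN
  set s := 1 - l * conj l with hs
  have h0 := fun z (hz : ‖z‖ ≤ 1) => one_sub_conj_mul_ne_zero hl hz
  have hF : DiffContOnCl ℂ (fun z => N / (1 - conj l * z) +
      conj A * B * β * s * z / (1 - conj l * z) ^ 2) (Metric.ball 0 1) :=
    diffContOnCl_of_forall fun z hz => by
      have := h0 z hz
      fun_prop (disch := first | assumption | exact pow_ne_zero 2 this)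
  have hG : DiffContOnCl ℂ (fun z => conj N * (1 / (1 - conj l * z) - 1) +
      conj A * B * β * s * z / (1 - conj l * z) ^ 2) (Metric.ball 0 1) :=
    diffContOnCl_of_forall fun z hz => by
      have := h0 z hz
      fun_prop (disch := first | assumption | exact pow_ne_zero 2 this)
  have h := integral_circ_add_conj hF hG
  simp only [mul_zero, sub_zero, div_one, sub_self, zero_div, add_zero, map_zero] at h
  rw [← h]
  refine integral_congr_ae (Filter.Eventually.of_forall fun x => ?_)
  set z : ℂ := circ x with hz
  have hzn : ‖z‖ = 1 := norm_circ _
  have hz0 : z ≠ 0 := norm_pos_iff.mp (by rw [hzn]; exact one_pos)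
  have hzc : conj z = z⁻¹ := conj_circ _
  have h1 := h0 z hzn.le
  have h2 : z - l ≠ 0 := by
    rw [sub_ne_zero]; rintro rfl; linarith
  have hβ0 : β ≠ 0 := left_ne_zero_of_mul_eq_one hβ
  have hβc : conj β = β⁻¹ := (inv_eq_of_mul_eq_one_right hβ).symm
  have hsc : conj s = s := by simp [hs, mul_comm]
  have hNc : conj N = N := by simp [hN, mul_comm]
  have h3 : 1 - l * z⁻¹ = (z - l) / z := by field_simp
  have h4 : z⁻¹ - conj l = (1 - conj l * z) / z := by field_simp
  simp only [blaschkeSlice, ← hz, map_mul, map_div₀, map_add, map_sub, map_one, Complex.conj_conj,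
    hzc, hβc, hsc, hNc, map_pow, h3, h4]
  have h5 : κ / (1 - conj l * z) * (A + B * (β * (z - l) / (1 - conj l * z))) *
      (conj κ / ((z - l) / z) * (conj A + conj B * (β⁻¹ * ((1 - conj l * z) / z) / ((z - l) / z)))) =
      (κ * conj κ) * ((1 / (1 - conj l * z) * (A + B * (β * (z - l) / (1 - conj l * z)))) *
      (1 / ((z - l) / z) * (conj A + conj B * (β⁻¹ * ((1 - conj l * z) / z) / ((z - l) / z))))) := by
    ring
  rw [h5, hκ, hN, hs]
  field_simp
  ring

/-- The quadratic form of the compressed shift on the model space of `b²`, in the basis `k`, `b k`.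
-/
theorem integral_mul_blaschkeSlice (hl : ‖l‖ < 1) (hβ : β * conj β = 1)
    (hκ : κ * conj κ = 1 - l * conj l) :
    ∫ x, circ x * (blaschkeSlice l β κ A B (circ x) *
      conj (blaschkeSlice l β κ A B (circ x)))
        ∂circleMeasure =
      l * (A * conj A + B * conj B) + A * conj B * (conj β * (1 - l * conj l)) := by
  set N := A * conj A + B * conj B with hN
  set s := 1 - l * conj l with hs
  have h0 := fun z (hz : ‖z‖ ≤ 1) => one_sub_conj_mul_ne_zero hl hz
  have hF : DiffContOnCl ℂ (fun z => N * z / (1 - conj l * z) +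
      conj A * B * β * s * z ^ 2 / (1 - conj l * z) ^ 2) (Metric.ball 0 1) :=
    diffContOnCl_of_forall fun z hz => by
      have := h0 z hz
      fun_prop (disch := first | assumption | exact pow_ne_zero 2 this)
  have hG : DiffContOnCl ℂ (fun z => conj N * conj l / (1 - conj l * z) +
      conj A * B * β * s / (1 - conj l * z) ^ 2) (Metric.ball 0 1) :=
    diffContOnCl_of_forall fun z hz => by
      have := h0 z hz
      fun_prop (disch := first | assumption | exact pow_ne_zero 2 this)
  have hsc : conj s = s := by simp [hs, mul_comm]
  have hNc : conj N = N := by simp [hN, mul_comm]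
  have h := integral_circ_add_conj hF hG
  have h6 : l * N + A * conj B * (conj β * s) = N * 0 / (1 - conj l * 0) +
      conj A * B * β * s * 0 ^ 2 / (1 - conj l * 0) ^ 2 + conj (conj N * conj l /
      (1 - conj l * 0) + conj A * B * β * s / (1 - conj l * 0) ^ 2) := by
    simp [hsc]
    ring
  rw [h6, ← h]
  refine integral_congr_ae (Filter.Eventually.of_forall fun x => ?_)
  set z : ℂ := circ x with hz
  have hzn : ‖z‖ = 1 := norm_circ _
  have hz0 : z ≠ 0 := norm_pos_iff.mp (by rw [hzn]; exact one_pos)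
  have hzc : conj z = z⁻¹ := conj_circ _
  have h1 := h0 z hzn.le
  have h2 : z - l ≠ 0 := by
    rw [sub_ne_zero]; rintro rfl; linarith
  have hβ0 : β ≠ 0 := left_ne_zero_of_mul_eq_one hβ
  have hβc : conj β = β⁻¹ := (inv_eq_of_mul_eq_one_right hβ).symm
  have h3 : 1 - l * z⁻¹ = (z - l) / z := by field_simp
  have h4 : z⁻¹ - conj l = (1 - conj l * z) / z := by field_simp
  simp only [blaschkeSlice, ← hz, map_mul, map_div₀, map_add, map_sub, map_one, Complex.conj_conj,
    hzc, hβc, hsc, hNc, map_pow, h3, h4]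
  have h5 : z * (κ / (1 - conj l * z) * (A + B * (β * (z - l) / (1 - conj l * z))) *
      (conj κ / ((z - l) / z) *
        (conj A + conj B * (β⁻¹ * ((1 - conj l * z) / z) / ((z - l) / z))))) =
      (κ * conj κ) * (z * ((1 / (1 - conj l * z) * (A + B * (β * (z - l) / (1 - conj l * z)))) *
      (1 / ((z - l) / z) *
        (conj A + conj B * (β⁻¹ * ((1 - conj l * z) / z) / ((z - l) / z)))))) := by
    ring
  rw [h5, hκ, hN, hs]
  field_simp
  ring

end

/-! ### The slices of the inner function -/

/-- `q(w) = a + c w`, so that `p(z, w) = q(w) - z`. -/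
def qpoly (a c : ℝ) (w : ℂ) : ℂ := a + c * w

/-- The zero of a slice of `θ₁`. -/
def sliceZero (a c : ℝ) (w : ℂ) : ℂ := (conj (qpoly a c w))⁻¹

/-- The unimodular factor of a slice of `θ₁`. -/
def slicePhase (a c : ℝ) (w : ℂ) : ℂ := w * conj (qpoly a c w) / qpoly a c w

/-- The functions in the model space of a slice of `Θ`, in coordinates with respect to an
orthonormal basis. -/
def slice (a c : ℝ) (A B w z : ℂ) : ℂ :=
  Real.sqrt (a * c) * (1 + w) * (A * (qpoly a c w - z) + B * (w * (conj (qpoly a c w) * z - 1))) /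
    (qpoly a c w - z) ^ 2

section

variable {a c : ℝ} (hc : 0 < c) (hac : a = 1 + c) {w : ℂ} (hw : ‖w‖ = 1)

include hc hac hw in
theorem qpoly_ne_zero : qpoly a c w ≠ 0 := by
  intro h
  have h1 : ‖(c : ℂ) * w‖ = c := by
    rw [norm_mul, hw, Complex.norm_real, Real.norm_of_nonneg hc.le, mul_one]
  have h2 : (c : ℂ) * w = -a := by unfold qpoly at h; linear_combination h
  rw [h2, norm_neg, Complex.norm_real, Real.norm_of_nonneg (by linarith)] at h1
  linarith

include hac hw in
-- Uses `(a - c)² = 1`. The polynomial form is what `exists_slice_eq` needs; `qpoly_mul_conj` is the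
-- manifestly nonnegative form, which gives `|q| > 1` off `w = -1` and the normalisation of the
-- kernel.
theorem qpoly_mul_conj_sub_one :
    (qpoly a c w * conj (qpoly a c w) - 1) * w = a * c * (1 + w) ^ 2 := by
  have h : w * conj w = 1 := by rw [Complex.mul_conj', hw]; norm_num
  have hac' : (a : ℂ) = 1 + c := by rw [hac]; push_cast; rfl
  simp only [qpoly, map_add, map_mul, Complex.conj_ofReal, hac', map_one]
  linear_combination (c + c ^ 2 : ℂ) * h + (c : ℂ) ^ 2 * w * h

include hac hw in
theorem qpoly_mul_conj :
    qpoly a c w * conj (qpoly a c w) - 1 = a * c * ((1 + w) * conj (1 + w)) := by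
  have h : w * conj w = 1 := by rw [Complex.mul_conj', hw]; norm_num
  have hac' : (a : ℂ) = 1 + c := by rw [hac]; push_cast; rfl
  simp only [qpoly, map_add, map_mul, Complex.conj_ofReal, hac', map_one]
  linear_combination (-c : ℂ) * h

include hc hac hw in
theorem one_lt_norm_qpoly (hw' : w ≠ -1) : 1 < ‖qpoly a c w‖ := by
  have h := qpoly_mul_conj hac hw
  rw [Complex.mul_conj', Complex.mul_conj'] at h
  have h1 : ‖qpoly a c w‖ ^ 2 - 1 = a * c * ‖1 + w‖ ^ 2 := by exact_mod_cast h
  have h2 : 0 < ‖1 + w‖ := norm_pos_iff.mpr fun h => hw' (by linear_combination h)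
  have h3 : 0 < a * c * ‖1 + w‖ ^ 2 := by subst hac; positivity
  nlinarith [norm_nonneg (qpoly a c w)]

include hc hac hw in
theorem slice_eq (hw' : w ≠ -1) (A B z : ℂ) :
    slice a c A B w z = blaschkeSlice (sliceZero a c w) (slicePhase a c w)
      (Real.sqrt (a * c) * (1 + w) / qpoly a c w) A B z := by
  have h1 := one_lt_norm_qpoly hc hac hw hw'
  have h2 : qpoly a c w ≠ 0 := norm_pos_iff.mp (by linarith)
  have h2' : conj (qpoly a c w) ≠ 0 := by simpa using h2
  have h4 : 1 - conj (sliceZero a c w) * z = (qpoly a c w - z) / qpoly a c w := by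
    rw [sliceZero, map_inv₀, Complex.conj_conj]; field_simp
  have h5 : z - sliceZero a c w = (conj (qpoly a c w) * z - 1) / conj (qpoly a c w) := by
    rw [sliceZero]; field_simp
  rw [blaschkeSlice, h4, h5, slice, slicePhase]
  -- At the pole both sides are zero, division by zero being zero.
  by_cases h3 : qpoly a c w - z = 0
  · simp [h3]
  · field_simp

include hc hac hw in
theorem blaschke_data (hw' : w ≠ -1) : ‖sliceZero a c w‖ < 1 ∧
    slicePhase a c w * conj (slicePhase a c w) = 1 ∧
    (Real.sqrt (a * c) * (1 + w) / qpoly a c w) *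
      conj (Real.sqrt (a * c) * (1 + w) / qpoly a c w) =
        1 - sliceZero a c w * conj (sliceZero a c w) := by
  have h1 := one_lt_norm_qpoly hc hac hw hw'
  have h2 : qpoly a c w ≠ 0 := norm_pos_iff.mp (by linarith)
  have h2' : conj (qpoly a c w) ≠ 0 := by simpa using h2
  refine ⟨?_, ?_, ?_⟩
  · rw [sliceZero, norm_inv, RCLike.norm_conj]
    exact inv_lt_one_of_one_lt₀ h1
  · rw [Complex.mul_conj', slicePhase, norm_div, norm_mul, hw, RCLike.norm_conj, one_mul,
      div_self (by positivity)]
    norm_num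
  · have hs : (Real.sqrt (a * c) : ℂ) * Real.sqrt (a * c) = a * c := by
      rw [← Complex.ofReal_mul, Real.mul_self_sqrt (by subst hac; positivity), Complex.ofReal_mul]
    have h := qpoly_mul_conj hac hw
    simp only [sliceZero, map_div₀, map_mul, map_inv₀, Complex.conj_conj, Complex.conj_ofReal]
    field_simp
    rw [map_add, map_one] at h ⊢
    linear_combination (-1 : ℂ) * h + (1 + w) * (1 + conj w) * hs

include hc hac hw in
theorem integral_slice (hw' : w ≠ -1) (A B : ℂ) :
    ∫ x, slice a c A B w (circ x) * conj (slice a c A B w (circ x))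
      ∂circleMeasure = A * conj A + B * conj B := by
  obtain ⟨h1, h2, h3⟩ := blaschke_data hc hac hw hw'
  simp only [slice_eq hc hac hw hw']
  exact integral_blaschkeSlice A B h1 h2 h3

include hc hac hw in
theorem integral_mul_slice (hw' : w ≠ -1) (A B : ℂ) :
    ∫ x, circ x * (slice a c A B w (circ x) *
      conj (slice a c A B w (circ x))) ∂circleMeasure =
      sliceZero a c w * (A * conj A + B * conj B) + A * conj B * (conj (slicePhase a c w) *
        (1 - sliceZero a c w * conj (sliceZero a c w))) := by
  obtain ⟨h1, h2, h3⟩ := blaschke_data hc hac hw hw'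
  simp only [slice_eq hc hac hw hw']
  exact integral_mul_blaschkeSlice A B h1 h2 h3

include hc hac hw in
/-- Every `(G₀ + G₁ z) / p(z, w) ^ 2` is in the model space of the slice of `Θ`. -/
theorem exists_slice_eq (hw' : w ≠ -1) (G₀ G₁ : ℂ) : ∃ A B : ℂ,
    (∀ z, (G₀ + G₁ * z) / (qpoly a c w - z) ^ 2 = slice a c A B w z) ∧
    B * ((Real.sqrt (a * c) : ℂ) * (a * c)) * (1 + w) ^ 3 = G₀ + qpoly a c w * G₁ ∧
    A * (Real.sqrt (a * c) : ℂ) * (1 + w) =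
      B * ((Real.sqrt (a * c) : ℂ) * (1 + w) * w * conj (qpoly a c w)) - G₁ := by
  have hw1 : 1 + w ≠ 0 := fun h => hw' (by linear_combination h)
  have ha : 0 < a * c := by subst hac; positivity
  have hs : (Real.sqrt (a * c) : ℂ) ≠ 0 := by
    rw [Complex.ofReal_ne_zero]; exact (Real.sqrt_pos.mpr ha).ne'
  have hc0 : (c : ℂ) ≠ 0 := by exact_mod_cast hc.ne'
  have ha0 : (a : ℂ) ≠ 0 := by rw [Complex.ofReal_ne_zero]; linarith
  set s : ℂ := (Real.sqrt (a * c) : ℂ) with hsdef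
  -- Setting `z = q(w)` in the numerator kills the `A` term and leaves `B` times `w (|q|² - 1) = ac
  -- (1 + w)²`, whence the cube; the coefficient of `z` then gives `A`.
  set B : ℂ := (G₀ + qpoly a c w * G₁) / (s * (a * c) * (1 + w) ^ 3) with hB
  have hB' : B * (s * (a * c)) * (1 + w) ^ 3 = G₀ + qpoly a c w * G₁ := by
    rw [hB]; field_simp
  set A : ℂ := (B * (s * (1 + w) * w * conj (qpoly a c w)) - G₁) / (s * (1 + w)) with hA
  have hA' : A * s * (1 + w) = B * (s * (1 + w) * w * conj (qpoly a c w)) - G₁ := by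
    rw [hA]; field_simp
  refine ⟨A, B, fun z => ?_, hB', hA'⟩
  have h := qpoly_mul_conj_sub_one hac hw
  rw [slice]
  congr 1
  linear_combination -hB' - (qpoly a c w - z) * hA' - B * s * (1 + w) * h

end

/-! ### Fourier coefficients on the circle -/

theorem fourierCoeff_circ_mul (g : UnitAddCircle → ℂ) (k : ℤ) :
    fourierCoeff (fun x => circ x * g x) k = fourierCoeff g (k - 1) := by
  simp only [fourierCoeff]
  congr 1
  ext x
  rw [show -(k - 1) = 1 + -k by ring, fourier_add, fourier_one, smul_eq_mul, smul_eq_mul, circ]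
  ring

theorem tendsto_fourierCoeff {g : UnitAddCircle → ℂ} (hg : MemLp g 2 circleMeasure) :
    Filter.Tendsto (fourierCoeff g) Filter.cofinite (nhds 0) := by
  have h := (hasSum_sq_fourierCoeff (hg.toLp g)).summable.tendsto_cofinite_zero
  rw [tendsto_zero_iff_norm_tendsto_zero]
  have h3 := h.sqrt
  simp only [Real.sqrt_zero, Real.sqrt_sq (norm_nonneg _)] at h3
  refine h3.congr fun n => ?_
  exact congrArg norm (congrFun (fourierCoeff_congr_ae hg.coeFn_toLp) n)

theorem ae_eq_of_fourierCoeff {f g : UnitAddCircle → ℂ} (hf : MemLp f 2 circleMeasure)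
    (hg : MemLp g 2 circleMeasure) (h : ∀ n, fourierCoeff f n = fourierCoeff g n) :
    f =ᵐ[circleMeasure] g := by
  rw [← hf.toLp_eq_toLp_iff hg]
  apply fourierBasis.repr.injective
  ext n
  rw [fourierBasis_repr, fourierBasis_repr, fourierCoeff_congr_ae hf.coeFn_toLp,
    fourierCoeff_congr_ae hg.coeFn_toLp, h]

theorem MemLp.continuous_circ_mul {u f : UnitAddCircle → ℂ} (hf : MemLp f 2 circleMeasure)
    (hu : Continuous u) : MemLp (fun t => u t * f t) 2 circleMeasure := by
  obtain ⟨C, hC⟩ := isCompact_univ.exists_bound_of_continuousOn hu.continuousOn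
  refine hf.of_le_mul (c := C) (hu.aestronglyMeasurable.mul hf.1) ?_
  filter_upwards with t
  rw [norm_mul]
  have := hC t trivial
  gcongr

theorem fourierCoeff_affine_mul {g : UnitAddCircle → ℂ} (hg : MemLp g 2 circleMeasure) (u v : ℂ)
    (k : ℤ) : fourierCoeff (fun x => (u + v * circ x) * g x) k =
      u * fourierCoeff g k + v * fourierCoeff g (k - 1) := by
  have h1 : MemLp (fun x => circ x * g x) 2 circleMeasure :=
    MemLp.continuous_circ_mul hg continuous_circ
  rw [show (fun x => (u + v * circ x) * g x) =
    (fun x => u * g x) + fun x => v * (circ x * g x) by ext x; simp only [Pi.add_apply]; ring]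
  rw [fourierCoeff.add ((hg.const_mul u).integrable (by norm_num))
    ((h1.const_mul v).integrable (by norm_num)), Pi.add_apply, fourierCoeff.const_mul,
    fourierCoeff.const_mul, fourierCoeff_circ_mul]

theorem iterate_add_injective_int {e : ℤ} (he : e ≠ 0) (n : ℤ) :
    Function.Injective fun k : ℕ => (fun m => m + e)^[k] n := by
  intro k l hkl
  simp only [add_right_iterate, nsmul_eq_mul, add_right_inj] at hkl
  exact_mod_cast mul_right_cancel₀ he hkl

/-- Division by `1 + z` on the circle: high frequencies. -/
theorem fourierCoeff_eq_zero_of_ge {g : UnitAddCircle → ℂ} (hg : MemLp g 2 circleMeasure) {N : ℤ}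
    (h : ∀ k, N + 1 ≤ k → fourierCoeff (fun x => (1 + circ x) * g x) k = 0) :
    ∀ k, N ≤ k → fourierCoeff g k = 0 := by
  refine eq_zero_of_norm_le_average (tendsto_fourierCoeff hg) (R := {k | N ≤ k})
    (s₁ := fun k => k + 1) (s₂ := fun k => k + 1) (a := 1) (c := 0) ?_ ?_
    (iterate_add_injective_int one_ne_zero) le_rfl (by norm_num) ?_
  · intro k hk; simp only [mem_ofPred_eq] at hk ⊢; lia
  · intro k hk; simp only [mem_ofPred_eq] at hk ⊢; lia
  · intro k hk
    simp only [mem_ofPred_eq] at hk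
    have h1 := h (k + 1) (by lia)
    have h2 := fourierCoeff_affine_mul hg 1 1 (k + 1)
    simp only [one_mul, add_sub_cancel_right] at h2
    rw [h1] at h2
    rw [eq_neg_of_add_eq_zero_right h2.symm, norm_neg]
    simp

/-- Division by `1 + z` on the circle: negative frequencies. -/
theorem fourierCoeff_eq_zero_of_neg {g : UnitAddCircle → ℂ} (hg : MemLp g 2 circleMeasure)
    (h : ∀ k < 0, fourierCoeff (fun x => (1 + circ x) * g x) k = 0) :
    ∀ k < 0, fourierCoeff g k = 0 := by
  refine eq_zero_of_norm_le_average (tendsto_fourierCoeff hg) (R := {k | k < 0})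
    (s₁ := fun k => k + -1) (s₂ := fun k => k + -1) (a := 1) (c := 0) ?_ ?_
    (iterate_add_injective_int (by norm_num)) le_rfl (by norm_num) ?_
  · intro k hk; simp only [mem_ofPred_eq] at hk ⊢; lia
  · intro k hk; simp only [mem_ofPred_eq] at hk ⊢; lia
  · intro k hk
    have h1 := h k hk
    have h2 := fourierCoeff_affine_mul hg 1 1 k
    simp only [one_mul] at h2
    rw [h1] at h2
    rw [eq_neg_of_add_eq_zero_left h2.symm, norm_neg, sub_eq_add_neg]
    simp

/-! ### Slices of functions on the torus -/

theorem measurePreserving_vec :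
    MeasurePreserving (fun p : UnitAddCircle × UnitAddCircle => (![p.1, p.2] : Torus))
      (circleMeasure.prod circleMeasure) torusMeasure :=
  (measurePreserving_finTwoArrow circleMeasure).symm

theorem measurableEmbedding_vec :
    MeasurableEmbedding fun p : UnitAddCircle × UnitAddCircle => (![p.1, p.2] : Torus) :=
  MeasurableEquiv.finTwoArrow.symm.measurableEmbedding

theorem ae_ae_of_ae_torus {P : Torus → Prop} (h : ∀ᵐ t ∂torusMeasure, P t) :
    ∀ᵐ y ∂circleMeasure, ∀ᵐ x ∂circleMeasure, P ![x, y] := by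
  have h1 : ∀ᵐ p ∂(circleMeasure.prod circleMeasure), P ![p.1, p.2] :=
    measurePreserving_vec.quasiMeasurePreserving.ae h
  rw [← Measure.prod_swap] at h1
  have h2 := ae_of_ae_map measurable_swap.aemeasurable h1
  exact Measure.ae_ae_of_ae_prod h2

theorem integrable_vec {F : Torus → ℂ} (hF : Integrable F torusMeasure) :
    Integrable (fun p : UnitAddCircle × UnitAddCircle => F ![p.1, p.2])
      (circleMeasure.prod circleMeasure) :=
  (measurePreserving_vec.integrable_comp_emb measurableEmbedding_vec).2 hF

theorem integral_torus {F : Torus → ℂ} (hF : Integrable F torusMeasure) :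
    ∫ t, F t ∂torusMeasure = ∫ y, ∫ x, F ![x, y] ∂circleMeasure ∂circleMeasure := by
  rw [← measurePreserving_vec.integral_comp measurableEmbedding_vec,
    integral_prod_symm _ (integrable_vec hF)]

theorem integrable_slice_integral {F : Torus → ℂ} (hF : Integrable F torusMeasure) :
    Integrable (fun y => ∫ x, F ![x, y] ∂circleMeasure) circleMeasure :=
  (integrable_vec hF).integral_prod_right

theorem coef_comp_snd {G : UnitAddCircle → ℂ} (n : Fin 2 → ℤ) :
    coef (fun t => G (t 1)) n = if n 0 = 0 then fourierCoeff G (n 1) else 0 := by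
  have h := integral_fintype_prod_eq_prod (ι := Fin 2) (𝕜 := ℂ) (μ := fun _ => circleMeasure)
    ![fun x => fourier (-n 0) x, fun x => fourier (-n 1) x * G x]
  simp only [Fin.prod_univ_two, Matrix.cons_val_zero, Matrix.cons_val_one] at h
  have h0 : ∫ x, fourier (-n 0) x ∂circleMeasure = if n 0 = 0 then 1 else 0 := by
    have h1 := (orthonormal_iff_ite.mp (orthonormal_fourier (T := (1 : ℝ)))) (n 0) 0
    rw [← h1]
    simp only [ContinuousMap.inner_toLp, ← fourier_neg, fourier_zero, one_mul]
  simp only [coef, UnitAddTorus.mFourier, ContinuousMap.coe_mk, Fin.prod_univ_two, Pi.neg_apply,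
    mul_assoc]
  rw [h, h0, fourierCoeff]
  simp only [smul_eq_mul, ite_mul, one_mul, zero_mul]

theorem memLp_comp_snd {G : UnitAddCircle → ℂ} (hG : MemLp G 2 circleMeasure) :
    MemLp (fun t : Torus => G (t 1)) 2 torusMeasure :=
  hG.comp_measurePreserving (measurePreserving_eval (fun _ : Fin 2 => circleMeasure) 1)

/-- A function whose spectrum is contained in `{0, 1} × ℤ` is affine in `z₁`. -/
theorem exists_eq_affine {F : Torus → ℂ} (hF : MemLp F 2 torusMeasure)
    (h : ∀ n : Fin 2 → ℤ, n 0 ≠ 0 → n 0 ≠ 1 → coef F n = 0) :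
    ∃ G : Fin 2 → UnitAddCircle → ℂ, (∀ j, MemLp (G j) 2 circleMeasure) ∧
      (∀ k, fourierCoeff (G 0) k = coef F ![0, k]) ∧
      (∀ k, fourierCoeff (G 1) k = coef F ![1, k]) ∧
      F =ᵐ[torusMeasure] fun t => G 0 (t 1) + coord 0 t * G 1 (t 1) := by
  have key : ∀ j : ℤ, ∃ G : UnitAddCircle → ℂ, MemLp G 2 circleMeasure ∧
      ∀ k, fourierCoeff G k = coef F ![j, k] := by
    intro j
    have hm : Memℓp (fun k : ℤ => coef F ![j, k]) 2 := by
      refine memℓp_gen ?_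
      have h1 := (torusBasis.repr (hF.toLp F)).2.summable (p := 2) (by norm_num)
      have hinj : Function.Injective fun k : ℤ => (![j, k] : Fin 2 → ℤ) := by
        intro k l hkl
        simpa using congrFun hkl 1
      have h2 := h1.comp_injective hinj
      refine h2.congr fun k => ?_
      simp only [Function.comp_apply]
      rw [← coef_toLp hF, ← torusBasis_repr]
    refine ⟨fourierBasis.repr.symm ⟨_, hm⟩, Lp.memLp _, fun k => ?_⟩
    rw [← fourierBasis_repr, LinearIsometryEquiv.apply_symm_apply]
  obtain ⟨G₀, hG₀, h₀⟩ := key 0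
  obtain ⟨G₁, hG₁, h₁⟩ := key 1
  refine ⟨![G₀, G₁], Fin.forall_fin_two.2 ⟨hG₀, hG₁⟩, h₀, h₁, ?_⟩
  have hm₀ := memLp_comp_snd hG₀
  have hm₁ : MemLp (fun t : Torus => coord 0 t * G₁ (t 1)) 2 torusMeasure :=
    MemLp.continuous_mul (memLp_comp_snd hG₁) (coord 0).continuous
  refine ae_eq_of_coef hF (hm₀.add hm₁) fun n => ?_
  have h2 := coef_add (hm₀.integrable (by norm_num)) (hm₁.integrable (by norm_num)) n
  rw [coef_coord_mul, coef_comp_snd, coef_comp_snd] at h2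
  have h3 : (n - unitFreq 0) 1 = n 1 := by simp
  have h4 : (n - unitFreq 0) 0 = n 0 - 1 := by simp
  rw [h3, h4] at h2
  refine Eq.trans ?_ h2.symm
  have hn : ∀ j, n 0 = j → n = ![j, n 1] := by
    intro j hj
    ext i
    fin_cases i
    · exact hj
    · rfl
  by_cases h00 : n 0 = 0
  · rw [if_pos h00, if_neg (by lia), add_zero, h₀, ← hn 0 h00]
  · by_cases h01 : n 0 = 1
    · rw [if_neg h00, if_pos (by lia), zero_add, h₁, ← hn 1 h01]
    · rw [h n h00 h01, if_neg h00, if_neg (by lia), add_zero]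

/-! ### The structure of the maximal invariant subspace -/

theorem den_vec (a c : ℝ) (x y : UnitAddCircle) :
    den a c ![x, y] = qpoly a c (circ y) - circ x := by
  simp only [den, poly, qpoly, coord_eq_circ, Matrix.cons_val_zero, Matrix.cons_val_one]
  ring

/-- The functions in `maxInvariant a c 0` in coordinates: `A`, `B` are the coordinates of the
slices, and `G₀ + z₁ G₁ = p² f`. -/
theorem exists_slice_coordinates {a c : ℝ} (hc : 0 < c) (hac : a = 1 + c) {f : L2}
    (hf : f ∈ maxInvariant a c 0) :
    ∃ (G : Fin 2 → UnitAddCircle → ℂ) (A B : UnitAddCircle → ℂ),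
      (∀ j, MemLp (G j) 2 circleMeasure) ∧
      (∀ k, fourierCoeff (G 0) k = coef (denSq a c f) ![0, k]) ∧
      (∀ k, fourierCoeff (G 1) k = coef (denSq a c f) ![1, k]) ∧
      (denSq a c f =ᵐ[torusMeasure] fun t => G 0 (t 1) + coord 0 t * G 1 (t 1)) ∧
      (∀ᵐ y ∂circleMeasure, circ y ≠ -1 ∧
        (∀ᵐ x ∂circleMeasure, f ![x, y] = slice a c (A y) (B y) (circ y) (circ x)) ∧
        B y * ((Real.sqrt (a * c) : ℂ) * (a * c)) * (1 + circ y) ^ 3 =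
          G 0 y + qpoly a c (circ y) * G 1 y ∧
        A y * (Real.sqrt (a * c) : ℂ) * (1 + circ y) =
          B y * ((Real.sqrt (a * c) : ℂ) * (1 + circ y) * circ y *
            conj (qpoly a c (circ y))) - G 1 y) := by
  have h := (mem_maxInvariant_iff_denSq hc hac).1 hf
  obtain ⟨G, hG, h0, h1, hFG⟩ := exists_eq_affine (MemLp.denSq (Lp.memLp f) a c)
    fun n hn0 hn1 => h n (by
      by_cases hn : n 0 < 0
      · exact Or.inl ⟨0, hn⟩
      · exact Or.inr (by lia))
  -- The coordinates are chosen point by point. Their measurability is recovered later from the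
  -- equations that determine them.
  have hAB : ∀ y, ∃ A B : ℂ, circ y ≠ -1 →
      (∀ z, (G 0 y + G 1 y * z) / (qpoly a c (circ y) - z) ^ 2 = slice a c A B (circ y) z) ∧
      B * ((Real.sqrt (a * c) : ℂ) * (a * c)) * (1 + circ y) ^ 3 =
        G 0 y + qpoly a c (circ y) * G 1 y ∧
      A * (Real.sqrt (a * c) : ℂ) * (1 + circ y) =
        B * ((Real.sqrt (a * c) : ℂ) * (1 + circ y) * circ y * conj (qpoly a c (circ y))) -
          G 1 y := by
    intro y
    by_cases hy : circ y = -1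
    · exact ⟨0, 0, fun h => absurd hy h⟩
    · obtain ⟨A, B, h⟩ := exists_slice_eq hc hac (norm_circ y) hy (G 0 y) (G 1 y)
      exact ⟨A, B, fun _ => h⟩
  choose A B hAB using hAB
  refine ⟨G, A, B, hG, h0, h1, hFG, ?_⟩
  filter_upwards [ae_toCircle_ne (-1), ae_ae_of_ae_torus hFG,
    ae_ae_of_ae_torus (ae_den_ne_zero hc hac)] with y hy h2 h3
  obtain ⟨h4, h5, h6⟩ := hAB y hy
  refine ⟨hy, ?_, h5, h6⟩
  filter_upwards [h2, h3] with x h2 h3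
  rw [← h4]
  rw [den_vec] at h3
  rw [denSq, den_vec, coord_eq_circ] at h2
  simp only [Matrix.cons_val_zero, Matrix.cons_val_one] at h2
  rw [eq_div_iff (pow_ne_zero 2 h3)]
  linear_combination h2

theorem integrable_mul_conj (f : L2) :
    Integrable (fun t => f t * conj (f t)) torusMeasure := by
  have h := L2.integrable_inner (𝕜 := ℂ) f f
  refine h.congr (Filter.Eventually.of_forall fun t => ?_)
  exact RCLike.inner_apply _ _

theorem integrable_coord_mul_conj (j : Fin 2) (f : L2) :
    Integrable (fun t => coord j t * (f t * conj (f t))) torusMeasure := by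
  refine (integrable_mul_conj f).bdd_mul (c := 1) (coord j).continuous.aestronglyMeasurable ?_
  exact Filter.Eventually.of_forall fun t => (norm_coord j t).le

theorem inner_self_eq_integral (f : L2) :
    inner ℂ f f = ∫ t, f t * conj (f t) ∂torusMeasure := by
  rw [inner_eq_integral_of_ae (Filter.EventuallyEq.refl _ _)]
  simp only [mul_comm]

theorem inner_mulCoord_eq_integral (j : Fin 2) (f : L2) :
    inner ℂ f (mulCoord j f) = ∫ t, coord j t * (f t * conj (f t)) ∂torusMeasure := by
  rw [inner_eq_integral_of_ae (Filter.EventuallyEq.refl _ _)]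
  refine integral_congr_ae ?_
  filter_upwards [coeFn_mulCoord j f] with t ht
  rw [ht]
  ring

section

variable {a c : ℝ} (hc : 0 < c) (hac : a = 1 + c) {f : Torus → ℂ} {A B : UnitAddCircle → ℂ}
  (h : ∀ᵐ y ∂circleMeasure, circ y ≠ -1 ∧
    ∀ᵐ x ∂circleMeasure, f ![x, y] = slice a c (A y) (B y) (circ y) (circ x))

include hc hac h in
theorem ae_integral_slice_eq : ∀ᵐ y ∂circleMeasure,
    ∫ x, f ![x, y] * conj (f ![x, y]) ∂circleMeasure = A y * conj (A y) + B y * conj (B y) := by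
  filter_upwards [h] with y ⟨hy, hx⟩
  rw [← integral_slice hc hac (norm_circ y) hy]
  refine integral_congr_ae ?_
  filter_upwards [hx] with x hx
  rw [hx]

include hc hac h in
theorem ae_integral_coord_mul_slice_eq : ∀ᵐ y ∂circleMeasure,
    ∫ x, coord 0 ![x, y] * (f ![x, y] * conj (f ![x, y])) ∂circleMeasure =
      sliceZero a c (circ y) * (A y * conj (A y) + B y * conj (B y)) +
        A y * conj (B y) * (conj (slicePhase a c (circ y)) *
          (1 - sliceZero a c (circ y) * conj (sliceZero a c (circ y)))) := by
  filter_upwards [h] with y ⟨hy, hx⟩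
  rw [← integral_mul_slice hc hac (norm_circ y) hy]
  refine integral_congr_ae ?_
  filter_upwards [hx] with x hx
  rw [hx, coord_eq_circ]
  simp only [Matrix.cons_val_zero]

end

/-- By Fubini and orthonormality `|A|² + |B|²` is the slice integral of `|f|²`, hence integrable. -/
theorem memLp_slice_coordinates {a c : ℝ} (hc : 0 < c) (hac : a = 1 + c) {f : L2}
    {A B : UnitAddCircle → ℂ} (h : ∀ᵐ y ∂circleMeasure, circ y ≠ -1 ∧
      ∀ᵐ x ∂circleMeasure, f ![x, y] = slice a c (A y) (B y) (circ y) (circ x)) :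
    (AEStronglyMeasurable A circleMeasure → MemLp A 2 circleMeasure) ∧
      (AEStronglyMeasurable B circleMeasure → MemLp B 2 circleMeasure) := by
  have h1 := (integrable_slice_integral (integrable_mul_conj f)).re
  have h2 : ∀ᵐ y ∂circleMeasure, RCLike.re (∫ x, f ![x, y] * conj (f ![x, y]) ∂circleMeasure) =
      ‖A y‖ ^ 2 + ‖B y‖ ^ 2 := by
    filter_upwards [ae_integral_slice_eq hc hac h] with y hy
    rw [hy, Complex.mul_conj', Complex.mul_conj']
    norm_cast
  constructor
  · intro hm
    rw [memLp_two_iff_integrable_sq_norm hm]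
    refine h1.mono' (hm.norm.pow 2) ?_
    filter_upwards [h2] with y hy
    rw [hy, norm_pow, norm_norm]
    nlinarith [sq_nonneg ‖B y‖]
  · intro hm
    rw [memLp_two_iff_integrable_sq_norm hm]
    refine h1.mono' (hm.norm.pow 2) ?_
    filter_upwards [h2] with y hy
    rw [hy, norm_pow, norm_norm]
    nlinarith [sq_nonneg ‖A y‖]

/-- The maximal invariant subspaces intersect trivially. -/
theorem maxInvariant_inf_eq_bot {a c : ℝ} (hc : 0 < c) (hac : a = 1 + c) :
    maxInvariant a c 0 ⊓ maxInvariant a c 1 = ⊥ := by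
  rw [eq_bot_iff]
  rintro f ⟨hf, hf'⟩
  have hsp := (mem_maxInvariant_iff_denSq hc hac).1 hf
  have hsp' := (mem_maxInvariant_iff_denSq hc hac).1 hf'
  obtain ⟨G, A, B, hG, h0, h1, hFG, hy⟩ := exists_slice_coordinates hc hac hf
  have hac0 : 0 < a * c := by subst hac; positivity
  set s : ℂ := (Real.sqrt (a * c) : ℂ) with hs_def
  have hs : s ≠ 0 := by
    rw [hs_def, Complex.ofReal_ne_zero]; exact (Real.sqrt_pos.mpr hac0).ne'
  have hc0 : (c : ℂ) ≠ 0 := by exact_mod_cast hc.ne'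
  have ha0 : (a : ℂ) ≠ 0 := by rw [Complex.ofReal_ne_zero]; linarith
  have hspec : ∀ j k : ℤ, (k < 0 ∨ 2 ≤ k) → coef (denSq a c f) ![j, k] = 0 := by
    rintro j k (hk | hk)
    · exact hsp' _ (Or.inl ⟨1, by simpa using hk⟩)
    · exact hsp' _ (Or.inr (by simpa using hk))
  have hslice : ∀ᵐ y ∂circleMeasure, circ y ≠ -1 ∧
      ∀ᵐ x ∂circleMeasure, f ![x, y] = slice a c (A y) (B y) (circ y) (circ x) :=
    hy.mono fun y h => ⟨h.1, h.2.1⟩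
  obtain ⟨hAm, hBm⟩ := memLp_slice_coordinates hc hac hslice
  have hqc : Continuous fun y => qpoly a c (circ y) := by
    have := continuous_circ
    unfold qpoly
    fun_prop
  have hH : MemLp (fun y => G 0 y + qpoly a c (circ y) * G 1 y) 2 circleMeasure :=
    (hG 0).add (MemLp.continuous_circ_mul (hG 1) hqc)
  have hHc : ∀ k, fourierCoeff (fun y => G 0 y + qpoly a c (circ y) * G 1 y) k =
      coef (denSq a c f) ![0, k] +
        (a * coef (denSq a c f) ![1, k] + c * coef (denSq a c f) ![1, k - 1]) := by
    intro k
    have h2 := fourierCoeff.add ((hG 0).integrable (by norm_num))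
      ((MemLp.continuous_circ_mul (hG 1) hqc).integrable (by norm_num))
    refine (congrFun h2 k).trans ?_
    rw [Pi.add_apply, h0]
    simp only [qpoly]
    rw [fourierCoeff_affine_mul (hG 1), h1, h1]
  have hne : ∀ᵐ y ∂circleMeasure, (1 + circ y) ≠ 0 := hy.mono fun y h h' =>
    h.1 (by linear_combination h')
  have hBL : MemLp B 2 circleMeasure := by
    refine hBm ?_
    have hm : AEStronglyMeasurable (fun y => (G 0 y + qpoly a c (circ y) * G 1 y) /
        (s * (a * c) * (1 + circ y) ^ 3)) circleMeasure := by
      refine (hH.1.aemeasurable.div (Continuous.measurable ?_).aemeasurable).aestronglyMeasurable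
      have := continuous_circ
      fun_prop
    refine hm.congr ?_
    filter_upwards [hy, hne] with y hy hne
    rw [← hy.2.2.1]
    field_simp
  have h1c : Continuous fun y => 1 + circ y := by
    have := continuous_circ
    fun_prop
  have hB1 := MemLp.continuous_circ_mul hBL h1c
  have hB2 := MemLp.continuous_circ_mul hB1 h1c
  -- `(1 + w)³ B` is a polynomial in `w` of degree at most `2`. For square integrable functions each
  -- division by `1 + w` lowers the degree bound by one, so three divisions leave nothing.
  have hB3 : ∀ k : ℤ, (k < 0 ∨ 3 ≤ k) → fourierCoeff (fun y => (1 + circ y) * ((1 + circ y) *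
      ((1 + circ y) * B y))) k = 0 := by
    intro k hk
    have h2 : (fun y => (1 + circ y) * ((1 + circ y) * ((1 + circ y) * B y)))
        =ᵐ[circleMeasure] fun y => (s * (a * c))⁻¹ * (G 0 y + qpoly a c (circ y) * G 1 y) := by
      filter_upwards [hy] with y hy
      rw [← hy.2.2.1]
      field_simp
    rw [fourierCoeff_congr_ae h2, fourierCoeff.const_mul, hHc, hspec _ _ (by lia),
      hspec _ _ (by lia), hspec _ _ (by lia)]
    simp
  have hBz : B =ᵐ[circleMeasure] fun _ => 0 := by
    refine ae_eq_of_fourierCoeff hBL (memLp_const 0) fun k => ?_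
    have hz : fourierCoeff (fun _ : UnitAddCircle => (0 : ℂ)) k = 0 := by
      simp [fourierCoeff]
    rw [hz]
    by_cases hk : k < 0
    · exact fourierCoeff_eq_zero_of_neg hBL (fourierCoeff_eq_zero_of_neg hB1
        (fourierCoeff_eq_zero_of_neg hB2 fun k hk => hB3 k (Or.inl hk))) k hk
    · exact fourierCoeff_eq_zero_of_ge hBL (N := 0) (fourierCoeff_eq_zero_of_ge hB1 (N := 1)
        (fourierCoeff_eq_zero_of_ge hB2 (N := 2) fun k hk => hB3 k (Or.inr (by lia)))) k (by lia)
  have hH0 : (fun y => G 0 y + qpoly a c (circ y) * G 1 y) =ᵐ[circleMeasure] fun _ => 0 := by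
    filter_upwards [hy, hBz] with y hy hB
    rw [← hy.2.2.1, hB]
    ring
  -- The top coefficient of `G₀ + q G₁ = 0`. It makes `G₁` constant, so the division argument
  -- applied to `(1 + w) A` gives `A = 0`.
  have hG11 : coef (denSq a c f) ![1, 1] = 0 := by
    have h2 := hHc 2
    rw [fourierCoeff_congr_ae hH0, hspec _ _ (by lia), hspec _ _ (by lia)] at h2
    simp only [fourierCoeff, smul_zero, integral_zero, mul_zero, zero_add] at h2
    exact (mul_eq_zero.mp h2.symm).resolve_left hc0
  have hAG : ∀ᵐ y ∂circleMeasure, (1 + circ y) * A y = (-s⁻¹) * G 1 y := by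
    filter_upwards [hy, hBz] with y hy hB
    have h2 := hy.2.2.2
    rw [hB] at h2
    field_simp
    linear_combination h2
  have hAL : MemLp A 2 circleMeasure := by
    refine hAm ?_
    have hm : AEStronglyMeasurable (fun y => (-s⁻¹) * G 1 y / (1 + circ y)) circleMeasure :=
      (((hG 1).1.aemeasurable.const_mul _).div
        h1c.measurable.aemeasurable).aestronglyMeasurable
    refine hm.congr ?_
    filter_upwards [hAG, hne] with y hy hne
    rw [← hy]
    field_simp
  have hA1 : ∀ k : ℤ, (k < 0 ∨ 1 ≤ k) → fourierCoeff (fun y => (1 + circ y) * A y) k = 0 := by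
    intro k hk
    rw [fourierCoeff_congr_ae hAG, fourierCoeff.const_mul, h1]
    by_cases hk1 : k = 1
    · rw [hk1, hG11, mul_zero]
    · rw [hspec _ _ (by lia), mul_zero]
  have hAz : A =ᵐ[circleMeasure] fun _ => 0 := by
    refine ae_eq_of_fourierCoeff hAL (memLp_const 0) fun k => ?_
    have hz : fourierCoeff (fun _ : UnitAddCircle => (0 : ℂ)) k = 0 := by
      simp [fourierCoeff]
    rw [hz]
    by_cases hk : k < 0
    · exact fourierCoeff_eq_zero_of_neg hAL (fun k hk => hA1 k (Or.inl hk)) k hk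
    · exact fourierCoeff_eq_zero_of_ge hAL (N := 0) (fun k hk => hA1 k (Or.inr (by lia))) k
        (by lia)
  rw [Submodule.mem_bot, ← inner_self_eq_zero (𝕜 := ℂ), inner_self_eq_integral,
    integral_torus (integrable_mul_conj f)]
  refine integral_eq_zero_of_ae ?_
  filter_upwards [ae_integral_slice_eq hc hac hslice, hAz, hBz] with y h2 hA hB
  rw [h2, hA, hB]
  simp

/-- The second summand of every decomposition is the maximal invariant subspace. -/
theorem IsInvariantDecomposition.right_eq {a c : ℝ} (hc : 0 < c) (hac : a = 1 + c)
    {S₁ S₂ : Submodule ℂ L2} (h : IsInvariantDecomposition (bigTheta a c) S₁ S₂) :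
    S₂ = maxInvariant a c 0 := by
  have h1 : S₁ ≤ maxInvariant a c 1 := le_maxInvariant hc hac (i := 0) (by decide)
    (h.sup_eq ▸ le_sup_left) h.invariant_left
  have h2 : S₂ ≤ maxInvariant a c 0 := le_maxInvariant hc hac (i := 1) (by decide)
    (h.sup_eq ▸ le_sup_right) h.invariant_right
  refine le_antisymm h2 fun f hf => ?_
  have hf' := maxInvariant_le hc hac 0 hf
  rw [← h.sup_eq, Submodule.mem_sup] at hf'
  obtain ⟨f₁, hf₁, f₂, hf₂, rfl⟩ := hf'
  -- The `S₁` component of `f` equals `f - f₂`, so it lies in both maximal subspaces.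
  have h3 : f₁ ∈ maxInvariant a c 0 ⊓ maxInvariant a c 1 := by
    refine ⟨?_, h1 hf₁⟩
    simpa using (maxInvariant a c 0).sub_mem hf (h2 hf₂)
  rw [maxInvariant_inf_eq_bot hc hac, Submodule.mem_bot] at h3
  rwa [h3, zero_add]

/-! ### Bounds for the quadratic form -/

theorem inner_self_eq_integral_slice {a c : ℝ} (hc : 0 < c) (hac : a = 1 + c) {f : L2}
    {A B : UnitAddCircle → ℂ} (h : ∀ᵐ y ∂circleMeasure, circ y ≠ -1 ∧
      ∀ᵐ x ∂circleMeasure, f ![x, y] = slice a c (A y) (B y) (circ y) (circ x)) :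
    inner ℂ f f = ∫ y, (A y * conj (A y) + B y * conj (B y)) ∂circleMeasure := by
  rw [inner_self_eq_integral, integral_torus (integrable_mul_conj f)]
  exact integral_congr_ae (ae_integral_slice_eq hc hac h)

theorem inner_mulCoord_eq_integral_slice {a c : ℝ} (hc : 0 < c) (hac : a = 1 + c) {f : L2}
    {A B : UnitAddCircle → ℂ} (h : ∀ᵐ y ∂circleMeasure, circ y ≠ -1 ∧
      ∀ᵐ x ∂circleMeasure, f ![x, y] = slice a c (A y) (B y) (circ y) (circ x)) :
    inner ℂ f (mulCoord 0 f) = ∫ y, (sliceZero a c (circ y) *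
      (A y * conj (A y) + B y * conj (B y)) + A y * conj (B y) * (conj (slicePhase a c (circ y)) *
        (1 - sliceZero a c (circ y) * conj (sliceZero a c (circ y))))) ∂circleMeasure := by
  rw [inner_mulCoord_eq_integral, integral_torus (integrable_coord_mul_conj 0 f)]
  exact integral_congr_ae (ae_integral_coord_mul_slice_eq hc hac h)

/-- The numerical range of the `2 × 2` slice lies in the disk of centre `l` and radius `(1 - |l|²) /
2`, because `|A| |B| ≤ (|A|² + |B|²) / 2`. -/
theorem re_slice_form_le {u l β A B : ℂ} {K : ℝ} (hu : ‖u‖ = 1) (hβ : β * conj β = 1)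
    (hl : ‖l‖ < 1) (hK : (conj u * l).re + (1 - ‖l‖ ^ 2) / 2 ≤ K) :
    (conj u * (l * (A * conj A + B * conj B) +
      A * conj B * (conj β * (1 - l * conj l)))).re ≤ K * (A * conj A + B * conj B).re := by
  have hβn : ‖β‖ = 1 := by
    rw [Complex.mul_conj'] at hβ
    have : ‖β‖ ^ 2 = 1 := by exact_mod_cast hβ
    nlinarith [norm_nonneg β]
  have hN : A * conj A + B * conj B = ((‖A‖ ^ 2 + ‖B‖ ^ 2 : ℝ) : ℂ) := by
    rw [Complex.mul_conj', Complex.mul_conj']; push_cast; rfl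
  have hs : 1 - l * conj l = ((1 - ‖l‖ ^ 2 : ℝ) : ℂ) := by
    rw [Complex.mul_conj']; push_cast; rfl
  have hs0 : 0 ≤ 1 - ‖l‖ ^ 2 := by nlinarith [norm_nonneg l]
  rw [hN, hs, mul_add, Complex.add_re, Complex.ofReal_re, ← mul_assoc, Complex.re_mul_ofReal]
  have h1 : (conj u * (A * conj B * (conj β * ((1 - ‖l‖ ^ 2 : ℝ) : ℂ)))).re ≤
      ‖A‖ * ‖B‖ * (1 - ‖l‖ ^ 2) := by
    refine (Complex.re_le_norm _).trans_eq ?_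
    simp only [norm_mul, RCLike.norm_conj, hu, hβn, Complex.norm_real, Real.norm_of_nonneg hs0]
    ring
  have h2 : ‖A‖ * ‖B‖ ≤ (‖A‖ ^ 2 + ‖B‖ ^ 2) / 2 := by nlinarith [sq_nonneg (‖A‖ - ‖B‖)]
  have h3 := mul_le_mul_of_nonneg_right h2 hs0
  have h4 : 0 ≤ ‖A‖ ^ 2 + ‖B‖ ^ 2 := by positivity
  nlinarith [mul_le_mul_of_nonneg_right hK h4]

theorem re_inner_mulCoord_le {a c : ℝ} (hc : 0 < c) (hac : a = 1 + c) {u : ℂ} (hu : ‖u‖ = 1)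
    {K : ℝ} (hK : ∀ w : ℂ, ‖w‖ = 1 → w ≠ -1 →
      (conj u * sliceZero a c w).re + (1 - ‖sliceZero a c w‖ ^ 2) / 2 ≤ K)
    {f : L2} (hf : f ∈ maxInvariant a c 0) :
    (conj u * inner ℂ f (mulCoord 0 f)).re ≤ K * ‖f‖ ^ 2 := by
  obtain ⟨G, A, B, -, -, -, -, hy⟩ := exists_slice_coordinates hc hac hf
  have h : ∀ᵐ y ∂circleMeasure, circ y ≠ -1 ∧
      ∀ᵐ x ∂circleMeasure, f ![x, y] = slice a c (A y) (B y) (circ y) (circ x) :=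
    hy.mono fun y h => ⟨h.1, h.2.1⟩
  have hi1 : Integrable (fun y => A y * conj (A y) + B y * conj (B y)) circleMeasure :=
    (integrable_slice_integral (integrable_mul_conj f)).congr (ae_integral_slice_eq hc hac h)
  have hi2 := (integrable_slice_integral (integrable_coord_mul_conj 0 f)).congr
    (ae_integral_coord_mul_slice_eq hc hac h)
  have hn : ‖f‖ ^ 2 = (inner ℂ f f).re := by
    rw [inner_self_eq_norm_sq_to_K]; norm_cast
  rw [hn, inner_self_eq_integral_slice hc hac h, inner_mulCoord_eq_integral_slice hc hac h,
    ← integral_const_mul]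
  have e1 := integral_re (hi2.const_mul (conj u))
  have e2 := integral_re hi1
  simp only [RCLike.re_to_complex] at e1 e2
  rw [← e1, ← e2, ← integral_const_mul]
  refine integral_mono_ae (hi2.const_mul (conj u)).re (hi1.re.const_mul K) ?_
  filter_upwards [h] with y hy
  obtain ⟨h1, h2, -⟩ := blaschke_data hc hac (norm_circ y) hy.1
  exact re_slice_form_le hu h2 h1 (hK _ (norm_circ y) hy.1)

/-! ### Functions with prescribed slice coordinates -/

/-- Square integrable functions on the circle without negative frequencies. -/
def IsAnalyticCircle (g : UnitAddCircle → ℂ) : Prop :=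
  MemLp g 2 circleMeasure ∧ ∀ k < 0, fourierCoeff g k = 0

theorem isAnalyticCircle_const (u : ℂ) : IsAnalyticCircle fun _ => u := by
  refine ⟨memLp_const u, fun k hk => ?_⟩
  have h : fourierCoeff (fun _ : UnitAddCircle => (1 : ℂ)) k = 0 := by
    have h0 := fourierCoeff_fourier (T := 1) 0
    have h1 : (fun _ : UnitAddCircle => (1 : ℂ)) = fun x => fourier 0 x := by
      ext x; simp
    rw [h1]
    refine (congrFun h0 k).trans ?_
    simp [hk.ne]
  have h2 := fourierCoeff.const_mul (fun _ : UnitAddCircle => (1 : ℂ)) u k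
  simpa [h] using h2

theorem IsAnalyticCircle.affine_mul {g : UnitAddCircle → ℂ} (hg : IsAnalyticCircle g) (u v : ℂ) :
    IsAnalyticCircle fun x => (u + v * circ x) * g x := by
  refine ⟨MemLp.continuous_circ_mul hg.1 (by have := continuous_circ; fun_prop), fun k hk => ?_⟩
  rw [fourierCoeff_affine_mul hg.1, hg.2 k hk, hg.2 (k - 1) (by lia)]
  simp

theorem isAnalyticCircle_affine_pow_mul {g : UnitAddCircle → ℂ} (hg : IsAnalyticCircle g)
    (u v : ℂ) (N : ℕ) : IsAnalyticCircle fun x => (u + v * circ x) ^ N * g x := by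
  induction N with
  | zero => simpa using hg
  | succ N ih =>
    have h := ih.affine_mul u v
    simpa only [pow_succ', mul_assoc] using h

/-- The function with slice coordinates `((1 + conj w₀ * z₂) / 2) ^ N * A` and
`((1 + conj w₀ * z₂) / 2) ^ N * B`. -/
def peakFunction (a c : ℝ) (w₀ A B : ℂ) (N : ℕ) (t : Torus) : ℂ :=
  slice a c ((1 / 2 + conj w₀ / 2 * coord 1 t) ^ N * A)
    ((1 / 2 + conj w₀ / 2 * coord 1 t) ^ N * B) (coord 1 t) (coord 0 t)

theorem measurable_peakFunction (a c : ℝ) (w₀ A B : ℂ) (N : ℕ) :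
    Measurable (peakFunction a c w₀ A B N) := by
  unfold peakFunction slice qpoly
  refine Measurable.div (Continuous.measurable ?_) (Continuous.measurable ?_) <;> fun_prop

theorem peakFunction_vec (a c : ℝ) (w₀ A B : ℂ) (N : ℕ) (x y : UnitAddCircle) :
    peakFunction a c w₀ A B N ![x, y] = slice a c ((1 / 2 + conj w₀ / 2 * circ y) ^ N * A)
      ((1 / 2 + conj w₀ / 2 * circ y) ^ N * B) (circ y) (circ x) := by
  simp only [peakFunction, coord_eq_circ, Matrix.cons_val_zero, Matrix.cons_val_one]

/-- `p` vanishes at `(1, -1)`, so boundedness is not available; the slice norms are known exactly,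
and Tonelli concludes. -/
theorem memLp_peakFunction {a c : ℝ} (hc : 0 < c) (hac : a = 1 + c) (w₀ A B : ℂ) (N : ℕ) :
    MemLp (peakFunction a c w₀ A B N) 2 torusMeasure := by
  have hm := measurable_peakFunction a c w₀ A B N
  rw [memLp_two_iff_integrable_sq_norm hm.aestronglyMeasurable,
    ← measurePreserving_vec.integrable_comp_emb measurableEmbedding_vec, integrable_prod_iff'
      ((hm.norm.pow_const 2).comp measurableEmbedding_vec.measurable).aestronglyMeasurable]
  constructor
  · filter_upwards [ae_toCircle_ne (-1)] with y hy
    have h1 : Continuous fun x => ‖peakFunction a c w₀ A B N ![x, y]‖ ^ 2 := by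
      simp only [peakFunction_vec, slice]
      have := continuous_circ
      refine (Continuous.norm (Continuous.div (by fun_prop) (by fun_prop) fun x => ?_)).pow 2
      rw [← den_vec]
      refine pow_ne_zero 2 (den_ne_zero hc hac ?_)
      exact hy
    exact h1.integrable_of_hasCompactSupport (HasCompactSupport.of_compactSpace _)
  · have h2 : Continuous fun y => ‖(1 / 2 + conj w₀ / 2 * circ y) ^ N * A‖ ^ 2 +
        ‖(1 / 2 + conj w₀ / 2 * circ y) ^ N * B‖ ^ 2 := by
      have := continuous_circ
      fun_prop
    refine (h2.integrable_of_hasCompactSupport (μ := circleMeasure)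
      (HasCompactSupport.of_compactSpace _)).congr ?_
    filter_upwards [ae_toCircle_ne (-1)] with y hy
    have h3 := integral_slice hc hac (norm_circ y) hy ((1 / 2 + conj w₀ / 2 * circ y) ^ N * A)
      ((1 / 2 + conj w₀ / 2 * circ y) ^ N * B)
    simp only [Complex.mul_conj'] at h3
    rw [← Complex.ofReal_inj]
    simp only [Function.comp_apply, peakFunction_vec, norm_pow, norm_norm]
    rw [← integral_complex_ofReal]
    push_cast
    rw [h3]

/-- On the circle `w conj (q(w)) = a w + c`, so `p²` times the function is visibly affine in `z₁`
with coefficients analytic in `z₂`. -/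
theorem peakFunction_mem {a c : ℝ} (hc : 0 < c) (hac : a = 1 + c) (w₀ A B : ℂ) (N : ℕ) :
    (memLp_peakFunction hc hac w₀ A B N).toLp _ ∈ maxInvariant a c 0 := by
  rw [mem_maxInvariant_iff_denSq hc hac]
  set g : UnitAddCircle → ℂ := fun y => (1 / 2 + conj w₀ / 2 * circ y) ^ N *
    ((1 + 1 * circ y) * (Real.sqrt (a * c) : ℂ)) with hg_def
  have hg : IsAnalyticCircle g :=
    isAnalyticCircle_affine_pow_mul ((isAnalyticCircle_const _).affine_mul 1 1) _ _ N
  have hG₀ := hg.affine_mul (A * a) (A * c - B)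
  have hG₁ := hg.affine_mul (B * c - A) (B * a)
  have hm₀ := memLp_comp_snd hG₀.1
  have hm₁ : MemLp (fun t : Torus => coord 0 t * ((B * c - A + B * a * circ (t 1)) * g (t 1))) 2
      torusMeasure := MemLp.continuous_mul (memLp_comp_snd hG₁.1) (coord 0).continuous
  have hden : denSq a c ((memLp_peakFunction hc hac w₀ A B N).toLp _) =ᵐ[torusMeasure]
      fun t => (A * a + (A * c - B) * circ (t 1)) * g (t 1) +
        coord 0 t * ((B * c - A + B * a * circ (t 1)) * g (t 1)) := by
    filter_upwards [(memLp_peakFunction hc hac w₀ A B N).coeFn_toLp, ae_den_ne_zero hc hac]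
      with t h1 h2
    have h3 : den a c t = qpoly a c (coord 1 t) - coord 0 t := by
      simp only [den, poly, qpoly]; ring
    have h4 : coord 1 t * conj (qpoly a c (coord 1 t)) = a * coord 1 t + c := by
      have h5 := coord_mul_conj 1 t
      simp only [qpoly, map_add, map_mul, Complex.conj_ofReal]
      linear_combination (c : ℂ) * h5
    have h5 : qpoly a c (coord 1 t) = a + c * coord 1 t := rfl
    have h6 : ∀ X, den a c t * (den a c t * (X / den a c t ^ 2)) = X := by
      intro X
      field_simp
    have h7 : circ (t 1) = coord 1 t := rfl
    rw [denSq, h1, peakFunction, slice, ← h3, h6, h3]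
    simp only [hg_def, h7]
    linear_combination ((Real.sqrt (a * c) : ℂ) * (1 + coord 1 t) *
      (1 / 2 + conj w₀ / 2 * coord 1 t) ^ N) * (A * h5 + B * coord 0 t * h4)
  intro n hn
  rw [coef_congr hden, coef_add (hm₀.integrable (by norm_num)) (hm₁.integrable (by norm_num)),
    coef_coord_mul, coef_comp_snd (G := fun y => (A * a + (A * c - B) * circ y) * g y),
    coef_comp_snd (G := fun y => (B * c - A + B * a * circ y) * g y)]
  have h3 : (n - unitFreq 0) 1 = n 1 := by simp
  have h4 : (n - unitFreq 0) 0 = n 0 - 1 := by simp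
  rw [h3, h4]
  by_cases h1 : n 1 < 0
  · rw [hG₀.2 _ h1, hG₁.2 _ h1]
    simp
  · have h5 : n 0 < 0 ∨ 2 ≤ n 0 := by
      rcases hn with ⟨i, hi⟩ | hn
      · fin_cases i
        · exact Or.inl hi
        · exact absurd hi h1
      · exact Or.inr hn
    rw [if_neg (by lia), if_neg (by lia), add_zero]

/-- The numerical range of the compressed shift on `maxInvariant a c 0`. -/
def shiftRange (a c : ℝ) : Set ℂ :=
  {w | ∃ f ∈ maxInvariant a c 0, ‖f‖ = 1 ∧ inner ℂ f (mulCoord 0 f) = w}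

theorem continuous_sliceZero {a c : ℝ} (hc : 0 < c) (hac : a = 1 + c) :
    Continuous (fun y => sliceZero a c (circ y)) ∧ Continuous fun y => slicePhase a c (circ y) := by
  have h0 : ∀ y, qpoly a c (circ y) ≠ 0 := fun y => qpoly_ne_zero hc hac (norm_circ y)
  have h1 : Continuous fun y => qpoly a c (circ y) := by
    have := continuous_circ
    unfold qpoly
    fun_prop
  have h2 : Continuous fun y => conj (qpoly a c (circ y)) := RCLike.continuous_conj.comp h1
  exact ⟨h2.inv₀ fun y => by simpa using h0 y, (continuous_circ.mul h2).div h1 h0⟩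

/-- The values of the slices of the compressed shift belong to the closure of its numerical
range. -/
theorem slice_form_mem_closure {a c : ℝ} (hc : 0 < c) (hac : a = 1 + c) (y₀ : UnitAddCircle)
    {A B : ℂ} (hAB : A * conj A + B * conj B = 1) :
    sliceZero a c (circ y₀) + A * conj B * (conj (slicePhase a c (circ y₀)) *
      (1 - sliceZero a c (circ y₀) * conj (sliceZero a c (circ y₀)))) ∈
        closure (shiftRange a c) := by
  set V : UnitAddCircle → ℂ := fun y => sliceZero a c (circ y) + A * conj B *
    (conj (slicePhase a c (circ y)) * (1 - sliceZero a c (circ y) *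
      conj (sliceZero a c (circ y)))) with hV_def
  have hV : Continuous V := by
    obtain ⟨h1, h2⟩ := continuous_sliceZero hc hac
    have h3 := RCLike.continuous_conj.comp h1
    have h4 := RCLike.continuous_conj.comp h2
    exact h1.add (continuous_const.mul (h4.mul (continuous_const.sub (h1.mul h3))))
  set m : UnitAddCircle → ℂ := fun y => 1 / 2 + conj (circ y₀) / 2 * circ y with hm_def
  set d : UnitAddCircle → ℝ := fun y => ‖m y‖ ^ 2 with hd_def
  have hmc : Continuous m := by
    have := continuous_circ
    fun_prop
  have hd : Continuous d := by fun_prop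
  have hm0 : m y₀ = 1 := by
    have h : conj (circ y₀) * circ y₀ = 1 := by
      rw [Complex.conj_mul', norm_circ]; norm_num
    rw [hm_def]
    linear_combination h / 2
  have hd0 : d y₀ = 1 := by simp [hd_def, hm0]
  -- `|(1 + v) / 2| < 1` for unimodular `v ≠ 1`, so the normalised weights `d ^ N` concentrate at
  -- `y₀`.
  have hdlt : ∀ y, y ≠ y₀ → d y < d y₀ := by
    intro y hy
    have h1 : conj (circ y₀) * circ y ≠ 1 := by
      intro h
      refine hy (AddCircle.injective_toCircle one_ne_zero (Subtype.ext ?_))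
      change circ y = circ y₀
      have h2 : circ y₀ * conj (circ y₀) = 1 := by
        rw [Complex.mul_conj', norm_circ]; norm_num
      linear_combination circ y₀ * h - circ y * h2
    set v := conj (circ y₀) * circ y with hv
    have hvn : ‖v‖ = 1 := by rw [hv, norm_mul, RCLike.norm_conj, norm_circ, norm_circ, one_mul]
    have hv2 : v.re ^ 2 + v.im ^ 2 = 1 := by
      have := Complex.sq_norm v
      rw [hvn, Complex.normSq_apply] at this
      nlinarith
    have hre : v.re < 1 := by
      by_contra! hge
      have h4 : v.re = 1 := by nlinarith [sq_nonneg v.im]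
      have h5 : v.im = 0 := by nlinarith [sq_nonneg v.im]
      exact h1 (Complex.ext (by simp [h4]) (by simp [h5]))
    have hmv : m y = 1 / 2 + 1 / 2 * v := by rw [hm_def, hv]; ring
    rw [hd0, hd_def]
    simp only [hmv]
    rw [Complex.sq_norm, Complex.normSq_apply]
    simp
    nlinarith
  have hlim := tendsto_setIntegral_pow_smul_of_unique_maximum_of_isCompact_of_continuousOn
    (μ := circleMeasure) (x₀ := y₀) (s := univ) isCompact_univ (c := d) hd.continuousOn
    (fun y _ hy => hdlt y hy) (fun y _ => by positivity) (by rw [hd0]; exact one_pos) (by simp)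
    hV.continuousOn
  refine mem_closure_of_tendsto hlim (Filter.Eventually.of_forall fun N => ?_)
  simp only [setIntegral_univ]
  set f := (memLp_peakFunction hc hac (circ y₀) A B N).toLp _ with hf_def
  have hf := peakFunction_mem hc hac (circ y₀) A B N
  have hslice : ∀ᵐ y ∂circleMeasure, circ y ≠ -1 ∧ ∀ᵐ x ∂circleMeasure, f ![x, y] =
      slice a c (m y ^ N * A) (m y ^ N * B) (circ y) (circ x) := by
    filter_upwards [ae_toCircle_ne (-1),
      ae_ae_of_ae_torus (memLp_peakFunction hc hac (circ y₀) A B N).coeFn_toLp] with y h1 h2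
    refine ⟨h1, ?_⟩
    filter_upwards [h2] with x h2
    rw [hf_def, h2, peakFunction_vec]
  have hdm : ∀ y, (m y) ^ N * conj (m y ^ N) = ((d y ^ N : ℝ) : ℂ) := by
    intro y
    rw [Complex.mul_conj', hd_def]
    simp only [norm_pow]
    push_cast
    ring
  have hIpos : 0 < ∫ y, d y ^ N ∂circleMeasure := by
    refine (hd.pow N).integral_pos_of_hasCompactSupport_nonneg_nonzero
      (HasCompactSupport.of_compactSpace _) (fun y => by positivity) (x := y₀) ?_
    rw [hd0]
    simp
  have hff : inner ℂ f f = ((∫ y, d y ^ N ∂circleMeasure : ℝ) : ℂ) := by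
    rw [inner_self_eq_integral_slice hc hac (A := fun y => m y ^ N * A) (B := fun y => m y ^ N * B)
      hslice, ← integral_complex_ofReal]
    congr 1
    ext y
    rw [← hdm, map_mul, map_mul]
    linear_combination (m y ^ N * conj (m y ^ N)) * hAB
  have hfM : inner ℂ f (mulCoord 0 f) = ∫ y, d y ^ N • V y ∂circleMeasure := by
    rw [inner_mulCoord_eq_integral_slice hc hac (A := fun y => m y ^ N * A)
      (B := fun y => m y ^ N * B) hslice]
    congr 1
    ext y
    rw [Complex.real_smul, ← hdm, map_mul, map_mul, hV_def]
    linear_combination (sliceZero a c (circ y) * m y ^ N * conj (m y ^ N)) * hAB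
  set I : ℝ := ∫ y, d y ^ N ∂circleMeasure with hI
  have hnorm : ‖f‖ ^ 2 = I := by
    refine Complex.ofReal_injective ?_
    rw [← hff, inner_self_eq_norm_sq_to_K]
    push_cast
    rfl
  have hnpos : 0 < ‖f‖ := by
    rw [norm_pos_iff]
    rintro h
    rw [h, norm_zero] at hnorm
    norm_num at hnorm
    linarith
  refine ⟨((‖f‖⁻¹ : ℝ) : ℂ) • f, Submodule.smul_mem _ _ hf, ?_, ?_⟩
  · rw [norm_smul, Complex.norm_real, norm_inv, norm_norm, inv_mul_cancel₀ hnpos.ne']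
  · rw [map_smul, inner_smul_left, inner_smul_right, hfM, Complex.real_smul, Complex.conj_ofReal,
      ← hnorm]
    push_cast
    ring

/-! ### Convexity of numerical ranges -/

section

variable {H : Type*} [NormedAddCommGroup H] [InnerProductSpace ℂ H]

theorem exists_unit_real_mul (p : ℂ) : ∃ ω : ℂ, ‖ω‖ = 1 ∧ (ω * p).im = 0 := by
  by_cases hp : p = 0
  · exact ⟨1, norm_one, by simp [hp]⟩
  · refine ⟨conj p / ‖p‖, ?_, ?_⟩
    · have : ‖p‖ ≠ 0 := norm_ne_zero_iff.mpr hp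
      rw [norm_div, RCLike.norm_conj, Complex.norm_real, norm_norm, div_self this]
    · rw [div_mul_eq_mul_div, Complex.conj_mul', ← Complex.ofReal_pow, ← Complex.ofReal_div,
        Complex.ofReal_im]

/-- The Toeplitz–Hausdorff theorem, in normalised form. -/
theorem ofReal_mem_numericalRange {T : H →L[ℂ] H} {x y : H} (hx : ‖x‖ = 1) (hy : ‖y‖ = 1)
    (h0 : inner ℂ x (T x) = 0) (h1 : inner ℂ y (T y) = 1) {t : ℝ} (ht : t ∈ Icc (0 : ℝ) 1) :
    (t : ℂ) ∈ numericalRange T := by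
  -- Rotating `y` by this phase makes the sum of the cross terms real. The form is then real along
  -- the segment from `x` to `ω y`, and the intermediate value theorem applies.
  obtain ⟨ω, hω, him⟩ := exists_unit_real_mul (inner ℂ x (T y) - conj (inner ℂ y (T x)))
  set z := ω • y with hz
  have hzn : ‖z‖ = 1 := by rw [hz, norm_smul, hω, hy, one_mul]
  have hωc : conj ω * ω = 1 := by rw [Complex.conj_mul', hω]; norm_num
  have h1' : inner ℂ z (T z) = 1 := by
    rw [hz, map_smul, inner_smul_left, inner_smul_right, h1]
    linear_combination hωc
  obtain ⟨k, hk⟩ : ∃ k : ℝ, inner ℂ x (T z) + inner ℂ z (T x) = (k : ℂ) := by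
    refine ⟨(inner ℂ x (T z) + inner ℂ z (T x)).re, ?_⟩
    refine Complex.ext (by simp) ?_
    rw [Complex.ofReal_im, hz, map_smul, inner_smul_left, inner_smul_right]
    simp only [Complex.add_im, Complex.mul_im, Complex.conj_re, Complex.conj_im, Complex.sub_re,
      Complex.sub_im] at him ⊢
    linarith
  set v : ℝ → H := fun s => ((1 - s : ℝ) : ℂ) • x + ((s : ℝ) : ℂ) • z with hv
  have hform : ∀ s, inner ℂ (v s) (T (v s)) = ((s ^ 2 + s * (1 - s) * k : ℝ) : ℂ) := by
    intro s
    simp only [hv, map_add, map_smul, inner_add_left, inner_add_right, inner_smul_left,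
      inner_smul_right, Complex.conj_ofReal, h0, h1']
    push_cast
    linear_combination ((1 - s) * s : ℂ) * hk
  have hvne : ∀ s, v s ≠ 0 := by
    intro s hs
    have h2 : ((1 - s : ℝ) : ℂ) • x = -(((s : ℝ) : ℂ) • z) := eq_neg_of_add_eq_zero_left hs
    have h3 := congrArg (fun w => inner ℂ w (T w)) h2
    simp only [map_neg, inner_neg_left, inner_neg_right, map_smul, inner_smul_left,
      inner_smul_right, Complex.conj_ofReal, h0, h1', mul_zero, mul_one] at h3
    have h4 : s = 0 := by
      have h5 : -(s * -s) = 0 := by exact_mod_cast h3.symm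
      exact mul_self_eq_zero.mp (by linarith)
    subst h4
    simp only [hv, sub_zero, Complex.ofReal_one, one_smul, Complex.ofReal_zero, zero_smul,
      add_zero] at hs
    rw [hs, norm_zero] at hx
    exact zero_ne_one hx
  have hcont : ContinuousOn (fun s => (s ^ 2 + s * (1 - s) * k) / ‖v s‖ ^ 2) (Icc (0 : ℝ) 1) := by
    have hvc : Continuous v := by rw [hv]; fun_prop
    refine Continuous.continuousOn (Continuous.div (by fun_prop) (by fun_prop) fun s => ?_)
    exact pow_ne_zero 2 (norm_ne_zero_iff.mpr (hvne s))
  have hsub := intermediate_value_Icc zero_le_one hcont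
  have hv0 : (0 : ℝ) ^ 2 + 0 * (1 - 0) * k = 0 := by ring
  have hv1 : ((1 : ℝ) ^ 2 + 1 * (1 - 1) * k) / ‖v 1‖ ^ 2 = 1 := by simp [hv, hzn]
  simp only [hv0, hv1, zero_div] at hsub
  obtain ⟨s, -, hs⟩ := hsub ht
  refine ⟨((‖v s‖⁻¹ : ℝ) : ℂ) • v s, ?_, ?_⟩
  · rw [norm_smul, Complex.norm_real, norm_inv, norm_norm,
      inv_mul_cancel₀ (norm_ne_zero_iff.mpr (hvne s))]
  · rw [map_smul, inner_smul_left, inner_smul_right, hform, ← hs, Complex.conj_ofReal]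
    push_cast
    field_simp

/-- The Toeplitz–Hausdorff theorem. -/
theorem convex_numericalRange (T : H →L[ℂ] H) : Convex ℝ (numericalRange T) := by
  rintro _ ⟨x, hx, rfl⟩ _ ⟨y, hy, rfl⟩ s t hs ht hst
  by_cases h : inner ℂ x (T x) = inner ℂ y (T y)
  · rw [← h, ← add_smul, hst, one_smul]
    exact ⟨x, hx, rfl⟩
  · set p := inner ℂ x (T x) with hp
    set d := inner ℂ y (T y) - p with hd
    have hd0 : d ≠ 0 := by rw [hd, sub_ne_zero]; exact Ne.symm h
    -- Affine normalisation sending the two given values to `0` and `1`.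
    set T' : H →L[ℂ] H := d⁻¹ • (T - p • ContinuousLinearMap.id ℂ H) with hT'
    have hform : ∀ w : H, ‖w‖ = 1 → inner ℂ w (T' w) = d⁻¹ * (inner ℂ w (T w) - p) := by
      intro w hw
      simp only [hT', smul_apply, sub_apply,
        ContinuousLinearMap.id_apply, inner_smul_right, inner_sub_right,
        inner_self_eq_norm_sq_to_K, hw]
      simp
    have h0 : inner ℂ x (T' x) = 0 := by rw [hform x hx, ← hp, sub_self, mul_zero]
    have h1 : inner ℂ y (T' y) = 1 := by rw [hform y hy, ← hd, inv_mul_cancel₀ hd0]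
    obtain ⟨w, hw, hwt⟩ := ofReal_mem_numericalRange hx hy h0 h1 (t := t) ⟨ht, by linarith⟩
    refine ⟨w, hw, ?_⟩
    rw [hform w hw] at hwt
    have h2 : inner ℂ w (T w) = t * d + p := by
      field_simp at hwt
      linear_combination hwt
    have h3 : inner ℂ y (T y) = d + p := by rw [hd]; ring
    have h4 : (s : ℂ) = 1 - t := by
      rw [eq_sub_of_add_eq hst]; push_cast; rfl
    rw [h2, h3, Complex.real_smul, Complex.real_smul, h4]
    ring

end

/-! ### Planar convex sets -/

/-- A supporting line at a point outside the interior: Hahn–Banach separates it from the interior,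
whose closure contains `S`. -/
theorem exists_unit_forall_re_le {S : Set ℂ} (hS : Convex ℝ S) (hne : (interior S).Nonempty)
    {z : ℂ} (hz : z ∉ interior S) :
    ∃ u : ℂ, ‖u‖ = 1 ∧ ∀ w ∈ S, (conj u * w).re ≤ (conj u * z).re := by
  obtain ⟨f, hf⟩ := geometric_hahn_banach_open_point hS.interior isOpen_interior hz
  have hfr : ∀ w : ℂ, f w = (conj (f 1 + f Complex.I * Complex.I : ℂ) * w).re := by
    intro w
    have h1 : w = w.re • (1 : ℂ) + w.im • Complex.I := by
      simp
    conv_lhs => rw [h1, map_add, map_smul, map_smul]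
    simp
    ring
  set v : ℂ := (f 1 + f Complex.I * Complex.I : ℂ) with hv
  have hle : ∀ w ∈ S, f w ≤ f z := by
    intro w hw
    have h1 : w ∈ closure (interior S) := by
      rw [hS.closure_interior_eq_closure_of_nonempty_interior hne]
      exact subset_closure hw
    have h2 : closure (interior S) ⊆ {w | f w ≤ f z} :=
      closure_minimal (fun w hw => (hf w hw).le) (isClosed_le f.continuous continuous_const)
    exact h2 h1
  have hv0 : v ≠ 0 := by
    intro h
    obtain ⟨w, hw⟩ := hne
    have h1 := hf w hw
    rw [hfr, hfr z, h] at h1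
    simp at h1
  have hvn : 0 < ‖v‖ := norm_pos_iff.mpr hv0
  refine ⟨v / ‖v‖, ?_, fun w hw => ?_⟩
  · rw [norm_div, Complex.norm_real, norm_norm, div_self hvn.ne']
  · have h1 := hle w hw
    rw [hfr, hfr z] at h1
    have h2 : ∀ x : ℂ, (conj (v / ‖v‖) * x).re = (conj v * x).re / ‖v‖ := by
      intro x
      rw [map_div₀, Complex.conj_ofReal, div_mul_eq_mul_div, Complex.div_ofReal_re]
    rw [h2, h2]
    gcongr

/-- Three non-collinear points in the closure suffice, since the affine span is closed in finite
dimension. -/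
theorem nonempty_interior_of_closure {S : Set ℂ} (hS : Convex ℝ S) {z : ℂ} {x₁ x₂ : ℝ}
    (hx : x₁ ≠ x₂) (hz : z.im ≠ 0) (h₁ : (x₁ : ℂ) ∈ closure S) (h₂ : (x₂ : ℂ) ∈ closure S)
    (h₃ : z ∈ closure S) : (interior S).Nonempty := by
  rw [hS.interior_nonempty_iff_affineSpan_eq_top]
  have hsub : closure S ⊆ affineSpan ℝ S :=
    closure_minimal (subset_affineSpan ℝ S) (AffineSubspace.closed_of_finiteDimensional _)
  rw [eq_top_iff]
  intro w _
  have e1 := AffineSubspace.vsub_mem_direction (hsub h₁) (hsub h₂)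
  have e2 := AffineSubspace.vsub_mem_direction (hsub h₃) (hsub h₂)
  obtain ⟨r, hr⟩ : ∃ r : ℝ, r = w.im / z.im := ⟨_, rfl⟩
  obtain ⟨q, hq⟩ : ∃ q : ℝ, q = (w.re - x₂ - r * (z.re - x₂)) / (x₁ - x₂) := ⟨_, rfl⟩
  have hw : w = (r • (z -ᵥ (x₂ : ℂ)) + q • ((x₁ : ℂ) -ᵥ (x₂ : ℂ))) +ᵥ (x₂ : ℂ) := by
    have hd' : x₁ - x₂ ≠ 0 := sub_ne_zero.mpr hx
    apply Complex.ext
    · have h : q * (x₁ - x₂) = w.re - x₂ - r * (z.re - x₂) := by rw [hq]; field_simp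
      simp
      linarith
    · have h : r * z.im = w.im := by rw [hr]; field_simp
      simp [h]
  rw [hw]
  exact AffineSubspace.vadd_mem_of_mem_direction
    (Submodule.add_mem _ (Submodule.smul_mem _ _ e2) (Submodule.smul_mem _ _ e1)) (hsub h₂)

/-! ### The support function of the union of the disks -/

/-- The support function of the union of the disks of the family. -/
def supportFun (a c : ℝ) (u : ℂ) : ℝ :=
  a / (a + c) * u.re + a / (a + c) * (c / (a + c)) + c / (a + c) * ‖u - (a / (a + c) : ℝ)‖

theorem center_eq (a c θ : ℝ) :
    center a c θ = (a / (a + c) : ℝ) + (c / (a + c) : ℝ) * Complex.exp (θ * Complex.I) := by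
  rw [center]
  push_cast
  ring

theorem radius_eq (a c θ : ℝ) :
    radius a c θ = a / (a + c) * (c / (a + c)) * (1 - Real.cos θ) := by
  rw [radius, sq, div_mul_div_comm, div_mul_eq_mul_div]

/-- The left side is affine in `ε`; its varying part is `γ Re (ε conj (u - α))`, which is at most `γ
|u - α|` with `α = a / (a + c)`, `γ = c / (a + c)`. -/
theorem re_conj_mul_add_le_supportFun {a c : ℝ} (ha : 0 < a) (hc : 0 < c) {u ε : ℂ}
    (hε : ‖ε‖ = 1) :
    (conj u * ((a / (a + c) : ℝ) + (c / (a + c) : ℝ) * ε)).re +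
      a / (a + c) * (c / (a + c)) * (1 - ε.re) ≤ supportFun a c u := by
  set p := a / (a + c)
  set q := c / (a + c)
  have hq : 0 ≤ q := by positivity
  have h1 : (ε * conj (u - (p : ℂ))).re ≤ ‖u - (p : ℂ)‖ := by
    refine (Complex.re_le_norm _).trans_eq ?_
    rw [norm_mul, RCLike.norm_conj, hε, one_mul]
  have h2 := mul_le_mul_of_nonneg_left h1 hq
  rw [supportFun]
  refine le_trans (le_of_eq ?_) (add_le_add_right h2 _)
  simp
  ring

section

variable {a c : ℝ} (ha : 0 < a) (hc : 0 < c) (θ : ℝ)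

include ha hc in
theorem ratio_mem : 0 < a / (a + c) ∧ a / (a + c) < 1 ∧ 0 < c / (a + c) ∧
    a / (a + c) + c / (a + c) = 1 := by
  refine ⟨by positivity, ?_, by positivity, by field_simp⟩
  rw [div_lt_one (by positivity)]
  linarith

include ha hc in
theorem abs_mul_sin_lt : |a / (a + c) * Real.sin θ| < 1 := by
  obtain ⟨h1, h2, -, -⟩ := ratio_mem ha hc
  rw [abs_mul, abs_of_pos h1]
  have := Real.abs_sin_le_one θ
  have h0 := abs_nonneg (Real.sin θ)
  nlinarith

include ha hc in
theorem sin_arcsin_mul_sin :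
    Real.sin (Real.arcsin (a / (a + c) * Real.sin θ)) = a / (a + c) * Real.sin θ := by
  have h := abs_lt.mp (abs_mul_sin_lt ha hc θ)
  exact Real.sin_arcsin h.1.le h.2.le

include ha hc in
theorem cos_arcsin_pos : 0 < Real.cos (Real.arcsin (a / (a + c) * Real.sin θ)) := by
  have h := abs_lt.mp (abs_mul_sin_lt ha hc θ)
  refine Real.cos_pos_of_mem_Ioo ⟨?_, ?_⟩
  · rw [Real.neg_pi_div_two_lt_arcsin]; exact h.1
  · rw [Real.arcsin_lt_pi_div_two]; exact h.2

include ha hc in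
theorem cos_mul_lt_cos_arcsin :
    a / (a + c) * Real.cos θ < Real.cos (Real.arcsin (a / (a + c) * Real.sin θ)) := by
  obtain ⟨h1, h2, -, -⟩ := ratio_mem ha hc
  have hpos := cos_arcsin_pos ha hc θ
  have hs := sin_arcsin_mul_sin ha hc θ
  have h3 := Real.sin_sq_add_cos_sq (Real.arcsin (a / (a + c) * Real.sin θ))
  have h4 := Real.sin_sq_add_cos_sq θ
  rw [hs] at h3
  refine lt_of_pow_lt_pow_left₀ 2 hpos.le ?_
  have h5 : (a / (a + c)) ^ 2 < 1 := by nlinarith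
  nlinarith

include ha hc in
-- The geometric meaning of `s₁`: the ray from `α = a / (a + c)` in the direction `e^{iθ}` meets the
-- unit circle at `e^{i s₁(θ)}`. The coefficient of `e^{iθ}` is the length of the segment, positive
-- by `cos_mul_lt_cos_arcsin`.
theorem exp_angle : Complex.exp (angle a c θ * Complex.I) = (a / (a + c) : ℝ) +
    ((Real.cos (Real.arcsin (a / (a + c) * Real.sin θ)) - a / (a + c) * Real.cos θ : ℝ) : ℂ) *
      Complex.exp (θ * Complex.I) := by
  have hs := sin_arcsin_mul_sin ha hc θ
  have h4 := Real.sin_sq_add_cos_sq θ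
  rw [angle]
  set ψ := Real.arcsin (a / (a + c) * Real.sin θ)
  apply Complex.ext
  · simp only [Complex.add_re, Complex.ofReal_re, Complex.re_ofReal_mul, Complex.exp_ofReal_mul_I_re,
      Real.cos_sub, hs]
    linear_combination (a / (a + c)) * h4
  · simp only [Complex.add_im, Complex.ofReal_im, Complex.im_ofReal_mul,
      Complex.exp_ofReal_mul_I_im, Real.sin_sub, hs]
    ring

theorem radius_nonneg (ha : 0 < a) (hc : 0 < c) : 0 ≤ radius a c θ := by
  rw [radius_eq]
  have := Real.cos_le_one θ
  have h : 0 ≤ 1 - Real.cos θ := by linarith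
  positivity

include ha hc in
theorem re_conj_mul_le_of_mem_closedBall {u z : ℂ} (hu : ‖u‖ = 1)
    (hz : z ∈ Metric.closedBall (center a c θ) (radius a c θ)) :
    (conj u * z).re ≤ supportFun a c u := by
  have h1 := re_conj_mul_add_le_supportFun ha hc (u := u) (Complex.norm_exp_ofReal_mul_I θ)
  rw [← center_eq, Complex.exp_ofReal_mul_I_re, ← radius_eq] at h1
  have h2 : (conj u * (z - center a c θ)).re ≤ radius a c θ := by
    refine (Complex.re_le_norm _).trans ?_
    rw [norm_mul, RCLike.norm_conj, hu, one_mul]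
    exact mem_closedBall_iff_norm.mp hz
  rw [mul_sub, Complex.sub_re] at h2
  linarith

include ha hc in
theorem curve_mem_closedBall : curve a c θ ∈ Metric.closedBall (center a c θ) (radius a c θ) := by
  rw [mem_closedBall_iff_norm, curve, add_sub_cancel_left, norm_mul,
    Complex.norm_exp_ofReal_mul_I, mul_one, Complex.norm_real,
    Real.norm_of_nonneg (radius_nonneg θ ha hc)]

include ha hc in
-- By `exp_angle`, `e^{iθ}` is the direction of `u - a / (a + c)`, the equality case of the bound
-- for the support function.
theorem re_conj_exp_angle_mul_curve :
    (conj (Complex.exp (angle a c θ * Complex.I)) * curve a c θ).re =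
      supportFun a c (Complex.exp (angle a c θ * Complex.I)) := by
  set u := Complex.exp (angle a c θ * Complex.I) with hu
  have hun : ‖u‖ = 1 := Complex.norm_exp_ofReal_mul_I _
  have huu : conj u * u = 1 := by rw [Complex.conj_mul', hun]; norm_num
  have hρ := sub_pos.mpr (cos_mul_lt_cos_arcsin ha hc θ)
  have he := exp_angle ha hc θ
  rw [← hu] at he
  set ρ := Real.cos (Real.arcsin (a / (a + c) * Real.sin θ)) - a / (a + c) * Real.cos θ
  set p := a / (a + c)
  set q := c / (a + c) with hq
  set ε := Complex.exp (θ * Complex.I) with hε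
  have hεn : ‖ε‖ = 1 := Complex.norm_exp_ofReal_mul_I _
  have hεε : ε * conj ε = 1 := by rw [Complex.mul_conj', hεn]; norm_num
  have hεre : ε.re = Real.cos θ := Complex.exp_ofReal_mul_I_re θ
  have hnorm : ‖u - (p : ℂ)‖ = ρ := by
    rw [he, add_sub_cancel_left, norm_mul, hεn, mul_one, Complex.norm_real,
      Real.norm_of_nonneg hρ.le]
  have hcurve : conj u * curve a c θ =
      (p : ℂ) * conj u + (q : ℂ) * (ε * (p + ρ * conj ε)) + radius a c θ := by
    have h1 : conj u = p + ρ * conj ε := by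
      rw [he, map_add, map_mul, Complex.conj_ofReal, Complex.conj_ofReal]
    rw [curve, center_eq, ← hu, ← hε]
    linear_combination (radius a c θ : ℂ) * huu + (q * ε : ℂ) * h1
  have h2 : ε * (p + ρ * conj ε) = p * ε + ρ := by linear_combination (ρ : ℂ) * hεε
  have hr : radius a c θ = p * q * (1 - Real.cos θ) := radius_eq a c θ
  rw [hcurve, h2, supportFun, hnorm]
  simp only [Complex.add_re, Complex.ofReal_re, Complex.re_ofReal_mul, Complex.conj_re, hεre]
  rw [hr]
  ring

include ha hc in
-- Take for `θ` the argument of `u - a / (a + c)`. The point `a / (a + c)` is inside the unit disk,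
-- so the ray from it leaves the disk only once.
theorem exists_exp_angle_eq {u : ℂ} (hu : ‖u‖ = 1) :
    ∃ θ ∈ Ico 0 (2 * Real.pi), Complex.exp (angle a c θ * Complex.I) = u := by
  obtain ⟨h1, h2, -, -⟩ := ratio_mem ha hc
  set p := a / (a + c) with hp
  set v := u - (p : ℂ) with hv
  set θ := toIcoMod Real.two_pi_pos 0 v.arg with hθ
  have hθm : θ ∈ Ico 0 (2 * Real.pi) := by
    have := toIcoMod_mem_Ico Real.two_pi_pos 0 v.arg
    simpa using this
  have hexp : Complex.exp (θ * Complex.I) = Complex.exp (v.arg * Complex.I) := by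
    obtain ⟨k, hk⟩ : ∃ k : ℤ, θ + k • (2 * Real.pi) = v.arg :=
      ⟨_, toIcoMod_add_toIcoDiv_zsmul Real.two_pi_pos 0 v.arg⟩
    have h3 : (v.arg : ℂ) = θ + k * (2 * Real.pi) := by
      rw [← hk, zsmul_eq_mul]
      push_cast
      ring
    rw [Complex.exp_eq_exp_iff_exists_int]
    refine ⟨-k, ?_⟩
    rw [h3]
    push_cast
    ring
  refine ⟨θ, hθm, ?_⟩
  have hρ := sub_pos.mpr (cos_mul_lt_cos_arcsin ha hc θ)
  have he := exp_angle ha hc θ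
  have hn : ‖Complex.exp (angle a c θ * Complex.I)‖ = 1 := Complex.norm_exp_ofReal_mul_I _
  rw [he] at hn ⊢
  set ρ := Real.cos (Real.arcsin (a / (a + c) * Real.sin θ)) - a / (a + c) * Real.cos θ
  set ε := Complex.exp (θ * Complex.I) with hε
  have hue : u = p + (‖v‖ : ℝ) * ε := by
    rw [hexp, Complex.norm_mul_exp_arg_mul_I, hv]
    ring
  have hvn : 0 ≤ ‖v‖ := norm_nonneg v
  have hεn : ε.re ^ 2 + ε.im ^ 2 = 1 := by
    have := Complex.sq_norm ε
    rw [hε, Complex.norm_exp_ofReal_mul_I, ← hε, Complex.normSq_apply] at this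
    nlinarith
  have hsq : ∀ s : ℝ, ‖(p : ℂ) + s * ε‖ = 1 → s ^ 2 + 2 * p * s * ε.re + p ^ 2 = 1 := by
    intro s hs
    have := Complex.sq_norm ((p : ℂ) + s * ε)
    rw [hs, Complex.normSq_apply] at this
    simp at this
    nlinarith
  have e1 := hsq ρ hn
  have e2 := hsq ‖v‖ (by rw [← hue]; exact hu)
  have h5 : ρ = ‖v‖ := by
    -- Both lengths are nonnegative roots of the same quadratic, whose constant term `p ^ 2 - 1` is
    -- negative.
    have h6 : (ρ - ‖v‖) * (ρ * ‖v‖ + (1 - p ^ 2)) = 0 := by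
      linear_combination ‖v‖ * e1 - ρ * e2
    rcases mul_eq_zero.mp h6 with h | h
    · linarith
    · nlinarith [mul_nonneg hρ.le hvn]
  rw [hue, h5]

end

theorem hasDerivAt_re_conj_exp_mul (d : ℂ) (φ : ℝ) :
    HasDerivAt (fun t : ℝ => (conj (Complex.exp (t * Complex.I)) * d).re)
      (-Real.sin φ * d.re + Real.cos φ * d.im) φ := by
  have h : (fun t : ℝ => (conj (Complex.exp (t * Complex.I)) * d).re) =
      fun t => Real.cos t * d.re + Real.sin t * d.im := by
    ext t
    rw [Complex.mul_re, Complex.conj_re, Complex.conj_im, Complex.exp_ofReal_mul_I_re,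
      Complex.exp_ofReal_mul_I_im]
    ring
  rw [h]
  exact ((Real.hasDerivAt_cos φ).mul_const _).add ((Real.hasDerivAt_sin φ).mul_const _)

/-- A supporting line meets the set described by the support function in at most one point. -/
theorem eq_of_re_conj_mul_eq_supportFun {a c : ℝ} (ha : 0 < a) (hc : 0 < c) {u z₁ z₂ : ℂ}
    (hu : ‖u‖ = 1) (h₁ : ∀ v : ℂ, ‖v‖ = 1 → (conj v * z₁).re ≤ supportFun a c v)
    (h₂ : ∀ v : ℂ, ‖v‖ = 1 → (conj v * z₂).re ≤ supportFun a c v)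
    (e₁ : (conj u * z₁).re = supportFun a c u) (e₂ : (conj u * z₂).re = supportFun a c u) :
    z₁ = z₂ := by
  obtain ⟨-, hp, -, -⟩ := ratio_mem ha hc
  obtain ⟨φ, hφ⟩ : ∃ φ : ℝ, u = Complex.exp (φ * Complex.I) := by
    refine ⟨u.arg, ?_⟩
    have := Complex.norm_mul_exp_arg_mul_I u
    rw [hu, Complex.ofReal_one, one_mul] at this
    exact this.symm
  have hS : DifferentiableAt ℝ (fun t : ℝ => supportFun a c (Complex.exp (t * Complex.I))) φ := by
    have h0 : Complex.exp (φ * Complex.I) - ((a / (a + c) : ℝ) : ℂ) ≠ 0 := by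
      rw [← hφ, sub_ne_zero]
      intro h
      rw [h, Complex.norm_real, Real.norm_of_nonneg (by positivity)] at hu
      linarith
    have h1 : DifferentiableAt ℝ (fun t : ℝ => Complex.exp (t * Complex.I) -
        ((a / (a + c) : ℝ) : ℂ)) φ := by
      have h2 : DifferentiableAt ℝ (fun t : ℝ => (t : ℂ)) φ :=
        Complex.ofRealCLM.differentiableAt
      exact ((h2.mul_const _).cexp).sub_const _
    have h3 : DifferentiableAt ℝ (fun t : ℝ => (Complex.exp (t * Complex.I)).re) φ := by
      simp only [Complex.exp_ofReal_mul_I_re]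
      fun_prop
    simp only [supportFun]
    exact ((h3.const_mul _).add_const _).add ((h1.norm ℝ h0).const_mul _)
  -- The difference of the two functions of `t` is at most `0`, with equality at `φ`. Hence the
  -- derivative of the support function gives the component of `z` tangential to `u`, while the
  -- equality gives the radial one.
  have key : ∀ z : ℂ, (∀ v : ℂ, ‖v‖ = 1 → (conj v * z).re ≤ supportFun a c v) →
      (conj u * z).re = supportFun a c u →
      deriv (fun t : ℝ => supportFun a c (Complex.exp (t * Complex.I))) φ =
        -Real.sin φ * z.re + Real.cos φ * z.im := by
    intro z h e
    have hd := (hasDerivAt_re_conj_exp_mul z φ).sub hS.hasDerivAt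
    have hmax : IsLocalMax ((fun t : ℝ => (conj (Complex.exp (t * Complex.I)) * z).re) -
        fun t : ℝ => supportFun a c (Complex.exp (t * Complex.I))) φ := by
      refine Filter.Eventually.of_forall fun t => ?_
      have h3 := h _ (Complex.norm_exp_ofReal_mul_I t)
      simp only [Pi.sub_apply, ← hφ, e, sub_self]
      linarith
    have := hmax.hasDerivAt_eq_zero hd
    linarith
  have k₁ := key z₁ h₁ e₁
  have k₂ := key z₂ h₂ e₂
  rw [k₁] at k₂
  rw [← e₂, hφ] at e₁
  simp only [Complex.mul_re, Complex.conj_re, Complex.conj_im, Complex.exp_ofReal_mul_I_re,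
    Complex.exp_ofReal_mul_I_im] at e₁
  have h4 := Real.sin_sq_add_cos_sq φ
  apply Complex.ext
  · linear_combination Real.cos φ * e₁ - Real.sin φ * k₂ - (z₁.re - z₂.re) * h4
  · linear_combination Real.sin φ * e₁ + Real.cos φ * k₂ - (z₁.im - z₂.im) * h4

/-! ### The boundary of convex sets with the given support function -/

theorem curve_zero {a c : ℝ} (ha : 0 < a) (hc : 0 < c) : curve a c 0 = ((1 : ℝ) : ℂ) := by
  have h : (a : ℂ) + c ≠ 0 := by exact_mod_cast (by positivity : a + c ≠ 0)
  simp [curve, center, radius, h]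

theorem exists_curve_pi {a c : ℝ} (ha : 0 < a) (hc : 0 < c) :
    ∃ x : ℝ, curve a c Real.pi = x ∧ x ≠ 1 := by
  obtain ⟨h1, h2, h3, h4⟩ := ratio_mem ha hc
  refine ⟨a / (a + c) - c / (a + c) - radius a c Real.pi, ?_, ?_⟩
  · rw [curve, center_eq]
    simp [angle, Complex.exp_pi_mul_I]
    ring
  · have := radius_nonneg Real.pi ha hc
    linarith

theorem curve_im (a c θ : ℝ) : (curve a c θ).im =
    c / (a + c) * Real.sin θ + radius a c θ * Real.sin (angle a c θ) := by
  rw [curve, center_eq, Complex.add_im, Complex.add_im, Complex.ofReal_im, Complex.im_ofReal_mul,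
    Complex.im_ofReal_mul, Complex.exp_ofReal_mul_I_im, Complex.exp_ofReal_mul_I_im, zero_add]

theorem curve_re (a c θ : ℝ) : (curve a c θ).re =
    a / (a + c) + c / (a + c) * Real.cos θ + radius a c θ * Real.cos (angle a c θ) := by
  rw [curve, center_eq, Complex.add_re, Complex.add_re, Complex.ofReal_re, Complex.re_ofReal_mul,
    Complex.re_ofReal_mul, Complex.exp_ofReal_mul_I_re, Complex.exp_ofReal_mul_I_re]

theorem curve_pi_div_two_im {a c : ℝ} (ha : 0 < a) (hc : 0 < c) :
    (curve a c (Real.pi / 2)).im ≠ 0 := by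
  obtain ⟨h1, h2, h3, h4⟩ := ratio_mem ha hc
  have h5 := cos_arcsin_pos ha hc (Real.pi / 2)
  have h6 := radius_nonneg (Real.pi / 2) ha hc
  rw [curve_im, angle, Real.sin_pi_div_two_sub, Real.sin_pi_div_two]
  rw [Real.sin_pi_div_two] at h5
  have := mul_nonneg h6 h5.le
  linarith

theorem nonempty_interior_of_curve_subset {a c : ℝ} (ha : 0 < a) (hc : 0 < c) {S : Set ℂ}
    (hS : Convex ℝ S) (h : curve a c '' Ico 0 (2 * Real.pi) ⊆ closure S) :
    (interior S).Nonempty := by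
  have hpi := Real.pi_pos
  obtain ⟨x, hx, hx1⟩ := exists_curve_pi ha hc
  refine nonempty_interior_of_closure hS hx1 (curve_pi_div_two_im ha hc) ?_ ?_ ?_
  · rw [← hx]; exact h ⟨Real.pi, ⟨hpi.le, by linarith⟩, rfl⟩
  · rw [← curve_zero ha hc]; exact h ⟨0, ⟨le_rfl, by linarith⟩, rfl⟩
  · exact h ⟨Real.pi / 2, ⟨by positivity, by linarith⟩, rfl⟩

/-- A boundary point has a supporting direction `u = e^{i s₁(θ)}`. There `E(θ)` in the closure
reaches the maximal height, so both points touch the same supporting line and coincide. Conversely,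
an interior `E(θ)` could be pushed outwards beyond the support function. -/
theorem frontier_eq_curve {a c : ℝ} (ha : 0 < a) (hc : 0 < c) {S : Set ℂ} (hS : Convex ℝ S)
    (hle : ∀ w ∈ S, ∀ u : ℂ, ‖u‖ = 1 → (conj u * w).re ≤ supportFun a c u)
    (hcurve : ∀ θ, curve a c θ ∈ closure S) :
    frontier S = curve a c '' Ico 0 (2 * Real.pi) := by
  have hne : (interior S).Nonempty := nonempty_interior_of_curve_subset ha hc hS (by
    rintro _ ⟨θ, -, rfl⟩; exact hcurve θ)
  have hcl : ∀ u : ℂ, ∀ K : ℝ, (∀ w ∈ S, (conj u * w).re ≤ K) →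
      ∀ w ∈ closure S, (conj u * w).re ≤ K := fun u K h =>
    closure_minimal (t := {w | (conj u * w).re ≤ K}) h
      (isClosed_le (by fun_prop) continuous_const)
  ext z
  constructor
  · rintro ⟨hz1, hz2⟩
    obtain ⟨u, hu, hz3⟩ := exists_unit_forall_re_le hS hne hz2
    obtain ⟨θ, hθ, hθu⟩ := exists_exp_angle_eq ha hc hu
    refine ⟨θ, hθ, ?_⟩
    have e1 := re_conj_exp_angle_mul_curve ha hc θ
    rw [hθu] at e1
    have h1 := hcl u _ hz3 _ (hcurve θ)
    have hzle : ∀ v : ℂ, ‖v‖ = 1 → (conj v * z).re ≤ supportFun a c v := fun v hv =>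
      hcl v _ (fun w hw => hle w hw v hv) z hz1
    refine eq_of_re_conj_mul_eq_supportFun ha hc hu (fun v hv => ?_) hzle e1
      (le_antisymm (hzle u hu) (e1 ▸ h1))
    exact re_conj_mul_le_of_mem_closedBall ha hc θ hv (curve_mem_closedBall ha hc θ)
  · rintro ⟨θ, -, rfl⟩
    refine ⟨hcurve θ, fun hint => ?_⟩
    set u := Complex.exp (angle a c θ * Complex.I) with hu
    have hun : ‖u‖ = 1 := Complex.norm_exp_ofReal_mul_I _
    obtain ⟨ε, hε, hball⟩ := Metric.isOpen_iff.mp isOpen_interior _ hint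
    have hmem : curve a c θ + (ε / 2 : ℝ) * u ∈ S := by
      refine interior_subset (hball ?_)
      rw [mem_ball_iff_norm, add_sub_cancel_left, norm_mul, hun, mul_one, Complex.norm_real,
        Real.norm_of_nonneg (by positivity)]
      linarith
    have h1 := hle _ hmem u hun
    have huu : conj u * u = 1 := by rw [Complex.conj_mul', hun]; norm_num
    have h2 : conj u * (curve a c θ + (ε / 2 : ℝ) * u) = conj u * curve a c θ + (ε / 2 : ℝ) := by
      linear_combination ((ε / 2 : ℝ) : ℂ) * huu
    rw [h2, Complex.add_re, Complex.ofReal_re, re_conj_exp_angle_mul_curve ha hc θ] at h1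
    linarith

theorem closedBall_subset_convexHull_curve {a c : ℝ} (ha : 0 < a) (hc : 0 < c) (θ : ℝ) :
    Metric.closedBall (center a c θ) (radius a c θ) ⊆
      convexHull ℝ (curve a c '' Ico 0 (2 * Real.pi)) := by
  intro z hz
  by_contra hzn
  have hS := convex_convexHull ℝ (curve a c '' Ico 0 (2 * Real.pi))
  have hsub := subset_convexHull ℝ (curve a c '' Ico 0 (2 * Real.pi))
  have hne := nonempty_interior_of_curve_subset ha hc hS (hsub.trans subset_closure)
  obtain ⟨u, hu, hle⟩ := exists_unit_forall_re_le hS hne fun h => hzn (interior_subset h)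
  obtain ⟨θ', hθ, hθu⟩ := exists_exp_angle_eq ha hc hu
  have e1 := re_conj_exp_angle_mul_curve ha hc θ'
  rw [hθu] at e1
  have hmem := hsub ⟨θ', hθ, rfl⟩
  have h1 := hle _ hmem
  have h2 := re_conj_mul_le_of_mem_closedBall ha hc θ hu hz
  -- The supporting line forces `z` to be a point of the curve itself, so closedness of the hull is
  -- not needed.
  refine hzn ?_
  rw [eq_of_re_conj_mul_eq_supportFun ha hc hu
    (fun v hv => re_conj_mul_le_of_mem_closedBall ha hc θ hv hz)
    (fun v hv => re_conj_mul_le_of_mem_closedBall ha hc θ' hv (curve_mem_closedBall ha hc θ'))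
    (le_antisymm h2 (e1 ▸ h1)) e1]
  exact hmem

/-! ### The envelope -/

theorem cos_lt_one_of_mem_Ioo {θ : ℝ} (hθ : θ ∈ Ioo 0 (2 * Real.pi)) : Real.cos θ < 1 := by
  refine lt_of_le_of_ne (Real.cos_le_one θ) fun h => ?_
  have := (Real.cos_eq_one_iff_of_lt_of_lt (by linarith [hθ.1, Real.pi_pos]) hθ.2).mp h
  exact hθ.1.ne' this

theorem radius_pos {a c θ : ℝ} (ha : 0 < a) (hc : 0 < c) (hθ : θ ∈ Ioo 0 (2 * Real.pi)) :
    0 < radius a c θ := by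
  have h : 0 < 1 - Real.cos θ := sub_pos.mpr (cos_lt_one_of_mem_Ioo hθ)
  rw [radius_eq]
  positivity

theorem center_re (a c θ : ℝ) :
    (center a c θ).re = a / (a + c) + c / (a + c) * Real.cos θ := by
  rw [center_eq, Complex.add_re, Complex.ofReal_re, Complex.re_ofReal_mul,
    Complex.exp_ofReal_mul_I_re]

theorem center_im (a c θ : ℝ) : (center a c θ).im = c / (a + c) * Real.sin θ := by
  rw [center_eq, Complex.add_im, Complex.ofReal_im, Complex.im_ofReal_mul,
    Complex.exp_ofReal_mul_I_im, zero_add]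

section

variable {a c : ℝ} (ha : 0 < a) (hc : 0 < c) (θ : ℝ)

include ha hc in
theorem hasDerivAt_angle : HasDerivAt (angle a c)
    (1 - a / (a + c) * Real.cos θ / Real.cos (Real.arcsin (a / (a + c) * Real.sin θ))) θ := by
  have h := abs_lt.mp (abs_mul_sin_lt ha hc θ)
  have h1 := (Real.hasDerivAt_arcsin h.1.ne' h.2.ne).comp θ
    ((Real.hasDerivAt_sin θ).const_mul (a / (a + c)))
  refine ((hasDerivAt_id θ).sub h1).congr_deriv ?_
  rw [Real.cos_arcsin]
  ring

include ha hc in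
theorem deriv_angle_pos :
    0 < 1 - a / (a + c) * Real.cos θ / Real.cos (Real.arcsin (a / (a + c) * Real.sin θ)) := by
  rw [sub_pos, div_lt_one (cos_arcsin_pos ha hc θ)]
  exact cos_mul_lt_cos_arcsin ha hc θ

theorem hasDerivAt_radius (a c θ : ℝ) :
    HasDerivAt (radius a c) (a / (a + c) * (c / (a + c)) * Real.sin θ) θ := by
  have h := ((Real.hasDerivAt_cos θ).const_sub 1).const_mul (a / (a + c) * (c / (a + c)))
  rw [funext (radius_eq a c)]
  exact h.congr_deriv (by ring)

include ha hc in
theorem hasDerivAt_curve_re : HasDerivAt (fun θ => (curve a c θ).re)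
    (-(c / (a + c)) * Real.sin θ +
      a / (a + c) * (c / (a + c)) * Real.sin θ * Real.cos (angle a c θ) -
      radius a c θ * Real.sin (angle a c θ) *
      (1 - a / (a + c) * Real.cos θ / Real.cos (Real.arcsin (a / (a + c) * Real.sin θ)))) θ := by
  simp only [curve_re]
  refine ((((Real.hasDerivAt_cos θ).const_mul (c / (a + c))).const_add (a / (a + c))).add
    ((hasDerivAt_radius a c θ).mul (hasDerivAt_angle ha hc θ).cos)).congr_deriv ?_
  ring

include ha hc in
theorem hasDerivAt_curve_im : HasDerivAt (fun θ => (curve a c θ).im)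
    (c / (a + c) * Real.cos θ +
      a / (a + c) * (c / (a + c)) * Real.sin θ * Real.sin (angle a c θ) +
      radius a c θ * Real.cos (angle a c θ) *
      (1 - a / (a + c) * Real.cos θ / Real.cos (Real.arcsin (a / (a + c) * Real.sin θ)))) θ := by
  simp only [curve_im]
  refine (((Real.hasDerivAt_sin θ).const_mul (c / (a + c))).add
    ((hasDerivAt_radius a c θ).mul (hasDerivAt_angle ha hc θ).sin)).congr_deriv ?_
  ring

include ha hc in
theorem contDiff_angle : ContDiff ℝ 1 (angle a c) := by
  rw [contDiff_iff_contDiffAt]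
  intro θ
  have h := abs_lt.mp (abs_mul_sin_lt ha hc θ)
  have h1 : ContDiffAt ℝ 1 (fun θ : ℝ => a / (a + c) * Real.sin θ) θ := by fun_prop
  exact contDiffAt_id.sub
    (ContDiffAt.comp (g := Real.arcsin) θ (Real.contDiffAt_arcsin h.1.ne' h.2.ne) h1)

include ha hc in
theorem contDiff_curve_re : ContDiff ℝ 1 (fun θ => (curve a c θ).re) := by
  have h := contDiff_angle ha hc
  simp only [curve_re, radius_eq]
  fun_prop

include ha hc in
theorem contDiff_curve_im : ContDiff ℝ 1 (fun θ => (curve a c θ).im) := by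
  have h := contDiff_angle ha hc
  simp only [curve_im, radius_eq]
  fun_prop

include ha hc in
theorem sin_sub_angle : Real.sin θ * Real.cos (angle a c θ) - Real.cos θ * Real.sin (angle a c θ) =
    a / (a + c) * Real.sin θ := by
  rw [← Real.sin_sub, angle, sub_sub_cancel, sin_arcsin_mul_sin ha hc]

theorem cos_sub_angle (a c θ : ℝ) :
    Real.cos θ * Real.cos (angle a c θ) + Real.sin θ * Real.sin (angle a c θ) =
      Real.cos (Real.arcsin (a / (a + c) * Real.sin θ)) := by
  rw [← Real.cos_sub, angle, sub_sub_cancel]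

include ha hc in
-- The component of `E'` along `i e^{i s₁}` is `γ cos (θ - s₁) + r s₁'` with `γ = c / (a + c)`; the
-- first term is positive and the second nonnegative.
theorem deriv_curve_sq_add_sq_ne_zero : deriv (fun θ => (curve a c θ).re) θ ^ 2 +
    deriv (fun θ => (curve a c θ).im) θ ^ 2 ≠ 0 := by
  rw [(hasDerivAt_curve_re ha hc θ).deriv, (hasDerivAt_curve_im ha hc θ).deriv]
  have h1 := deriv_angle_pos ha hc θ
  have h2 := cos_sub_angle a c θ
  have h3 := cos_arcsin_pos ha hc θ
  have h4 := radius_nonneg θ ha hc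
  have h5 := Real.sin_sq_add_cos_sq (angle a c θ)
  have h6 : 0 < c / (a + c) := by positivity
  set σ := angle a c θ
  set s := 1 - a / (a + c) * Real.cos θ / Real.cos (Real.arcsin (a / (a + c) * Real.sin θ))
  intro h
  set x := -(c / (a + c)) * Real.sin θ + a / (a + c) * (c / (a + c)) * Real.sin θ * Real.cos σ -
    radius a c θ * Real.sin σ * s with hx
  set y := c / (a + c) * Real.cos θ + a / (a + c) * (c / (a + c)) * Real.sin θ * Real.sin σ +
    radius a c θ * Real.cos σ * s with hy
  have hx0 : x = 0 := by nlinarith [sq_nonneg x, sq_nonneg y]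
  have hy0 : y = 0 := by nlinarith [sq_nonneg x, sq_nonneg y]
  have h7 : -x * Real.sin σ + y * Real.cos σ =
      c / (a + c) * Real.cos (Real.arcsin (a / (a + c) * Real.sin θ)) + radius a c θ * s := by
    rw [hx, hy]
    linear_combination c / (a + c) * h2 + radius a c θ * s * h5
  rw [hx0, hy0] at h7
  have h8 := mul_pos h6 h3
  have h9 := mul_nonneg h4 h1.le
  linarith

include ha hc in
theorem isEnvelopeOn_circleFamily : IsEnvelopeOn (circleFamily a c) (fun θ => (curve a c θ).re)
    (fun θ => (curve a c θ).im) (Ioo 0 (2 * Real.pi)) where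
  family_regular := by
    intro θ hθ u v h
    have hr := radius_pos ha hc hθ
    have h1 : HasDerivAt (fun u' => circleFamily a c u' v θ) (2 * (u - (center a c θ).re)) u := by
      have := (((hasDerivAt_id u).sub_const (center a c θ).re).pow 2).add_const
        ((v - (center a c θ).im) ^ 2) |>.sub_const (radius a c θ ^ 2)
      exact this.congr_deriv (by simp)
    have h2 : HasDerivAt (fun v' => circleFamily a c u v' θ) (2 * (v - (center a c θ).im)) v := by
      have := (((hasDerivAt_id v).sub_const (center a c θ).im).pow 2).const_add
        ((u - (center a c θ).re) ^ 2) |>.sub_const (radius a c θ ^ 2)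
      exact this.congr_deriv (by simp)
    rw [h1.deriv, h2.deriv]
    rw [circleFamily] at h
    have : 0 < radius a c θ ^ 2 := by positivity
    nlinarith
  contDiffOn_x := (contDiff_curve_re ha hc).contDiffOn
  contDiffOn_y := (contDiff_curve_im ha hc).contDiffOn
  curve_regular := fun θ _ => deriv_curve_sq_add_sq_ne_zero ha hc θ
  mem_curve := by
    intro θ _
    rw [circleFamily, curve_re, curve_im, center_re, center_im]
    linear_combination radius a c θ ^ 2 * Real.sin_sq_add_cos_sq (angle a c θ)
  hasDerivAt_zero := by
    intro θ _
    simp only [circleFamily, center_re, center_im]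
    have h1 := (((Real.hasDerivAt_cos θ).const_mul (c / (a + c))).const_add (a / (a + c))).const_sub
      (curve a c θ).re
    have h2 := ((Real.hasDerivAt_sin θ).const_mul (c / (a + c))).const_sub (curve a c θ).im
    refine (((h1.pow 2).add (h2.pow 2)).sub ((hasDerivAt_radius a c θ).pow 2)).congr_deriv ?_
    rw [curve_re, curve_im]
    push_cast
    -- At `E(θ)` the derivative is a multiple of `sin (θ - s₁) - a / (a + c) * sin θ`, zero by the
    -- choice of `s₁`.
    linear_combination 2 * radius a c θ * (c / (a + c)) * sin_sub_angle ha hc θ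

end

/-- With `γ = c / (a + c)`, the squared distance to the centre exceeds `γ²` by `r² + 2 γ r cos (θ -
s₁)`, which is positive. -/
theorem curve_notMem_closedBall {a c θ : ℝ} (ha : 0 < a) (hc : 0 < c)
    (hθ : θ ∈ Ioo 0 (2 * Real.pi)) :
    curve a c θ ∉ Metric.closedBall ((a / (a + c) : ℝ) : ℂ) (c / (a + c)) := by
  have hr := radius_pos ha hc hθ
  have h2 := cos_sub_angle a c θ
  have h3 := cos_arcsin_pos ha hc θ
  have hq : 0 < c / (a + c) := by positivity
  rw [mem_closedBall_iff_norm, not_le]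
  refine lt_of_pow_lt_pow_left₀ 2 (norm_nonneg _) ?_
  rw [Complex.sq_norm, Complex.normSq_apply, Complex.sub_re, Complex.sub_im, Complex.ofReal_re,
    Complex.ofReal_im, curve_re, curve_im]
  have h5 := Real.sin_sq_add_cos_sq (angle a c θ)
  have h6 := Real.sin_sq_add_cos_sq θ
  have h7 : 0 < radius a c θ ^ 2 + 2 * (c / (a + c)) * radius a c θ *
      Real.cos (Real.arcsin (a / (a + c) * Real.sin θ)) := by positivity
  rw [← sub_pos]
  refine lt_of_lt_of_eq h7 ?_
  linear_combination -(c / (a + c)) ^ 2 * h6 - radius a c θ ^ 2 * h5 -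
    2 * (c / (a + c)) * radius a c θ * h2

/-! ### The zeros of the slices lie on the circle of the centres -/

/-- An involution of the unit circle. -/
def circleInvolution (a c : ℝ) (w : ℂ) : ℂ := -(c + a * conj w) / (a + c * conj w)

section

variable {a c : ℝ} (hc : 0 < c) (hac : a = 1 + c) {w : ℂ} (hw : ‖w‖ = 1)

include hc hac hw in
theorem add_mul_conj_ne_zero : (a : ℂ) + c * conj w ≠ 0 :=
  qpoly_ne_zero hc hac (w := conj w) (by rw [RCLike.norm_conj, hw])

include hc hac hw in
theorem norm_circleInvolution : ‖circleInvolution a c w‖ = 1 := by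
  have h0 := add_mul_conj_ne_zero hc hac hw
  have hww : w * conj w = 1 := by rw [Complex.mul_conj', hw]; norm_num
  have h1 : (c : ℂ) + a * conj w = conj w * conj (a + c * conj w) := by
    simp only [map_add, map_mul, Complex.conj_ofReal, Complex.conj_conj]
    linear_combination -(c : ℂ) * hww
  rw [circleInvolution, norm_div, norm_neg, h1, norm_mul, RCLike.norm_conj, RCLike.norm_conj, hw,
    one_mul, div_self (norm_ne_zero_iff.mpr h0)]

include hc hac hw in
theorem circleInvolution_circleInvolution :
    circleInvolution a c (circleInvolution a c w) = w := by
  have h0 := add_mul_conj_ne_zero hc hac hw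
  have h1 : (a : ℂ) + c * w ≠ 0 := qpoly_ne_zero hc hac hw
  have h2 := add_mul_conj_ne_zero hc hac (norm_circleInvolution hc hac hw)
  have h3 : conj (circleInvolution a c w) = -(c + a * w) / (a + c * w) := by
    simp only [circleInvolution, map_div₀, map_neg, map_add, map_mul, Complex.conj_ofReal,
      Complex.conj_conj]
  rw [circleInvolution, div_eq_iff h2, h3]
  field_simp
  ring

include hc hac hw in
-- Inversion carries the circle of centre `a` and radius `c` to the circle of the centres, because
-- `a - c = 1`. The angle is changed by an involution, so every centre is the zero of some slice.
theorem sliceZero_eq : sliceZero a c w =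
    (a / (a + c) : ℝ) + (c / (a + c) : ℝ) * circleInvolution a c w := by
  have h0 := add_mul_conj_ne_zero hc hac hw
  have h1 : (a : ℂ) + c ≠ 0 := by exact_mod_cast (by linarith : a + c ≠ 0)
  have h2 : (a : ℂ) = 1 + c := by exact_mod_cast congrArg (fun x : ℝ => (x : ℂ)) hac
  rw [sliceZero, qpoly, circleInvolution]
  simp only [map_add, map_mul, Complex.conj_ofReal]
  push_cast
  field_simp
  linear_combination -(a + c : ℂ) * h2

include hc hac hw in
theorem slicePhase_mul_conj : slicePhase a c w * conj (slicePhase a c w) = 1 := by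
  have h0 := qpoly_ne_zero hc hac hw
  have h1 : conj (qpoly a c w) ≠ 0 := (map_ne_zero _).mpr h0
  have hww : w * conj w = 1 := by rw [Complex.mul_conj', hw]; norm_num
  simp only [slicePhase, map_div₀, map_mul, Complex.conj_conj]
  field_simp
  exact hww

end

theorem one_sub_mul_conj_eq {a c : ℝ} (ha : 0 < a) (hc : 0 < c) {ε : ℂ} (hε : ‖ε‖ = 1) :
    1 - ‖((a / (a + c) : ℝ) : ℂ) + (c / (a + c) : ℝ) * ε‖ ^ 2 =
      2 * (a / (a + c) * (c / (a + c)) * (1 - ε.re)) := by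
  obtain ⟨-, -, -, h⟩ := ratio_mem ha hc
  have h1 := Complex.sq_norm ε
  rw [hε, Complex.normSq_apply] at h1
  rw [Complex.sq_norm, Complex.normSq_apply]
  simp only [Complex.add_re, Complex.add_im, Complex.ofReal_re, Complex.ofReal_im,
    Complex.re_ofReal_mul, Complex.im_ofReal_mul]
  set p := a / (a + c)
  set q := c / (a + c)
  linear_combination -(1 + p + q) * h + q ^ 2 * h1

/-! ### The numerical range of the compressed shift -/

theorem re_inner_mulCoord_le_supportFun {a c : ℝ} (hc : 0 < c) (hac : a = 1 + c) {u : ℂ}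
    (hu : ‖u‖ = 1) {f : L2} (hf : f ∈ maxInvariant a c 0) :
    (conj u * inner ℂ f (mulCoord 0 f)).re ≤ supportFun a c u * ‖f‖ ^ 2 := by
  have ha : 0 < a := by linarith
  refine re_inner_mulCoord_le hc hac hu (fun w hw _ => ?_) hf
  have hε := norm_circleInvolution hc hac hw
  have h := re_conj_mul_add_le_supportFun ha hc (u := u) hε
  rw [sliceZero_eq hc hac hw, one_sub_mul_conj_eq ha hc hε]
  linarith

theorem exists_circ_eq {w : ℂ} (hw : ‖w‖ = 1) : ∃ y, circ y = w := by
  refine ⟨((w.arg / (2 * Real.pi) : ℝ) : UnitAddCircle), ?_⟩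
  have h := Complex.norm_mul_exp_arg_mul_I w
  rw [hw, Complex.ofReal_one, one_mul] at h
  rw [circ, AddCircle.toCircle_apply_mk, Circle.coe_exp, div_one,
    mul_div_cancel₀ _ Real.two_pi_pos.ne', h]

theorem curve_mem_closure_shiftRange {a c : ℝ} (hc : 0 < c) (hac : a = 1 + c) (θ : ℝ) :
    curve a c θ ∈ closure (shiftRange a c) := by
  have ha : 0 < a := by linarith
  set ε := Complex.exp (θ * Complex.I) with hε_def
  have hε : ‖ε‖ = 1 := Complex.norm_exp_ofReal_mul_I θ
  have hw := norm_circleInvolution hc hac hε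
  obtain ⟨y, hy⟩ := exists_circ_eq hw
  have hl : sliceZero a c (circ y) = center a c θ := by
    rw [hy, sliceZero_eq hc hac hw, circleInvolution_circleInvolution hc hac hε, center_eq]
  have hβ := slicePhase_mul_conj hc hac (norm_circ y)
  set β := slicePhase a c (circ y)
  have hs : (1 : ℂ) - sliceZero a c (circ y) * conj (sliceZero a c (circ y)) =
      2 * radius a c θ := by
    rw [hl, Complex.mul_conj']
    have h := one_sub_mul_conj_eq ha hc hε
    rw [← center_eq, Complex.exp_ofReal_mul_I_re, ← radius_eq] at h
    exact_mod_cast h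
  set e := Complex.exp (angle a c θ * Complex.I)
  have he : e * conj e = 1 := by
    rw [Complex.mul_conj', Complex.norm_exp_ofReal_mul_I]; norm_num
  have h2 : ((Real.sqrt (1 / 2) : ℝ) : ℂ) * ((Real.sqrt (1 / 2) : ℝ) : ℂ) = 1 / 2 := by
    rw [← Complex.ofReal_mul, Real.mul_self_sqrt (by norm_num)]; norm_num
  -- The extremal vector of the `2 × 2` matrix: coordinates of equal modulus, with the phase chosen
  -- so that the off-diagonal term is `r e^{i s₁}`.
  have h := slice_form_mem_closure hc hac y (A := Real.sqrt (1 / 2) * (β * e))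
    (B := Real.sqrt (1 / 2)) (by
      simp only [map_mul, Complex.conj_ofReal]
      linear_combination (β * conj β * (e * conj e) + 1) * h2 + (1 / 2 : ℂ) * (e * conj e) * hβ +
        (1 / 2 : ℂ) * he)
  convert h using 1
  rw [hs, hl, Complex.conj_ofReal, curve]
  linear_combination -(2 * radius a c θ * e * (β * conj β)) * h2 - (radius a c θ * e) * hβ

theorem numericalRange_compression {H : Type*} [NormedAddCommGroup H] [InnerProductSpace ℂ H]
    (T : H →L[ℂ] H) (S : Submodule ℂ H) [S.HasOrthogonalProjection] :
    numericalRange (compression T S) = {w | ∃ x ∈ S, ‖x‖ = 1 ∧ inner ℂ x (T x) = w} := by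
  have h : ∀ x : S, inner ℂ x (compression T S x) = inner ℂ (x : H) (T x) := fun x =>
    S.inner_orthogonalProjectionOnto_eq_of_mem_left x (T x)
  ext w
  constructor
  · rintro ⟨x, hx, rfl⟩
    exact ⟨x, x.2, hx, (h x).symm⟩
  · rintro ⟨x, hxS, hx, rfl⟩
    exact ⟨⟨x, hxS⟩, hx, h _⟩

theorem IsInvariantDecomposition.frontier_numericalRange {a c : ℝ} (hc : 0 < c) (hac : a = 1 + c)
    {S₁ S₂ : Submodule ℂ L2} [S₂.HasOrthogonalProjection]
    (h : IsInvariantDecomposition (bigTheta a c) S₁ S₂) :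
    frontier (numericalRange (compression (mulCoord 0) S₂)) =
      curve a c '' Ico 0 (2 * Real.pi) := by
  have ha : 0 < a := by linarith
  have hW : numericalRange (compression (mulCoord 0) S₂) = shiftRange a c := by
    rw [numericalRange_compression, h.right_eq hc hac, shiftRange]
  have hconv := convex_numericalRange (compression (mulCoord 0) S₂)
  rw [hW] at hconv ⊢
  refine frontier_eq_curve ha hc hconv ?_ (curve_mem_closure_shiftRange hc hac)
  rintro _ ⟨f, hf, hn, rfl⟩ u hu
  simpa [hn] using re_inner_mulCoord_le_supportFun hc hac hu hf

/-! ### Polynomials with a zero on the torus and none in the bidisk -/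

/-- A torus zero gives `a ≤ 1 + c` by the triangle inequality. If `a < 1 + c`, then `(x, -x)` with
`x = a / (1 + c)` is a zero in the bidisk. -/
theorem eq_one_add_of_zeros {a c : ℝ} (ha : 0 < a) (hc : 0 < c)
    (hD : ∀ z₁ z₂ : ℂ, ‖z₁‖ < 1 → ‖z₂‖ < 1 → poly a c z₁ z₂ ≠ 0)
    (hT : ∃ z₁ z₂ : ℂ, ‖z₁‖ = 1 ∧ ‖z₂‖ = 1 ∧ poly a c z₁ z₂ = 0) : a = 1 + c := by
  refine le_antisymm ?_ ?_
  · obtain ⟨z₁, z₂, h1, h2, h⟩ := hT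
    have h3 : (a : ℂ) = z₁ - c * z₂ := by unfold poly at h; linear_combination h
    have h4 := norm_sub_le z₁ (c * z₂)
    rw [← h3, norm_mul, h1, h2, Complex.norm_real, Complex.norm_real,
      Real.norm_of_nonneg ha.le, Real.norm_of_nonneg hc.le] at h4
    linarith
  · by_contra! h
    have key : ∀ x y : ℝ, |x| < 1 → |y| < 1 → a - x + c * y ≠ 0 := by
      intro x y hx hy h0
      refine hD x y ?_ ?_ ?_
      · rwa [Complex.norm_real]
      · rwa [Complex.norm_real]
      · rw [poly]; exact_mod_cast h0
    have h1 : |a / (1 + c)| < 1 := by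
      rw [abs_of_pos (by positivity), div_lt_one (by positivity)]
      exact h
    refine key (a / (1 + c)) (-(a / (1 + c))) h1 (by rwa [abs_neg]) ?_
    field_simp
    ring

end Bidisk

end

theorem theorem6p1 (a c : ℝ) (ha : 0 < a) (hc : 0 < c)
    (hD : ∀ z₁ z₂ : ℂ, ‖z₁‖ < 1 → ‖z₂‖ < 1 → Bidisk.poly a c z₁ z₂ ≠ 0)
    (hT : ∃ z₁ z₂ : ℂ, ‖z₁‖ = 1 ∧ ‖z₂‖ = 1 ∧ Bidisk.poly a c z₁ z₂ = 0) :
    -- decompositions as in the definition of the compressed shift exist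
    (∃ S₁ S₂ : Submodule ℂ Bidisk.L2,
      Bidisk.IsInvariantDecomposition (Bidisk.bigTheta a c) S₁ S₂) ∧
    -- for each of them, the boundary of the numerical range is the curve
    (∀ (S₁ S₂ : Submodule ℂ Bidisk.L2) [S₂.HasOrthogonalProjection],
      Bidisk.IsInvariantDecomposition (Bidisk.bigTheta a c) S₁ S₂ →
        frontier (Bidisk.numericalRange (Bidisk.compression (Bidisk.mulCoord 0) S₂)) =
          Bidisk.curve a c '' Set.Ico 0 (2 * Real.pi)) ∧
    -- the curve is an envelope of the family of circles
    Bidisk.IsEnvelopeOn (Bidisk.circleFamily a c) (fun θ => (Bidisk.curve a c θ).re)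
      (fun θ => (Bidisk.curve a c θ).im) (Set.Ioo 0 (2 * Real.pi)) ∧
    -- it is the outer one: it lies outside the closed disk bounded by the circle of the centres,
    -- and it encloses all the disks bounded by the circles of the family
    (∀ θ ∈ Set.Ioo 0 (2 * Real.pi), Bidisk.curve a c θ ∉
      Metric.closedBall ((a / (a + c) : ℝ) : ℂ) (c / (a + c))) ∧
    (∀ θ : ℝ, Metric.closedBall (Bidisk.center a c θ) (Bidisk.radius a c θ) ⊆
      convexHull ℝ (Bidisk.curve a c '' Set.Ico 0 (2 * Real.pi))) := by
  have hac := Bidisk.eq_one_add_of_zeros ha hc hD hT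
  exact ⟨⟨_, _, Bidisk.isInvariantDecomposition_maxInvariant hc hac⟩,
    fun _ _ _ h => h.frontier_numericalRange hc hac, Bidisk.isEnvelopeOn_circleFamily ha hc,
    fun _ hθ => Bidisk.curve_notMem_closedBall ha hc hθ,
    Bidisk.closedBall_subset_convexHull_curve ha hc⟩
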